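/- Consider ordered rooted binary trees in which every interior node has exactly two ordered children. A right rotation replaces, at some node, a subtree of the form $((A,B),C)$ by $(A,(B,C))$; a left rotation is the inverse operation. For two such trees $T_1,T_2$ with the same number of leaves, the rotation distance $d_R(T_1,T_2)$ is the minimum number of (left or right) rotations that transform $T_1$ into $T_2$. The problem \textsc{Rotation Distance} has as input two such trees $T_1,T_2$ with the same number $n$ of leaves and a parameter $k\in\mathbb{N}$, and asks whether $d_R(T_1,T_2)\le k$. \textbf{Corollary.} \textsc{Rotation Distance} is fixed-parameter tractable in the parameter $k$: there are a constant $c$, a function $f$ and an algorithm that decides every input $\langle x,k\rangle$, $x=(T_1,T_2)$, in time $O(f(k)\,|x|^c)$. More precisely, there are an algorithm and a constant $C$ such that for all $n\geq 1$, all trees $T_1,T_2$ with $n$ leaves each and all $k\ge 0$ the algorithm decides whether $d_R(T_1,T_2)\le k$ in at most $C\,\bigl(n+(7k)^k\bigr)$ steps (with $0^0=1$). Here algorithms are programs of a random access machine with unit cost, whose elementary operations are loading constants, copying, addition, truncated subtraction, indirect reading and writing of memory, and testing a register for zero; the trees are given in memory by their preorder bit codes ($1$ for an interior node, $0$ for a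 leaf), $|x|$ is the total length of these codes, which is $4n-2$, and $k$ is given in a register. -/

import Mathlib

/-! ### Ordered rooted binary trees and rotation distance -/

/-- Ordered rooted binary trees in which every interior node has two (ordered) children; `nil` is
the tree with a single leaf. The leaves are implicitly numbered from left to right. -/
abbrev OTree : Type := BinaryTree Unit

/-- `RightRotation s t`: the tree `t` arises from `s` by one right rotation, performed at the root
or at any other node of `s`. -/
inductive RightRotation : OTree → OTree → Prop
  | root (a b c : OTree) :
      RightRotation (.node () (.node () a b) c) (.node () a (.node () b c))
  | left {a a' : OTree} (b : OTree) (h : RightRotation a a') :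
      RightRotation (.node () a b) (.node () a' b)
  | right (a : OTree) {b b' : OTree} (h : RightRotation b b') :
      RightRotation (.node () a b) (.node () a b')

/-- The rotation graph: two trees are adjacent if one right rotation, or its inverse, a left
rotation, transforms the first one into the second one. -/
def rotationGraph : SimpleGraph OTree := SimpleGraph.fromRel RightRotation

/-- The rotation distance: the least number of rotations that transform `s` into `t`
(`⊤` if there is no such sequence of rotations). -/
noncomputable def rotationDist (s t : OTree) : ℕ∞ := rotationGraph.edist s t

/-- The preorder code of a tree: `true` for an interior node, `false` for a leaf. -/
def OTree.code : OTree → List Bool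
  | .nil => [false]
  | .node _ l r => true :: (OTree.code l ++ OTree.code r)

/-! ### Random access machines with unit cost -/

namespace RAM

/-- Finitely many registers (those that a program mentions) and a memory with random access, all
holding natural numbers. -/
structure State where
  reg : ℕ → ℕ
  mem : ℕ → ℕ

/-- The elementary instructions. -/
inductive Instr : Type
  /-- `reg r := c` -/
  | const (r c : ℕ)
  /-- `reg r := reg a` -/
  | copy (r a : ℕ)
  /-- `reg r := reg a + reg b` -/
  | add (r a b : ℕ)
  /-- `reg r := reg a - reg b`, truncated at `0` -/
  | sub (r a b : ℕ)
  /-- `reg r := mem (reg a)` -/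
  | load (r a : ℕ)
  /-- `mem (reg a) := reg r` -/
  | store (a r : ℕ)

/-- The effect of an elementary instruction. -/
def Instr.run : Instr → State → State
  | .const r c, s => { s with reg := Function.update s.reg r c }
  | .copy r a, s => { s with reg := Function.update s.reg r (s.reg a) }
  | .add r a b, s => { s with reg := Function.update s.reg r (s.reg a + s.reg b) }
  | .sub r a b, s => { s with reg := Function.update s.reg r (s.reg a - s.reg b) }
  | .load r a, s => { s with reg := Function.update s.reg r (s.mem (s.reg a)) }
  | .store a r, s => { s with mem := Function.update s.mem (s.reg a) (s.reg r) }

/-- Programs: finite structured compositions of elementary instructions. -/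
inductive Prog : Type
  | instr (i : Instr)
  | seq (p q : Prog)
  /-- if `reg r ≠ 0` then `p` else `q` -/
  | ite (r : ℕ) (p q : Prog)
  /-- while `reg r ≠ 0` do `p` -/
  | loop (r : ℕ) (p : Prog)

/-- `Exec p s s' t`: started in the state `s`, the program `p` halts in the state `s'` after exactly
`t` steps. Every elementary instruction and every test of a register is one step. -/
inductive Exec : Prog → State → State → ℕ → Prop
  | instr (i : Instr) (s : State) : Exec (.instr i) s (i.run s) 1
  | seq {p q : Prog} {s s' s'' : State} {t t' : ℕ} (hp : Exec p s s' t) (hq : Exec q s' s'' t') :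
      Exec (.seq p q) s s'' (t + t')
  | ite_true {r : ℕ} {p q : Prog} {s s' : State} {t : ℕ} (hr : s.reg r ≠ 0) (hp : Exec p s s' t) :
      Exec (.ite r p q) s s' (t + 1)
  | ite_false {r : ℕ} {p q : Prog} {s s' : State} {t : ℕ} (hr : s.reg r = 0) (hq : Exec q s s' t) :
      Exec (.ite r p q) s s' (t + 1)
  | loop_done {r : ℕ} {p : Prog} {s : State} (hr : s.reg r = 0) : Exec (.loop r p) s s 1
  | loop_step {r : ℕ} {p : Prog} {s s' s'' : State} {t t' : ℕ} (hr : s.reg r ≠ 0)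
      (hp : Exec p s s' t) (hl : Exec (.loop r p) s' s'' t') : Exec (.loop r p) s s'' (t + t' + 1)

/-- Final state and running time are determined by the program and the initial state. -/
theorem Exec.unique {p : Prog} {s s₁ s₂ : State} {t₁ t₂ : ℕ} (h₁ : Exec p s s₁ t₁)
    (h₂ : Exec p s s₂ t₂) : s₁ = s₂ ∧ t₁ = t₂ := by
  induction h₁ generalizing s₂ t₂ with
  | instr i s => cases h₂; exact ⟨rfl, rfl⟩
  | seq _ _ ihp ihq =>
    cases h₂ with
    | seq hp' hq' =>
      obtain ⟨rfl, rfl⟩ := ihp hp'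
      obtain ⟨rfl, rfl⟩ := ihq hq'
      exact ⟨rfl, rfl⟩
  | ite_true hr _ ih =>
    cases h₂ with
    | ite_true _ hp' => obtain ⟨rfl, rfl⟩ := ih hp'; exact ⟨rfl, rfl⟩
    | ite_false hr' _ => exact absurd hr' hr
  | ite_false hr _ ih =>
    cases h₂ with
    | ite_true hr' _ => exact absurd hr hr'
    | ite_false _ hp' => obtain ⟨rfl, rfl⟩ := ih hp'; exact ⟨rfl, rfl⟩
  | loop_done hr =>
    cases h₂ with
    | loop_done _ => exact ⟨rfl, rfl⟩
    | loop_step hr' _ _ => exact absurd hr hr'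
  | loop_step hr _ _ ihp ihl =>
    cases h₂ with
    | loop_done hr' => exact absurd hr' hr
    | loop_step _ hp' hl' =>
      obtain ⟨rfl, rfl⟩ := ihp hp'
      obtain ⟨rfl, rfl⟩ := ihl hl'
      exact ⟨rfl, rfl⟩

/-- The initial state on the input `⟨w, k⟩`: register `0` holds `k`, register `1` holds the length
of the word `w`, memory cell `i` holds the `i`-th letter of `w`; everything else is `0`. -/
def init (w : List Bool) (k : ℕ) : State where
  reg := fun r => if r = 0 then k else if r = 1 then w.length else 0
  mem := fun i => if w.getD i false then 1 else 0

end RAM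

/-! ### Parameterized problems and fixed-parameter tractability -/

/-- A parameterized decision problem: instances `x`, coded by words over `{0, 1}`, and the set of
pairs `⟨x, k⟩` with answer yes, where the natural number `k` is the parameter. -/
structure ParamProblem where
  Inst : Type
  encode : Inst → List Bool
  Yes : Inst → ℕ → Prop

namespace ParamProblem

open Classical in
/-- The program `p` decides the problem `Q`: on every input `⟨x, k⟩` it halts after at most `T x k`
steps, with `1` in register `0` if the answer is yes and with `0` there if the answer is no. -/
def DecidedInTime (Q : ParamProblem) (p : RAM.Prog) (T : Q.Inst → ℕ → ℕ) : Prop :=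
  ∀ (x : Q.Inst) (k : ℕ), ∃ (s : RAM.State) (t : ℕ),
    RAM.Exec p (RAM.init (Q.encode x) k) s t ∧ t ≤ T x k ∧
      s.reg 0 = if Q.Yes x k then 1 else 0

/-- `Q` is fixed-parameter tractable: for some constant `c` and some function `f`, one program
decides `⟨x, k⟩` in time `O(f(k) |x| ^ c)`. -/
def FixedParameterTractable (Q : ParamProblem) : Prop :=
  ∃ (p : RAM.Prog) (c C : ℕ) (f : ℕ → ℕ),
    Q.DecidedInTime p fun x k => C * (f k * (Q.encode x).length ^ c)

end ParamProblem

/-- A pair of ordered rooted trees with the same number of leaves. -/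
structure TreePair where
  fst : OTree
  snd : OTree
  numLeaves_eq : fst.numLeaves = snd.numLeaves

/-- The problem Rotation Distance: given two ordered rooted trees with the same number of leaves,
and the parameter `k`, is their rotation distance at most `k`? -/
def rotationDistanceProblem : ParamProblem where
  Inst := TreePair
  encode := fun x => OTree.code x.fst ++ OTree.code x.snd
  Yes := fun x k => rotationDist x.fst x.snd ≤ (k : ℕ∞)

/-! ### The rotation distance as a metric -/

/-! Number the leaves and record for every subtree the interval of its leaves. A rotation replaces
just one of these intervals, so at distance at most `k` at most `k` intervals of one tree are
missing from the other (`countP_ivs_le_rotationDist`).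

Intervals common to both trees cut the problem into independent pieces. Restricting a tree to an
interval of leaves, or contracting that interval to one leaf, turns a rotation into at most one
rotation, and no rotation is visible in both images. Hence distances add up when trees with equal
numbers of leaves are plugged into the same leaves (`rotationDist_plug`, `rotationDist_subst`).

Call a node trivial if its interval and those of its two children are common. The other tree then
has the same split there, and the distance is the sum over the two sides. Hanging the right side
onto the last leaf of the left side gives the same sum with one node fewer. Removing all trivial
nodes produces kernels with the same distance (`kernel_spec`). Every node that is kept involves an
interval that is not common, so the kernels have at most `2 * k + 1` leaves (`numLeaves_kernel_le`),
and their codes have length at most `4 * k + 1`.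

The kernels can be computed in linear time. A scan from right to left finds the ends of all subtrees
and, for each endpoint, the longest interval that begins or ends there. A subtree other than the
whole tree is a left or a right child, hence longest at one of its two endpoints, so commonness is
tested in constant time (`Detects.node`, `scan_tree`). A pass from left to right then emits the
kernel's code (`emit_tree`), since removing a trivial node deletes two letters.

If the kernels are too large, the answer is no. Otherwise all sequences of `k` positions in a code
of length `m ≤ 4 * k + 1` are tried. On codes a rotation moves one block by one cell, so a sequence
costs `O((k + 1) * (m + 1))`, and the total is absorbed by `(7 * k) ^ k` (`search_cost_le`).

Running times are tracked by `Realizes`, on a machine with variables and arrays that is simulated by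
the random access machine. -/

theorem rotationDist_self (s : OTree) : rotationDist s s = 0 := SimpleGraph.edist_self

theorem rotationDist_comm (s t : OTree) : rotationDist s t = rotationDist t s :=
  SimpleGraph.edist_comm

theorem rotationDist_triangle (s t u : OTree) :
    rotationDist s u ≤ rotationDist s t + rotationDist t u :=
  SimpleGraph.edist_triangle

theorem RightRotation.rotationDist_le_one {s t : OTree} (h : RightRotation s t) :
    rotationDist s t ≤ 1 := by
  by_cases hst : s = t
  · subst hst; simp [rotationDist_self]
  · refine SimpleGraph.edist_le_one_iff_adj_or_eq.2 (Or.inl ?_)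
    exact ⟨hst, Or.inl h⟩

/-- A pseudometric for which rotations have length at most one is bounded by the rotation
distance. -/
theorem le_rotationDist (F : OTree → OTree → ℕ∞) (h0 : ∀ s, F s s = 0)
    (hsymm : ∀ s t, F s t = F t s) (htri : ∀ s t u, F s u ≤ F s t + F t u)
    (hrot : ∀ s t, RightRotation s t → F s t ≤ 1) (s t : OTree) : F s t ≤ rotationDist s t := by
  by_cases h : rotationDist s t = ⊤
  · rw [h]; exact le_top
  · obtain ⟨p, hp⟩ := SimpleGraph.exists_walk_of_edist_ne_top h
    change _ ≤ rotationGraph.edist s t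
    rw [← hp]
    clear hp h
    induction p with
    | nil => simp [h0]
    | @cons u v w hadj p ih =>
      refine (htri u v w).trans ?_
      have h1 : F u v ≤ 1 := by
        rcases hadj.2 with h | h
        · exact hrot _ _ h
        · rw [hsymm]; exact hrot _ _ h
      rw [SimpleGraph.Walk.length_cons]
      push_cast
      rw [add_comm]
      exact add_le_add ih h1

/-- The pullback of the distance along `φ` is again a pseudometric, so a Lipschitz bound on single
rotations suffices. -/
theorem rotationDist_map_le (φ : OTree → OTree)
    (h : ∀ s t, RightRotation s t → rotationDist (φ s) (φ t) ≤ 1) (s t : OTree) :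
    rotationDist (φ s) (φ t) ≤ rotationDist s t :=
  le_rotationDist (fun s t => rotationDist (φ s) (φ t)) (fun _ => rotationDist_self _)
    (fun _ _ => rotationDist_comm _ _) (fun _ _ _ => rotationDist_triangle _ _ _) h s t

theorem RightRotation.numLeaves_eq {s t : OTree} (h : RightRotation s t) :
    s.numLeaves = t.numLeaves := by
  induction h with
  | root a b c => simp [BinaryTree.numLeaves]; omega
  | left b _ ih => simp [BinaryTree.numLeaves, ih]
  | right a _ ih => simp [BinaryTree.numLeaves, ih]

namespace OTree

theorem one_le_numLeaves (s : OTree) : 1 ≤ s.numLeaves := s.numLeaves_pos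

/-! ### Restriction of a tree to a set of leaves -/

/-- Join two possibly empty trees. -/
def join : Option OTree → Option OTree → Option OTree
  | none, t => t
  | some s, none => some s
  | some s, some t => some (.node () s t)

/-- The tree induced on the leaves whose number satisfies `p`, where the leaves are numbered from
`o` on. -/
def restr (p : ℕ → Bool) : ℕ → OTree → Option OTree
  | o, .nil => if p o then some .nil else none
  | o, .node _ l r => join (restr p o l) (restr p (o + l.numLeaves) r)

/-- At most one rotation leads from `s` to `t`. -/
def RotOrEq (s t : Option OTree) : Prop :=
  s = t ∨ ∃ a b, s = some a ∧ t = some b ∧ RightRotation a b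

theorem RotOrEq.join_left {s t : Option OTree} (h : RotOrEq s t) (u : Option OTree) :
    RotOrEq (join s u) (join t u) := by
  rcases h with rfl | ⟨a, b, rfl, rfl, h⟩
  · exact Or.inl rfl
  · cases u with
    | none => exact Or.inr ⟨a, b, rfl, rfl, h⟩
    | some u => exact Or.inr ⟨_, _, rfl, rfl, .left u h⟩

theorem RotOrEq.join_right {s t : Option OTree} (h : RotOrEq s t) (u : Option OTree) :
    RotOrEq (join u s) (join u t) := by
  rcases h with rfl | ⟨a, b, rfl, rfl, h⟩
  · exact Or.inl rfl
  · cases u with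
    | none => exact Or.inr ⟨a, b, rfl, rfl, h⟩
    | some u => exact Or.inr ⟨_, _, rfl, rfl, .right u h⟩

/-- If all three parts of `((A,B),C)` keep a leaf, the restricted trees differ by the same rotation.
Once one part vanishes, both bracketings of the others coincide. -/
theorem restr_rotOrEq (p : ℕ → Bool) {s t : OTree} (h : RightRotation s t) (o : ℕ) :
    RotOrEq (restr p o s) (restr p o t) := by
  induction h generalizing o with
  | root a b c =>
    simp only [restr, BinaryTree.numLeaves, ← add_assoc]
    cases restr p o a <;> cases restr p (o + a.numLeaves) b <;>
      cases restr p (o + a.numLeaves + b.numLeaves) c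
    case some.some.some a b c => exact Or.inr ⟨_, _, rfl, rfl, .root a b c⟩
    all_goals exact Or.inl rfl
  | left b h ih =>
    simp only [restr, h.numLeaves_eq]
    exact (ih o).join_left _
  | right a h ih =>
    simp only [restr]
    exact (ih _).join_right _

theorem restr_eq_none {p : ℕ → Bool} {s : OTree} {o : ℕ}
    (h : ∀ x, o ≤ x → x < o + s.numLeaves → p x = false) : restr p o s = none := by
  induction s generalizing o with
  | nil => simp [restr, h o le_rfl (by simp [BinaryTree.numLeaves])]
  | node _ l r ihl ihr =>
    simp only [BinaryTree.numLeaves] at h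
    rw [restr, ihl fun x h1 h2 => h x h1 (by omega), ihr fun x h1 h2 => h x (by omega) (by omega)]
    rfl

theorem restr_eq_self {p : ℕ → Bool} {s : OTree} {o : ℕ}
    (h : ∀ x, o ≤ x → x < o + s.numLeaves → p x = true) : restr p o s = some s := by
  induction s generalizing o with
  | nil => simp [restr, h o le_rfl (by simp [BinaryTree.numLeaves])]
  | node _ l r ihl ihr =>
    simp only [BinaryTree.numLeaves] at h
    rw [restr, ihl fun x h1 h2 => h x h1 (by omega), ihr fun x h1 h2 => h x (by omega) (by omega)]
    rfl

theorem exists_of_restr_ne_none {p : ℕ → Bool} {s : OTree} {o : ℕ} (h : restr p o s ≠ none) :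
    ∃ x, o ≤ x ∧ x < o + s.numLeaves ∧ p x = true := by
  by_contra! hc
  exact h (restr_eq_none fun x h1 h2 => by simpa using hc x h1 h2)

/-- Only the first leaf is kept. -/
theorem restr_eq_nil {p : ℕ → Bool} {s : OTree} {o : ℕ} (h0 : p o = true)
    (h : ∀ x, o < x → x < o + s.numLeaves → p x = false) : restr p o s = some .nil := by
  induction s generalizing o with
  | nil => simp [restr, h0]
  | node _ l r ihl ihr =>
    simp only [BinaryTree.numLeaves] at h
    have := one_le_numLeaves l
    rw [restr, ihl h0 fun x h1 h2 => h x h1 (by omega),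
      restr_eq_none fun x h1 h2 => h x (by omega) (by omega)]
    rfl

/-- The leaves from `i` to `i + m - 1`. -/
def inside (i m : ℕ) (x : ℕ) : Bool := i ≤ x ∧ x < i + m

/-- The leaves that are not among those from `i + 1` to `i + m - 1`. -/
def outside (i m : ℕ) (x : ℕ) : Bool := x ≤ i ∨ i + m ≤ x

/-- A rotation cannot change both the tree induced on an interval of leaves and the tree that
arises by contracting that interval. -/
theorem restr_inside_or_outside (i m : ℕ) {s t : OTree} (h : RightRotation s t) (o : ℕ) :
    restr (inside i m) o s = restr (inside i m) o t ∨
      restr (outside i m) o s = restr (outside i m) o t := by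
  induction h generalizing o with
  | root a b c =>
    simp only [restr, BinaryTree.numLeaves, ← add_assoc]
    by_cases ha : restr (inside i m) o a = none
    · left; rw [ha]; rfl
    by_cases hc : restr (inside i m) (o + a.numLeaves + b.numLeaves) c = none
    · left; rw [hc]
      cases restr (inside i m) o a <;> cases restr (inside i m) (o + a.numLeaves) b <;> rfl
    -- Now `a` and `c` both meet the interval, so all leaves of `b` lie in it and behind its first
    -- leaf, the only one of the interval that `outside` keeps. With `b` gone, the two bracketings
    -- of `a` and `c` agree.
    right
    obtain ⟨x, hx1, hx2, hx⟩ := exists_of_restr_ne_none ha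
    obtain ⟨y, hy1, hy2, hy⟩ := exists_of_restr_ne_none hc
    simp only [inside, decide_eq_true_eq] at hx hy
    have hb : restr (outside i m) (o + a.numLeaves) b = none :=
      restr_eq_none fun z h1 h2 => by simp only [outside, decide_eq_false_iff_not]; omega
    rw [hb]
    cases restr (outside i m) o a <;>
      cases restr (outside i m) (o + a.numLeaves + b.numLeaves) c <;> rfl
  | left b h ih =>
    simp only [restr, h.numLeaves_eq]
    rcases ih o with h | h <;> simp [h]
  | right a h ih =>
    simp only [restr]
    rcases ih (o + a.numLeaves) with h | h <;> simp [h]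

theorem RotOrEq.rotationDist_le_one {s t : Option OTree} (h : RotOrEq s t) :
    rotationDist (s.getD .nil) (t.getD .nil) ≤ 1 := by
  rcases h with rfl | ⟨a, b, rfl, rfl, h⟩
  · simp [rotationDist_self]
  · exact h.rotationDist_le_one

/-- The sum on the left is a pseudometric in `s` and `t`. A rotation has length at most one in it,
because one summand vanishes and the other is at most one. -/
theorem add_restr_le_rotationDist (i m : ℕ) (s t : OTree) :
    rotationDist ((restr (inside i m) 0 s).getD .nil) ((restr (inside i m) 0 t).getD .nil) +
      rotationDist ((restr (outside i m) 0 s).getD .nil) ((restr (outside i m) 0 t).getD .nil) ≤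
      rotationDist s t := by
  refine le_rotationDist (fun s t =>
    rotationDist ((restr (inside i m) 0 s).getD .nil) ((restr (inside i m) 0 t).getD .nil) +
      rotationDist ((restr (outside i m) 0 s).getD .nil) ((restr (outside i m) 0 t).getD .nil))
    ?_ ?_ ?_ ?_ s t
  · intro s; simp [rotationDist_self]
  · intro s t; simp only [rotationDist_comm]
  · intro s t u
    refine (add_le_add (rotationDist_triangle _ ((restr (inside i m) 0 t).getD .nil) _)
      (rotationDist_triangle _ ((restr (outside i m) 0 t).getD .nil) _)).trans_eq ?_
    abel
  · intro s t h
    rcases restr_inside_or_outside i m h 0 with h1 | h1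
    · simp only [h1, rotationDist_self, zero_add]
      exact (restr_rotOrEq _ h 0).rotationDist_le_one
    · simp only [h1, rotationDist_self, add_zero]
      exact (restr_rotOrEq _ h 0).rotationDist_le_one

/-! ### Substitution of trees for leaves -/

/-- The tree `s` with its leaf number `i` replaced by `t`. -/
def plug : OTree → ℕ → OTree → OTree
  | .nil, _, t => t
  | .node _ l r, i, t =>
    if i < l.numLeaves then .node () (plug l i t) r else .node () l (plug r (i - l.numLeaves) t)

theorem numLeaves_plug {s : OTree} {i : ℕ} (hi : i < s.numLeaves) (t : OTree) :
    (plug s i t).numLeaves + 1 = s.numLeaves + t.numLeaves := by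
  induction s generalizing i with
  | nil => simp [plug, BinaryTree.numLeaves, add_comm]
  | node _ l r ihl ihr =>
    simp only [BinaryTree.numLeaves] at hi
    by_cases h : i < l.numLeaves
    · have := ihl h
      simp only [plug, h, if_true, BinaryTree.numLeaves]; omega
    · have := ihr (i := i - l.numLeaves) (by omega)
      simp only [plug, h, if_false, BinaryTree.numLeaves]; omega

theorem rotationDist_node_left_le (l l' r : OTree) :
    rotationDist (.node () l r) (.node () l' r) ≤ rotationDist l l' :=
  rotationDist_map_le (fun l => .node () l r)
    (fun _ _ h => (RightRotation.left r h).rotationDist_le_one) l l'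

theorem rotationDist_node_right_le (l r r' : OTree) :
    rotationDist (.node () l r) (.node () l r') ≤ rotationDist r r' :=
  rotationDist_map_le (fun r => .node () l r)
    (fun _ _ h => (RightRotation.right l h).rotationDist_le_one) r r'

theorem rotationDist_plug_right_le (s : OTree) (i : ℕ) (t t' : OTree) :
    rotationDist (plug s i t) (plug s i t') ≤ rotationDist t t' := by
  induction s generalizing i with
  | nil => exact le_rfl
  | node _ l r ihl ihr =>
    by_cases h : i < l.numLeaves
    · simp only [plug, h, if_true]; exact (rotationDist_node_left_le _ _ _).trans (ihl _)
    · simp only [plug, h, if_false]; exact (rotationDist_node_right_le _ _ _).trans (ihr _)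

theorem _root_.RightRotation.plug {s s' : OTree} (h : RightRotation s s') (i : ℕ) (t : OTree) :
    RightRotation (plug s i t) (plug s' i t) := by
  induction h generalizing i with
  | root a b c =>
    simp only [OTree.plug, BinaryTree.numLeaves]
    by_cases h1 : i < a.numLeaves
    · simp only [h1, if_true, show i < a.numLeaves + b.numLeaves by omega]
      exact .root _ _ _
    · by_cases h2 : i < a.numLeaves + b.numLeaves
      · simp only [h1, h2, if_true, if_false, show i - a.numLeaves < b.numLeaves by omega]
        exact .root _ _ _
      · simp only [h1, h2, if_false, show ¬ i - a.numLeaves < b.numLeaves by omega, Nat.sub_sub]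
        exact .root _ _ _
  | left b h ih =>
    simp only [OTree.plug, h.numLeaves_eq]
    split_ifs
    · exact .left _ (ih _)
    · exact .left _ h
  | right a h ih =>
    simp only [OTree.plug]
    split_ifs
    · exact .right _ h
    · exact .right _ (ih _)

theorem rotationDist_plug_left_le (s s' : OTree) (i : ℕ) (t : OTree) :
    rotationDist (plug s i t) (plug s' i t) ≤ rotationDist s s' :=
  rotationDist_map_le (fun s => plug s i t) (fun _ _ h => (h.plug i t).rotationDist_le_one) s s'

theorem restr_inside_plug {s : OTree} {i : ℕ} (hi : i < s.numLeaves) (t : OTree) (o : ℕ) :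
    restr (inside (o + i) t.numLeaves) o (plug s i t) = some t := by
  induction s generalizing i o with
  | nil =>
    simp only [BinaryTree.numLeaves] at hi
    obtain rfl : i = 0 := by omega
    rw [plug]
    exact restr_eq_self fun x h1 h2 => by simp only [inside, decide_eq_true_eq]; omega
  | node _ l r ihl ihr =>
    simp only [BinaryTree.numLeaves] at hi
    by_cases h : i < l.numLeaves
    · simp only [plug, h, if_true, restr, ihl h]
      have := numLeaves_plug h t
      rw [restr_eq_none fun x h1 h2 => by simp only [inside, decide_eq_false_iff_not]; omega]
      rfl
    · simp only [plug, h, if_false, restr]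
      rw [restr_eq_none (s := l) fun x h1 h2 => by
        simp only [inside, decide_eq_false_iff_not]; omega]
      have := ihr (i := i - l.numLeaves) (by omega) (o + l.numLeaves)
      rw [show o + l.numLeaves + (i - l.numLeaves) = o + i by omega] at this
      rw [this]; rfl

theorem restr_outside_plug {s : OTree} {i : ℕ} (hi : i < s.numLeaves) (t : OTree) (o : ℕ) :
    restr (outside (o + i) t.numLeaves) o (plug s i t) = some s := by
  have ht := one_le_numLeaves t
  induction s generalizing i o with
  | nil =>
    simp only [BinaryTree.numLeaves] at hi
    obtain rfl : i = 0 := by omega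
    rw [plug]
    exact restr_eq_nil (by simp [outside]) fun x h1 h2 => by
      simp only [outside, decide_eq_false_iff_not]; omega
  | node _ l r ihl ihr =>
    simp only [BinaryTree.numLeaves] at hi
    by_cases h : i < l.numLeaves
    · simp only [plug, h, if_true, restr, ihl h]
      have := numLeaves_plug h t
      rw [restr_eq_self fun x h1 h2 => by simp only [outside, decide_eq_true_eq]; omega]
      rfl
    · simp only [plug, h, if_false, restr]
      rw [restr_eq_self (s := l) fun x h1 h2 => by
        simp only [outside, decide_eq_true_eq]; omega]
      have := ihr (i := i - l.numLeaves) (by omega) (o + l.numLeaves)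
      rw [show o + l.numLeaves + (i - l.numLeaves) = o + i by omega] at this
      rw [this]; rfl

/-- Subtrees with the same leaves are never broken up by a shortest sequence of rotations. -/
theorem rotationDist_plug {s s' t t' : OTree} {i : ℕ} (hi : i < s.numLeaves)
    (hs : s.numLeaves = s'.numLeaves) (ht : t.numLeaves = t'.numLeaves) :
    rotationDist (plug s i t) (plug s' i t') = rotationDist s s' + rotationDist t t' := by
  apply le_antisymm
  · exact (rotationDist_triangle _ (plug s' i t) _).trans
      (add_le_add (rotationDist_plug_left_le _ _ _ _) (rotationDist_plug_right_le _ _ _ _))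
  · have h := add_restr_le_rotationDist i t.numLeaves (plug s i t) (plug s' i t')
    have h1 := restr_inside_plug hi t 0
    have h2 := restr_outside_plug hi t 0
    have h3 := restr_inside_plug (hs ▸ hi) t' 0
    have h4 := restr_outside_plug (hs ▸ hi) t' 0
    simp only [zero_add, ← ht] at h1 h2 h3 h4
    rw [h1, h2, h3, h4] at h
    rw [add_comm]
    exact h

/-- The tree `s` with its leaves from number `i` on replaced by the trees of the list. -/
def subst (s : OTree) : List OTree → ℕ → OTree
  | [], _ => s
  | t :: ts, i => plug (subst s ts (i + 1)) i t

/-- `subst` plugs from right to left, so that the numbers of the leaves still to be replaced do not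
move. This bound keeps those numbers valid. -/
theorem numLeaves_le_subst (s : OTree) (ts : List OTree) (i : ℕ) (h : i + ts.length ≤ s.numLeaves) :
    s.numLeaves ≤ (subst s ts i).numLeaves := by
  induction ts generalizing i with
  | nil => exact le_rfl
  | cons t ts ih =>
    simp only [List.length_cons] at h
    have h1 := ih (i + 1) (by omega)
    have h2 := numLeaves_plug (s := subst s ts (i + 1)) (i := i) (by omega) t
    have h3 := one_le_numLeaves t
    simp only [subst]; omega

theorem numLeaves_subst_congr {s s' : OTree} {ts ts' : List OTree} {i : ℕ}
    (hs : s.numLeaves = s'.numLeaves)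
    (hts : List.Forall₂ (fun t t' : OTree => t.numLeaves = t'.numLeaves) ts ts')
    (h : i + ts.length ≤ s.numLeaves) :
    (subst s ts i).numLeaves = (subst s' ts' i).numLeaves := by
  induction hts generalizing i with
  | nil => exact hs
  | @cons t t' ts ts' ht hts ih =>
    simp only [List.length_cons] at h
    have hlen := hts.length_eq
    have h1 := numLeaves_le_subst s ts (i + 1) (by omega)
    have h1' := numLeaves_le_subst s' ts' (i + 1) (by omega)
    have h2 := numLeaves_plug (s := subst s ts (i + 1)) (i := i) (by omega) t
    have h2' := numLeaves_plug (s := subst s' ts' (i + 1)) (i := i) (by omega) t'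
    have := ih (i := i + 1) (by omega)
    simp only [subst]; omega

theorem rotationDist_subst {s s' : OTree} {ts ts' : List OTree} {i : ℕ}
    (hs : s.numLeaves = s'.numLeaves)
    (hts : List.Forall₂ (fun t t' : OTree => t.numLeaves = t'.numLeaves) ts ts')
    (h : i + ts.length ≤ s.numLeaves) :
    rotationDist (subst s ts i) (subst s' ts' i) =
      rotationDist s s' + (List.zipWith rotationDist ts ts').sum := by
  induction hts generalizing i with
  | nil => simp [subst]
  | @cons t t' ts ts' ht hts ih =>
    simp only [List.length_cons] at h
    have h1 := numLeaves_le_subst s ts (i + 1) (by omega)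
    rw [subst, subst, rotationDist_plug (by omega)
      (numLeaves_subst_congr hs hts (by omega)) ht, ih (by omega)]
    simp only [List.zipWith_cons_cons, List.sum_cons]
    abel

theorem subst_node_right (l r : OTree) (ts : List OTree) (i : ℕ) :
    subst (.node () l r) ts (l.numLeaves + i) = .node () l (subst r ts i) := by
  induction ts generalizing i with
  | nil => rfl
  | cons t ts ih => simp [subst, add_assoc, ih, plug]

theorem subst_node (l r : OTree) (ts ts' : List OTree) (i : ℕ) (h : i + ts.length = l.numLeaves) :
    subst (.node () l r) (ts ++ ts') i = .node () (subst l ts i) (subst r ts' 0) := by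
  induction ts generalizing i with
  | nil =>
    simp only [List.length_nil, add_zero] at h
    subst h
    exact subst_node_right l r ts' 0
  | cons t ts ih =>
    simp only [List.length_cons] at h
    have h1 := numLeaves_le_subst l ts (i + 1) (by omega)
    rw [List.cons_append, subst, ih (i + 1) (by omega), plug, if_pos (by omega), subst]

/-! ### Intervals of leaves

The leaves are numbered from right to left here; the subtree whose leaves have the numbers
`b + 1, …, a` is represented by the pair `(a, b)`. -/

/-- The intervals of leaves of the subtrees, when there are `b` leaves to the right of the tree. -/
def ivs : ℕ → OTree → List (ℕ × ℕ)
  | b, .nil => [(b + 1, b)]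
  | b, .node _ l r =>
    (b + (r.numLeaves + l.numLeaves), b) :: (ivs (b + r.numLeaves) l ++ ivs b r)

theorem mem_ivs_bounds {b : ℕ} {s : OTree} {x y : ℕ} (h : (x, y) ∈ ivs b s) :
    b ≤ y ∧ y < x ∧ x ≤ b + s.numLeaves := by
  induction s generalizing b with
  | nil => simp [ivs] at h; simp [h, BinaryTree.numLeaves]
  | node _ l r ihl ihr =>
    have := one_le_numLeaves l
    simp only [ivs, List.mem_cons, Prod.mk.injEq, List.mem_append] at h
    simp only [BinaryTree.numLeaves]
    rcases h with h | h | h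
    · omega
    · have := ihl h; omega
    · have := ihr h; omega

theorem root_mem_ivs (b : ℕ) (s : OTree) : (b + s.numLeaves, b) ∈ ivs b s := by
  cases s with
  | nil => simp [ivs, BinaryTree.numLeaves]
  | node _ l r => simp [ivs, BinaryTree.numLeaves, add_comm]

theorem leaf_mem_ivs {b : ℕ} {s : OTree} {x : ℕ} (h1 : b ≤ x) (h2 : x < b + s.numLeaves) :
    (x + 1, x) ∈ ivs b s := by
  induction s generalizing b with
  | nil =>
    simp only [BinaryTree.numLeaves] at h2
    obtain rfl : x = b := by omega
    simp [ivs]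
  | node _ l r ihl ihr =>
    simp only [BinaryTree.numLeaves] at h2
    simp only [ivs, List.mem_cons, List.mem_append]
    by_cases h : x < b + r.numLeaves
    · exact Or.inr (Or.inr (ihr h1 h))
    · exact Or.inr (Or.inl (ihl (by omega) (by omega)))

theorem mem_ivs_node_left {b : ℕ} {l r : OTree} {x y : ℕ} (h : b + r.numLeaves ≤ y) :
    (x, y) ∈ ivs b (.node () l r) ↔ (x, y) ∈ ivs (b + r.numLeaves) l := by
  have := one_le_numLeaves r
  simp only [ivs, List.mem_cons, Prod.mk.injEq, List.mem_append]
  constructor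
  · rintro (h1 | h1 | h1)
    · omega
    · exact h1
    · have := mem_ivs_bounds h1; omega
  · exact fun h1 => Or.inr (Or.inl h1)

theorem mem_ivs_node_right {b : ℕ} {l r : OTree} {x y : ℕ} (h : x ≤ b + r.numLeaves) :
    (x, y) ∈ ivs b (.node () l r) ↔ (x, y) ∈ ivs b r := by
  have := one_le_numLeaves l
  simp only [ivs, List.mem_cons, Prod.mk.injEq, List.mem_append]
  constructor
  · rintro (h1 | h1 | h1)
    · omega
    · have := mem_ivs_bounds h1; omega
    · exact h1
  · exact fun h1 => Or.inr (Or.inr h1)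

/-! ### The kernel -/

/-- The tree `l` with its last leaf replaced by `r`. -/
def graft (l r : OTree) : OTree := plug l (l.numLeaves - 1) r

theorem numLeaves_graft (l r : OTree) :
    (graft l r).numLeaves + 1 = l.numLeaves + r.numLeaves :=
  numLeaves_plug (by have := one_le_numLeaves l; omega) r

theorem rotationDist_graft {l l' r r' : OTree} (hl : l.numLeaves = l'.numLeaves)
    (hr : r.numLeaves = r'.numLeaves) :
    rotationDist (graft l r) (graft l' r') = rotationDist l l' + rotationDist r r' := by
  rw [graft, graft, ← hl]
  exact rotationDist_plug (by have := one_le_numLeaves l; omega) hl hr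

theorem rotationDist_node {l l' r r' : OTree} (hl : l.numLeaves = l'.numLeaves)
    (hr : r.numLeaves = r'.numLeaves) :
    rotationDist (.node () l r) (.node () l' r') = rotationDist l l' + rotationDist r r' := by
  -- A node is a cherry with two leaves substituted, and the cherry contributes distance `0`.
  have h : ∀ l r : OTree, (.node () l r : OTree) =
      subst (.node () .nil .nil) [l, r] 0 := fun l r => rfl
  rw [h l r, h l' r', rotationDist_subst rfl (.cons hl (.cons hr .nil))
    (by simp [BinaryTree.numLeaves])]
  simp [rotationDist_self]

/-- A node is trivial if `c` holds for its interval and for the intervals of its children. -/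
def isTrivial (c : ℕ → ℕ → Bool) (b : ℕ) (l r : OTree) : Bool :=
  c (b + (r.numLeaves + l.numLeaves)) b &&
    (c (b + (r.numLeaves + l.numLeaves)) (b + r.numLeaves) && c (b + r.numLeaves) b)

/-- The kernel: all trivial nodes are removed. -/
def kernel (c : ℕ → ℕ → Bool) : ℕ → OTree → OTree
  | _, .nil => .nil
  | b, .node _ l r =>
    if isTrivial c b l r then graft (kernel c (b + r.numLeaves) l) (kernel c b r)
    else .node () (kernel c (b + r.numLeaves) l) (kernel c b r)

/-- An interval that fails `c` pays for two leaves: one for its own node, and one unit of credit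
(the extra summand) for its parent. A kept node whose own interval satisfies `c` has a child that
fails it and uses that child's credit; a trivial node costs nothing because grafting loses a leaf.
-/
theorem numNodes_kernel_add_le (c : ℕ → ℕ → Bool) (b : ℕ) (s : OTree)
    (hc : ∀ x, b ≤ x → x < b + s.numLeaves → c (x + 1) x = true) :
    (kernel c b s).numLeaves + (if c (b + s.numLeaves) b then 0 else 1) ≤
      2 * (ivs b s).countP (fun x => !c x.1 x.2) + 1 := by
  induction s generalizing b with
  | nil =>
    have := hc b le_rfl (by simp [BinaryTree.numLeaves])
    simp [kernel, ivs, BinaryTree.numLeaves, this]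
  | node _ l r ihl ihr =>
    simp only [BinaryTree.numLeaves] at hc
    have h1 := ihl (b + r.numLeaves) fun x h1 h2 => hc x (by omega) (by omega)
    have h2 := ihr b fun x h1 h2 => hc x (by omega) (by omega)
    have hg := numLeaves_graft (kernel c (b + r.numLeaves) l) (kernel c b r)
    rw [add_assoc] at h1
    simp only [kernel, isTrivial, ivs, BinaryTree.numLeaves, List.countP_cons, List.countP_append,
      add_comm l.numLeaves]
    by_cases e1 : c (b + (r.numLeaves + l.numLeaves)) b = true <;>
      by_cases e2 : c (b + (r.numLeaves + l.numLeaves)) (b + r.numLeaves) = true <;>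
      by_cases e3 : c (b + r.numLeaves) b = true <;>
      simp [BinaryTree.numLeaves, e1, e2, e3] at h1 h2 ⊢ <;> omega

/-! ### Counting the intervals that differ -/

/-- Passing from `((A,B),C)` to `(A,(B,C))` exchanges the interval of `(A,B)` for that of `(B,C)`
and changes no other interval. -/
theorem countP_ivs_rotation (p : ℕ × ℕ → Bool) {s t : OTree} (h : RightRotation s t) (b : ℕ) :
    (ivs b s).countP p ≤ (ivs b t).countP p + 1 ∧ (ivs b t).countP p ≤ (ivs b s).countP p + 1 := by
  induction h generalizing b with
  | root x y z =>
    simp only [ivs, List.countP_cons, List.countP_append, BinaryTree.numLeaves]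
    rw [show z.numLeaves + (x.numLeaves + y.numLeaves) = y.numLeaves + z.numLeaves + x.numLeaves by
      omega, show b + z.numLeaves + y.numLeaves = b + (y.numLeaves + z.numLeaves) by omega]
    constructor <;> split_ifs <;> omega
  | left r h ih =>
    have := ih (b + r.numLeaves)
    simp only [ivs, List.countP_cons, List.countP_append, h.numLeaves_eq]
    omega
  | right l h ih =>
    have := ih b
    simp only [ivs, List.countP_cons, List.countP_append, h.numLeaves_eq]
    omega

/-- The absolute difference of the counts is a pseudometric to which `le_rotationDist` applies. The
intended `p` singles out the intervals that are missing from `t`. -/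
theorem countP_ivs_le_rotationDist (p : ℕ × ℕ → Bool) (b : ℕ) (s t : OTree)
    (ht : (ivs b t).countP p = 0) : (((ivs b s).countP p : ℕ) : ℕ∞) ≤ rotationDist s t := by
  have := le_rotationDist (fun s t => (((ivs b s).countP p - (ivs b t).countP p +
    ((ivs b t).countP p - (ivs b s).countP p) : ℕ) : ℕ∞)) (by simp)
    (fun s t => by rw [add_comm]) (fun s t u => by norm_cast; omega)
    (fun s t h => by have := countP_ivs_rotation p h b; norm_cast; omega) s t
  simpa [ht] using this

/-! ### Maximal intervals -/

/-- The maximal subtrees whose intervals satisfy `c`, together with the numbers of leaves to the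
right of them. -/
def blocks (c : ℕ → ℕ → Bool) : ℕ → OTree → List (ℕ × OTree)
  | b, .nil => [(b, .nil)]
  | b, .node _ l r =>
    if c (b + (r.numLeaves + l.numLeaves)) b then [(b, .node () l r)]
    else blocks c (b + r.numLeaves) l ++ blocks c b r

/-- The tree that arises if these subtrees are contracted to leaves. -/
def shape (c : ℕ → ℕ → Bool) : ℕ → OTree → OTree
  | _, .nil => .nil
  | b, .node _ l r =>
    if c (b + (r.numLeaves + l.numLeaves)) b then .nil
    else .node () (shape c (b + r.numLeaves) l) (shape c b r)

variable {c : ℕ → ℕ → Bool}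

theorem length_blocks (b : ℕ) (s : OTree) : (blocks c b s).length = (shape c b s).numLeaves := by
  induction s generalizing b with
  | nil => rfl
  | node _ l r ihl ihr => rw [blocks, shape]; split_ifs <;> simp [BinaryTree.numLeaves, ihl, ihr]

theorem subst_blocks (b : ℕ) (s : OTree) :
    subst (shape c b s) ((blocks c b s).map Prod.snd) 0 = s := by
  induction s generalizing b with
  | nil => rfl
  | node _ l r ihl ihr =>
    rw [blocks, shape]
    split_ifs
    · rfl
    · rw [List.map_append, subst_node _ _ _ _ _ (by simp [length_blocks]), ihl, ihr]

/-- Above the blocks no interval satisfies `c`, hence no node of the shape is trivial and `kernel`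
acts only within the blocks. -/
theorem subst_kernel_blocks (b : ℕ) (s : OTree) :
    subst (shape c b s) ((blocks c b s).map fun x => kernel c x.1 x.2) 0 = kernel c b s := by
  induction s generalizing b with
  | nil => rfl
  | node _ l r ihl ihr =>
    rw [blocks, shape]
    split_ifs with h
    · rfl
    · rw [List.map_append, subst_node _ _ _ _ _ (by simp [length_blocks]), ihl, ihr, kernel,
        isTrivial]
      simp [h]

theorem blocks_bounds {b : ℕ} {s : OTree} {x : ℕ} {t : OTree} (h : (x, t) ∈ blocks c b s) :
    b ≤ x ∧ x + t.numLeaves ≤ b + s.numLeaves := by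
  induction s generalizing b with
  | nil => simp [blocks] at h; simp [h]
  | node _ l r ihl ihr =>
    rw [blocks] at h
    split_ifs at h
    · simp only [List.mem_singleton, Prod.mk.injEq] at h
      simp [h]
    · simp only [BinaryTree.numLeaves]
      rcases List.mem_append.1 h with h | h
      · have := ihl h; omega
      · have := ihr h; omega

/-- On the way down to the block, each step passes to the one child that contains the range. This
lets the description of common intervals pass from the trees to their blocks. -/
theorem blocks_mem_ivs {b : ℕ} {s : OTree} {x : ℕ} {t : OTree} (h : (x, t) ∈ blocks c b s)
    {y z : ℕ} (hz : x ≤ z) (hy : y ≤ x + t.numLeaves) :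
    (y, z) ∈ ivs b s ↔ (y, z) ∈ ivs x t := by
  induction s generalizing b with
  | nil => simp [blocks] at h; simp [h]
  | node _ l r ihl ihr =>
    rw [blocks] at h
    split_ifs at h
    · simp only [List.mem_singleton, Prod.mk.injEq] at h
      simp [h]
    · rcases List.mem_append.1 h with h | h
      · have := blocks_bounds h
        rw [mem_ivs_node_left (by omega), ihl h]
      · have := blocks_bounds h
        rw [mem_ivs_node_right (by omega), ihr h]

theorem blocks_sat {b : ℕ} {s : OTree} (hc : ∀ x, b ≤ x → x < b + s.numLeaves → c (x + 1) x = true)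
    {x : ℕ} {t : OTree} (h : (x, t) ∈ blocks c b s) : c (x + t.numLeaves) x = true := by
  induction s generalizing b with
  | nil =>
    simp [blocks] at h
    simpa [h] using hc b le_rfl (by simp [BinaryTree.numLeaves])
  | node _ l r ihl ihr =>
    rw [blocks] at h
    simp only [BinaryTree.numLeaves] at hc
    split_ifs at h with h1
    · simp only [List.mem_singleton, Prod.mk.injEq] at h
      simpa [h, BinaryTree.numLeaves, add_comm l.numLeaves] using h1
    · rcases List.mem_append.1 h with h | h
      · exact ihl (fun x h1 h2 => hc x (by omega) (by omega)) h
      · exact ihr (fun x h1 h2 => hc x (by omega) (by omega)) h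

/-- The descent from the root towards the subtree with this interval stops there at the latest,
because `c` holds. -/
theorem exists_block {b : ℕ} {s : OTree} {y z : ℕ} (h : (y, z) ∈ ivs b s) (hc : c y z = true) :
    ∃ x t, (x, t) ∈ blocks c b s ∧ x ≤ z ∧ y ≤ x + t.numLeaves := by
  induction s generalizing b with
  | nil =>
    have := mem_ivs_bounds h
    exact ⟨b, .nil, by simp [blocks], this.1, this.2.2⟩
  | node _ l r ihl ihr =>
    rw [blocks]
    split_ifs with h1
    · have := mem_ivs_bounds h
      exact ⟨b, .node () l r, by simp, this.1, this.2.2⟩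
    · simp only [ivs, List.mem_cons, Prod.mk.injEq, List.mem_append] at h
      rcases h with h | h | h
      · rw [h.1, h.2] at hc; exact absurd hc h1
      · obtain ⟨x, t, hx, h2⟩ := ihl h; exact ⟨x, t, List.mem_append_left _ hx, h2⟩
      · obtain ⟨x, t, hx, h2⟩ := ihr h; exact ⟨x, t, List.mem_append_right _ hx, h2⟩

/-- The blocks of the list cover the leaves from `top` down to `bot + 1`, from left to right. -/
def Consecutive (bot : ℕ) : ℕ → List (ℕ × OTree) → Prop
  | top, [] => top = bot
  | top, (x, t) :: L => x + t.numLeaves = top ∧ Consecutive bot x L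

theorem Consecutive.append {bot mid : ℕ} {L L' : List (ℕ × OTree)} (h' : Consecutive bot mid L')
    {top : ℕ} (h : Consecutive mid top L) : Consecutive bot top (L ++ L') := by
  induction L generalizing top with
  | nil => have h : top = mid := h; subst h; exact h'
  | cons x L ih => exact ⟨h.1, ih h.2⟩

theorem consecutive_blocks (b : ℕ) (s : OTree) :
    Consecutive b (b + s.numLeaves) (blocks c b s) := by
  induction s generalizing b with
  | nil => exact ⟨rfl, rfl⟩
  | node _ l r ihl ihr =>
    rw [blocks]
    split_ifs
    · exact ⟨rfl, rfl⟩
    · refine (ihr b).append ?_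
      have := ihl (b + r.numLeaves)
      rwa [show b + r.numLeaves + l.numLeaves = b + (BinaryTree.node () l r).numLeaves by
        simp only [BinaryTree.numLeaves]; omega] at this

theorem Consecutive.bounds {bot top : ℕ} {L : List (ℕ × OTree)} (h : Consecutive bot top L) :
    bot ≤ top ∧ ∀ x t, (x, t) ∈ L → bot ≤ x ∧ x + t.numLeaves ≤ top := by
  induction L generalizing top with
  | nil => have h : top = bot := h; simp [h]
  | cons p L ih =>
    obtain ⟨h1, h2⟩ := h
    have := ih h2
    refine ⟨by omega, fun x t hx => ?_⟩
    rcases List.mem_cons.1 hx with rfl | hx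
    · exact ⟨this.1, h1.le⟩
    · have := this.2 x t hx; omega

/-- Two partitions of the same range into intervals, each refining the other, are equal. Comparing
the leftmost blocks gives both inequalities for their right ends, and the tails inherit the
hypotheses. -/
theorem Consecutive.forall₂ {bot top : ℕ} {L L' : List (ℕ × OTree)} (h : Consecutive bot top L)
    (h' : Consecutive bot top L')
    (hL : ∀ x t, (x, t) ∈ L → ∃ x' t', (x', t') ∈ L' ∧ x' ≤ x ∧
      x + t.numLeaves ≤ x' + t'.numLeaves)
    (hL' : ∀ x t, (x, t) ∈ L' → ∃ x' t', (x', t') ∈ L ∧ x' ≤ x ∧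
      x + t.numLeaves ≤ x' + t'.numLeaves) :
    List.Forall₂ (fun p q : ℕ × OTree => p.1 = q.1 ∧ p.2.numLeaves = q.2.numLeaves) L L' := by
  induction L generalizing top L' with
  | nil =>
    cases L' with
    | nil => exact .nil
    | cons q L' => obtain ⟨_, _, h, _⟩ := hL' q.1 q.2 (by simp); simp at h
  | cons p L ih =>
    obtain ⟨x, t⟩ := p
    cases L' with
    | nil => obtain ⟨_, _, h, _⟩ := hL x t (by simp); simp at h
    | cons q L' =>
      obtain ⟨y, u⟩ := q
      obtain ⟨h1, h2⟩ := h
      obtain ⟨h1', h2'⟩ := h'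
      have ht := one_le_numLeaves t
      have hu := one_le_numLeaves u
      have hyx : y ≤ x := by
        obtain ⟨x', t', hm, h3, h4⟩ := hL x t (by simp)
        rcases List.mem_cons.1 hm with hm | hm
        · simp only [Prod.mk.injEq] at hm; omega
        · have := h2'.bounds.2 _ _ hm; omega
      have hxy : x ≤ y := by
        obtain ⟨x', t', hm, h3, h4⟩ := hL' y u (by simp)
        rcases List.mem_cons.1 hm with hm | hm
        · simp only [Prod.mk.injEq] at hm; omega
        · have := h2.bounds.2 _ _ hm; omega
      obtain rfl : x = y := le_antisymm hxy hyx
      refine .cons ⟨rfl, by simp only; omega⟩ (ih h2 h2' ?_ ?_)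
      · intro z v hz
        obtain ⟨x', t', hm, h3, h4⟩ := hL z v (by simp [hz])
        rcases List.mem_cons.1 hm with hm | hm
        · have := h2.bounds.2 _ _ hz
          have := one_le_numLeaves v
          simp only [Prod.mk.injEq] at hm; omega
        · exact ⟨x', t', hm, h3, h4⟩
      · intro z v hz
        obtain ⟨x', t', hm, h3, h4⟩ := hL' z v (by simp [hz])
        rcases List.mem_cons.1 hm with hm | hm
        · have := h2'.bounds.2 _ _ hz
          have := one_le_numLeaves v
          simp only [Prod.mk.injEq] at hm; omega
        · exact ⟨x', t', hm, h3, h4⟩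

/-! ### The kernels of two trees have the same distance as the trees -/

/-- Among the intervals between `b` and `b + n`, the predicate `c` describes those of both trees. -/
def IsCommon (c : ℕ → ℕ → Bool) (b : ℕ) (s t : OTree) : Prop :=
  ∀ x y, b ≤ y → x ≤ b + s.numLeaves → (c x y = true ↔ (x, y) ∈ ivs b s ∧ (x, y) ∈ ivs b t)

theorem IsCommon.symm {b : ℕ} {s t : OTree} (h : IsCommon c b s t)
    (hst : s.numLeaves = t.numLeaves) : IsCommon c b t s :=
  fun x y h1 h2 => (h x y h1 (hst ▸ h2)).trans and_comm

theorem IsCommon.leaf {b : ℕ} {s t : OTree} (h : IsCommon c b s t)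
    (hst : s.numLeaves = t.numLeaves) {x : ℕ} (h1 : b ≤ x) (h2 : x < b + s.numLeaves) :
    c (x + 1) x = true :=
  (h _ _ h1 (by omega)).2 ⟨leaf_mem_ivs h1 h2, leaf_mem_ivs h1 (by omega)⟩

/-- The intervals of `l` and `r` also occur in the second tree. The first touches its left end and
must come from `l'`, the second touches its right end and must come from `r'`; this bounds the split
point from both sides. -/
theorem IsCommon.split_eq {b : ℕ} {l r l' r' : OTree}
    (h : IsCommon c b (.node () l r) (.node () l' r'))
    (hn : l.numLeaves + r.numLeaves = l'.numLeaves + r'.numLeaves)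
    (ht : isTrivial c b l r = true) : r.numLeaves = r'.numLeaves := by
  have := one_le_numLeaves l
  have := one_le_numLeaves r
  have := one_le_numLeaves l'
  have := one_le_numLeaves r'
  simp only [isTrivial, Bool.and_eq_true] at ht
  obtain ⟨-, h1, h2⟩ := ht
  have h1 := ((h _ _ (by omega) (by simp only [BinaryTree.numLeaves]; omega)).1 h1).2
  have h2 := ((h _ _ (by omega) (by simp only [BinaryTree.numLeaves]; omega)).1 h2).2
  simp only [ivs, List.mem_cons, Prod.mk.injEq, List.mem_append] at h1 h2
  rcases h1 with h1 | h1 | h1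
  · omega
  · rcases h2 with h2 | h2 | h2
    · omega
    · have := mem_ivs_bounds h2; omega
    · have := mem_ivs_bounds h1; have := mem_ivs_bounds h2; omega
  · have := mem_ivs_bounds h1; omega

theorem IsCommon.isTrivial_right {b : ℕ} {l r l' r' : OTree}
    (h : IsCommon c b (.node () l r) (.node () l' r'))
    (hn : l.numLeaves + r.numLeaves = l'.numLeaves + r'.numLeaves)
    (ht : isTrivial c b l r = true) : isTrivial c b l' r' = true := by
  have h1 := h.split_eq hn ht
  have h2 : l.numLeaves = l'.numLeaves := by omega
  rwa [isTrivial, ← h1, ← h2]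

/-- Induction on the number of leaves. At a trivial root both trees split alike. At any other root
the trees below it have the same maximal common blocks; these are treated by induction and put back
into shapes that the kernel leaves unchanged. -/
theorem kernel_spec {n b : ℕ} {s t : OTree} (hn : s.numLeaves ≤ n)
    (hst : s.numLeaves = t.numLeaves) (hc : IsCommon c b s t) :
    (kernel c b s).numLeaves = (kernel c b t).numLeaves ∧
      rotationDist (kernel c b s) (kernel c b t) = rotationDist s t := by
  induction n generalizing b s t with
  | zero => have := one_le_numLeaves s; omega
  | succ n ih =>
    cases s with
    | nil =>
      cases t with
      | nil => exact ⟨rfl, rfl⟩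
      | node _ l r =>
        have := one_le_numLeaves l
        have := one_le_numLeaves r
        simp [BinaryTree.numLeaves] at hst
        omega
    | node _ l r =>
    cases t with
    | nil =>
      have := one_le_numLeaves l
      have := one_le_numLeaves r
      simp [BinaryTree.numLeaves] at hst
      omega
    | node _ l' r' =>
    have hl := one_le_numLeaves l
    have hr := one_le_numLeaves r
    have hl' := one_le_numLeaves l'
    have hr' := one_le_numLeaves r'
    have hst' := hst
    simp only [BinaryTree.numLeaves] at hst hn
    by_cases htr : isTrivial c b l r = true
    · have hrr := hc.split_eq hst htr
      have hll : l.numLeaves = l'.numLeaves := by omega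
      have htr' := hc.isTrivial_right hst htr
      have h1 := ih (b := b + r.numLeaves) (s := l) (t := l') (by omega) hll fun x y h1 h2 => by
        rw [hc x y (by omega) (by simp only [BinaryTree.numLeaves]; omega),
          mem_ivs_node_left h1, mem_ivs_node_left (by omega), hrr]
      have h2 := ih (b := b) (s := r) (t := r') (by omega) hrr fun x y h1 h2 => by
        rw [hc x y (by omega) (by simp only [BinaryTree.numLeaves]; omega),
          mem_ivs_node_right h2, mem_ivs_node_right (by omega)]
      have g1 := numLeaves_graft (kernel c (b + r.numLeaves) l) (kernel c b r)
      have g2 := numLeaves_graft (kernel c (b + r'.numLeaves) l') (kernel c b r')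
      rw [hrr] at h1 g1
      rw [kernel, kernel, if_pos htr, if_pos htr', hrr]
      refine ⟨by omega, ?_⟩
      -- Nodes and grafts split the distance into the same two summands.
      rw [rotationDist_graft h1.1 h2.1, rotationDist_node hll hrr, h1.2, h2.2]
    · have htr' : ¬ isTrivial c b l' r' = true := fun h =>
        htr ((hc.symm hst').isTrivial_right hst.symm h)
      -- The root interval is common, so the whole tree would be a single block. Taking blocks in
      -- the two children makes them strictly smaller, as the induction needs.
      set B := blocks c (b + r.numLeaves) l ++ blocks c b r with hB
      set B' := blocks c (b + r'.numLeaves) l' ++ blocks c b r' with hB'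
      set sh : OTree := .node () (shape c (b + r.numLeaves) l) (shape c b r) with hsh
      set sh' : OTree := .node () (shape c (b + r'.numLeaves) l') (shape c b r') with hsh'
      have e1 : subst sh (B.map Prod.snd) 0 = .node () l r := by
        rw [hB, List.map_append, hsh, subst_node _ _ _ _ _ (by simp [length_blocks]),
          subst_blocks, subst_blocks]
      have e1' : subst sh' (B'.map Prod.snd) 0 = .node () l' r' := by
        rw [hB', List.map_append, hsh', subst_node _ _ _ _ _ (by simp [length_blocks]),
          subst_blocks, subst_blocks]
      have e2 : subst sh (B.map fun x => kernel c x.1 x.2) 0 = kernel c b (.node () l r) := by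
        rw [hB, List.map_append, hsh, subst_node _ _ _ _ _ (by simp [length_blocks]),
          subst_kernel_blocks, subst_kernel_blocks, kernel, if_neg htr]
      have e2' : subst sh' (B'.map fun x => kernel c x.1 x.2) 0 =
          kernel c b (.node () l' r') := by
        rw [hB', List.map_append, hsh', subst_node _ _ _ _ _ (by simp [length_blocks]),
          subst_kernel_blocks, subst_kernel_blocks, kernel, if_neg htr']
      have hlen : B.length = sh.numLeaves := by
        simp [hB, hsh, BinaryTree.numLeaves, length_blocks]
      have hlen' : B'.length = sh'.numLeaves := by
        simp [hB', hsh', BinaryTree.numLeaves, length_blocks]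
      have key : ∀ {l r l' r' : OTree},
          l.numLeaves + r.numLeaves = l'.numLeaves + r'.numLeaves →
          IsCommon c b (.node () l r) (.node () l' r') →
          ∀ x t, (x, t) ∈ blocks c (b + r.numLeaves) l ++ blocks c b r →
            t.numLeaves < l.numLeaves + r.numLeaves ∧ b ≤ x ∧
            x + t.numLeaves ≤ b + (l.numLeaves + r.numLeaves) ∧
            (∀ y z, x ≤ z → y ≤ x + t.numLeaves →
              ((y, z) ∈ ivs b (.node () l r) ↔ (y, z) ∈ ivs x t)) ∧
            ∃ x' t', (x', t') ∈ blocks c (b + r'.numLeaves) l' ++ blocks c b r' ∧ x' ≤ x ∧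
              x + t.numLeaves ≤ x' + t'.numLeaves := by
        intro l r l' r' hn hc x t hx
        have hl := one_le_numLeaves l
        have hr := one_le_numLeaves r
        have h1 : t.numLeaves < l.numLeaves + r.numLeaves ∧ b ≤ x ∧
            x + t.numLeaves ≤ b + (l.numLeaves + r.numLeaves) ∧
            (∀ y z, x ≤ z → y ≤ x + t.numLeaves →
              ((y, z) ∈ ivs b (.node () l r) ↔ (y, z) ∈ ivs x t)) ∧
            c (x + t.numLeaves) x = true := by
          have hleaf : ∀ x, b ≤ x → x < b + (l.numLeaves + r.numLeaves) → c (x + 1) x = true :=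
            fun x h1 h2 => hc.leaf (by simpa [BinaryTree.numLeaves] using hn) h1
              (by simpa [BinaryTree.numLeaves] using h2)
          rcases List.mem_append.1 hx with hx | hx
          · have hb := blocks_bounds hx
            refine ⟨by omega, by omega, by omega, fun y z h1 h2 => ?_,
              blocks_sat (fun x h1 h2 => hleaf x (by omega) (by omega)) hx⟩
            rw [mem_ivs_node_left (by omega), blocks_mem_ivs hx h1 h2]
          · have hb := blocks_bounds hx
            refine ⟨by omega, by omega, by omega, fun y z h1 h2 => ?_,
              blocks_sat (fun x h1 h2 => hleaf x (by omega) (by omega)) hx⟩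
            rw [mem_ivs_node_right (by omega), blocks_mem_ivs hx h1 h2]
        obtain ⟨h2, h3, h4, h5, h6⟩ := h1
        refine ⟨h2, h3, h4, h5, ?_⟩
        -- A block has a common interval, hence an interval of the other tree, where it lies in a
        -- block below the root. By symmetry the two lists of blocks refine each other.
        have h7 := ((hc _ _ h3 (by simpa [BinaryTree.numLeaves] using h4)).1 h6).2
        simp only [ivs, List.mem_cons, Prod.mk.injEq, List.mem_append] at h7
        rcases h7 with h7 | h7 | h7
        · omega
        · obtain ⟨x', t', h8, h9⟩ := exists_block h7 h6
          exact ⟨x', t', List.mem_append_left _ h8, h9⟩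
        · obtain ⟨x', t', h8, h9⟩ := exists_block h7 h6
          exact ⟨x', t', List.mem_append_right _ h8, h9⟩
      have cons : ∀ l r : OTree, Consecutive b (b + (l.numLeaves + r.numLeaves))
          (blocks c (b + r.numLeaves) l ++ blocks c b r) := fun l r => by
        refine (consecutive_blocks b r).append ?_
        have := consecutive_blocks (c := c) (b + r.numLeaves) l
        rwa [show b + r.numLeaves + l.numLeaves = b + (l.numLeaves + r.numLeaves) by omega] at this
      have k1 := key hst hc
      have k2 := key hst.symm (hc.symm hst')
      have hf : List.Forall₂ (fun p q : ℕ × OTree => p.1 = q.1 ∧ p.2.numLeaves = q.2.numLeaves)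
          B B' :=
        (cons l r).forall₂ (hst ▸ cons l' r') (fun x t hx => (k1 x t hx).2.2.2.2)
          (fun x t hx => (k2 x t hx).2.2.2.2)
      have hsub : ∀ p q, p ∈ B → q ∈ B' → p.1 = q.1 ∧ p.2.numLeaves = q.2.numLeaves →
          (kernel c p.1 p.2).numLeaves = (kernel c q.1 q.2).numLeaves ∧
            rotationDist (kernel c p.1 p.2) (kernel c q.1 q.2) = rotationDist p.2 q.2 := by
        rintro ⟨x, t⟩ ⟨y, u⟩ hp hq ⟨rfl, htu⟩
        obtain ⟨h2, h3, h4, h5, -⟩ := k1 x t hp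
        obtain ⟨-, -, -, h5', -⟩ := k2 x u hq
        refine ih (by simp only; omega) htu fun y z h6 h7 => ?_
        rw [hc y z (by simp only at h6; omega)
          (by simp only [BinaryTree.numLeaves] at h7 ⊢; omega), h5 y z h6 h7,
          h5' y z h6 (htu ▸ h7)]
      clear_value B B' sh sh'
      clear k1 k2 key cons hB hB' hsh hsh'
      have hlen2 := hf.length_eq
      have hs : sh.numLeaves = sh'.numLeaves := by omega
      have f1 : List.Forall₂ (fun t t' : OTree => t.numLeaves = t'.numLeaves) (B.map Prod.snd)
          (B'.map Prod.snd) := by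
        rw [List.forall₂_map_left_iff, List.forall₂_map_right_iff]
        exact hf.imp fun _ _ h => h.2
      have f2 : List.Forall₂ (fun t t' : OTree => t.numLeaves = t'.numLeaves)
          (B.map fun x => kernel c x.1 x.2) (B'.map fun x => kernel c x.1 x.2) := by
        rw [List.forall₂_map_left_iff, List.forall₂_map_right_iff]
        clear e1 e1' e2 e2' hlen hlen' f1 hlen2
        induction hf with
        | nil => exact .nil
        | cons h _ ih2 =>
          exact .cons (hsub _ _ (by simp) (by simp) h).1
            (ih2 fun p q hp hq => hsub p q (by simp [hp]) (by simp [hq]))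
      have hz : List.zipWith rotationDist (B.map fun x => kernel c x.1 x.2)
          (B'.map fun x => kernel c x.1 x.2) =
          List.zipWith rotationDist (B.map Prod.snd) (B'.map Prod.snd) := by
        clear e1 e1' e2 e2' hlen hlen' f1 f2 hlen2
        induction hf with
        | nil => rfl
        | cons h _ ih2 =>
          simp only [List.map_cons, List.zipWith_cons_cons, List.cons.injEq]
          exact ⟨(hsub _ _ (by simp) (by simp) h).2,
            ih2 fun p q hp hq => hsub p q (by simp [hp]) (by simp [hq])⟩
      -- Both distances are now the distance of the shapes plus a sum over the blocks, and the sums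
      -- agree term by term by `hz`.
      rw [← e2, ← e2', ← e1, ← e1']
      refine ⟨numLeaves_subst_congr hs f2 (by simp [hlen]), ?_⟩
      rw [rotationDist_subst hs f1 (by simp [hlen]), rotationDist_subst hs f2 (by simp [hlen]), hz]

/-- The size of the kernel is bounded by the distance. -/
theorem numLeaves_kernel_le {b : ℕ} {s t : OTree} {k : ℕ} (hst : s.numLeaves = t.numLeaves)
    (hc : IsCommon c b s t) (hk : rotationDist s t ≤ k) : (kernel c b s).numLeaves ≤ 2 * k + 1 := by
  have h1 := numNodes_kernel_add_le c b s fun x h1 h2 => hc.leaf hst h1 h2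
  -- Count the intervals of `s` that are missing from `t`; within `s` these are exactly the ones
  -- that fail `c`.
  have h2 := countP_ivs_le_rotationDist (fun x => decide (x ∉ ivs b t)) b s t
    (List.countP_eq_zero.2 fun x hx => by simp [hx])
  have h3 : (ivs b s).countP (fun x => !c x.1 x.2) =
      (ivs b s).countP (fun x => decide (x ∉ ivs b t)) := by
    refine List.countP_congr fun x hx => ?_
    have hb := mem_ivs_bounds (x := x.1) (y := x.2) hx
    have := hc x.1 x.2 hb.1 hb.2.2
    simp only [Prod.mk.eta, hx, true_and] at this
    simp [← this]
  have h4 := h2.trans hk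
  rw [← h3] at h4
  have h5 : (ivs b s).countP (fun x => !c x.1 x.2) ≤ k := by exact_mod_cast h4
  omega

/-- The machine numbers the leaves of both trees consecutively and tests intervals with a shift.
Only the values of `c` on intervals of the tree matter, so its kernel is the intended one. -/
theorem kernel_congr {c c' : ℕ → ℕ → Bool} {b b' : ℕ} {s : OTree}
    (h : ∀ x y, (b + x, b + y) ∈ ivs b s → c (b + x) (b + y) = c' (b' + x) (b' + y)) :
    kernel c b s = kernel c' b' s := by
  induction s generalizing b b' with
  | nil => rfl
  | node _ l r ihl ihr =>
    have e1 := h (r.numLeaves + l.numLeaves) 0 (by simp [ivs])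
    have e2 := h (r.numLeaves + l.numLeaves) r.numLeaves (by
      have := root_mem_ivs (b + r.numLeaves) l
      rw [add_assoc] at this
      simp [ivs, this])
    have e3 := h r.numLeaves 0 (by simp [ivs, root_mem_ivs])
    simp only [add_zero] at e1 e3
    rw [kernel, kernel, isTrivial, isTrivial, e1, e2, e3,
      ihl (b := b + r.numLeaves) (b' := b' + r.numLeaves) fun x y hx => by
        simpa only [add_assoc] using h (r.numLeaves + x) (r.numLeaves + y) (by
          rw [← add_assoc, ← add_assoc]; simp [ivs, hx]),
      ihr fun x y hx => h x y (by simp [ivs, hx])]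

theorem mem_ivs_add {b d x y : ℕ} {s : OTree} :
    (d + x, d + y) ∈ ivs (d + b) s ↔ (x, y) ∈ ivs b s := by
  induction s generalizing b with
  | nil => simp [ivs, add_assoc]
  | node _ l r ihl ihr => simp [ivs, add_assoc, ihl, ihr]

/-! ### Preorder codes -/

theorem length_code (s : OTree) : (code s).length + 1 = 2 * s.numLeaves := by
  induction s with
  | nil => rfl
  | node _ l r ihl ihr =>
    simp only [code, List.length_cons, List.length_append, BinaryTree.numLeaves]; omega

theorem code_ne_nil (s : OTree) : code s ≠ [] := by cases s <;> simp [code]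

/-- The last letter of a preorder code is the last leaf, and this letter is what `r` replaces.
Compared with the code of the node with children `l` and `r`, two letters disappear: the node's own
and the last one of `l`. -/
theorem code_graft (l r : OTree) : code (graft l r) = (code l).dropLast ++ code r := by
  rw [graft]
  induction l with
  | nil => rfl
  | node _ a b _ ih =>
    have := one_le_numLeaves b
    have h : ¬ a.numLeaves + b.numLeaves - 1 < a.numLeaves := by omega
    have h' : a.numLeaves + b.numLeaves - 1 - a.numLeaves = b.numLeaves - 1 := by omega
    simp only [plug, BinaryTree.numLeaves, h, if_false, h', code, ih]
    rw [show true :: (code a ++ code b) = (true :: code a) ++ code b from rfl,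
      List.dropLast_append_of_ne_nil (code_ne_nil b)]
    simp

end OTree

namespace RAM

/-! ### A machine with variables and arrays

The variable `x` is kept in register `2 * x`, the length of the input word in register `1`; the
other registers with odd numbers are used for the evaluation of expressions. The cell number `i` of
the array number `a` is kept in the memory cell `16 * i + a` behind the input word. -/

/-- An input word, which is never changed, variables, and sixteen arrays. -/
structure AState where
  inp : List Bool
  v : ℕ → ℕ
  arr : Fin 16 → ℕ → ℕ

namespace AState

/-- Assignment to a variable. -/
def set (s : AState) (x n : ℕ) : AState := { s with v := Function.update s.v x n }

/-- Assignment to a cell of an array. -/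
def put (s : AState) (a : Fin 16) (i n : ℕ) : AState :=
  { s with arr := Function.update s.arr a (Function.update (s.arr a) i n) }

@[simp] theorem inp_set (s : AState) (x n : ℕ) : (s.set x n).inp = s.inp := rfl
@[simp] theorem arr_set (s : AState) (x n : ℕ) : (s.set x n).arr = s.arr := rfl
@[simp] theorem inp_put (s : AState) (a : Fin 16) (i n : ℕ) : (s.put a i n).inp = s.inp := rfl
@[simp] theorem v_put (s : AState) (a : Fin 16) (i n : ℕ) : (s.put a i n).v = s.v := rfl

@[simp] theorem v_set (s : AState) (x n y : ℕ) : (s.set x n).v y = if y = x then n else s.v y := by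
  simp [set, Function.update_apply]

@[simp] theorem arr_put (s : AState) (a : Fin 16) (i n : ℕ) (b : Fin 16) (j : ℕ) :
    (s.put a i n).arr b j = if b = a then (if j = i then n else s.arr b j) else s.arr b j := by
  by_cases h : b = a
  · subst h; simp [put, Function.update_apply]
  · simp [put, h]

/-- The contents of the memory. -/
def mem (s : AState) (i : ℕ) : ℕ :=
  if i < s.inp.length then (if s.inp.getD i false then 1 else 0)
  else s.arr ⟨(i - s.inp.length) % 16, Nat.mod_lt _ (by norm_num)⟩ ((i - s.inp.length) / 16)

theorem mem_arr (s : AState) (a : Fin 16) (i : ℕ) :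
    s.mem (16 * i + s.inp.length + a) = s.arr a i := by
  have h1 : 16 * i + s.inp.length + (a : ℕ) - s.inp.length = 16 * i + a := by omega
  have h2 : (16 * i + (a : ℕ)) % 16 = a := by have := a.2; omega
  have h3 : (16 * i + (a : ℕ)) / 16 = i := by have := a.2; omega
  simp only [mem, if_neg (show ¬ 16 * i + s.inp.length + (a : ℕ) < s.inp.length by omega), h1, h2,
    h3]

/-- Array and index are remainder and quotient modulo `16` of the address behind the input, so
distinct array cells never share a memory cell. -/
theorem mem_put (s : AState) (a : Fin 16) (i n : ℕ) :
    (s.put a i n).mem = Function.update s.mem (16 * i + s.inp.length + a) n := by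
  funext j
  by_cases hj : j = 16 * i + s.inp.length + a
  · subst hj
    rw [Function.update_self]
    exact ((s.put a i n).mem_arr a i).trans (by simp)
  · rw [Function.update_of_ne hj]
    by_cases h : j < s.inp.length
    · rw [mem, mem, if_pos h, if_pos (show j < (s.put a i n).inp.length from h)]
      rfl
    · rw [mem, mem, if_neg h, if_neg (show ¬ j < (s.put a i n).inp.length from h), arr_put]
      by_cases h1 : (⟨(j - s.inp.length) % 16, Nat.mod_lt _ (by norm_num)⟩ : Fin 16) = a
      · have h2 : (j - s.inp.length) / 16 ≠ i := fun h2 => by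
          have h3 := congrArg Fin.val h1
          simp only at h3
          omega
        exact (if_pos h1).trans (if_neg h2)
      · exact if_neg h1

end AState

/-- The state `σ` represents `s`. -/
structure Rel (s : AState) (σ : State) : Prop where
  reg : ∀ x, σ.reg (2 * x) = s.v x
  len : σ.reg 1 = s.inp.length
  mem : σ.mem = s.mem

/-- Expressions. -/
inductive Expr : Type
  | const (n : ℕ)
  | var (x : ℕ)
  | len
  | inp (e : Expr)
  | arr (a : Fin 16) (e : Expr)
  | add (e f : Expr)
  | sub (e f : Expr)

namespace Expr

/-- The value of an expression. -/
def eval (s : AState) : Expr → ℕ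
  | const n => n
  | var x => s.v x
  | len => s.inp.length
  | inp e => s.mem (e.eval s)
  | arr a e => s.arr a (e.eval s)
  | add e f => e.eval s + f.eval s
  | sub e f => e.eval s - f.eval s

/-- Turns the index in register `r` into an address; register `r + 2` is used. -/
def address (a : Fin 16) (r : ℕ) : Prog :=
  .seq (.instr (.add r r r)) <| .seq (.instr (.add r r r)) <| .seq (.instr (.add r r r)) <|
    .seq (.instr (.add r r r)) <| .seq (.instr (.add r r 1)) <|
    .seq (.instr (.const (r + 2) a)) (.instr (.add r r (r + 2)))

/-- Evaluation of an expression into register `2 * d + 3`. -/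
def compile : Expr → ℕ → Prog
  | const n, d => .instr (.const (2 * d + 3) n)
  | var x, d => .instr (.copy (2 * d + 3) (2 * x))
  | len, d => .instr (.copy (2 * d + 3) 1)
  | inp e, d => .seq (compile e d) (.instr (.load (2 * d + 3) (2 * d + 3)))
  | arr a e, d =>
    .seq (compile e d) (.seq (address a (2 * d + 3)) (.instr (.load (2 * d + 3) (2 * d + 3))))
  | add e f, d =>
    .seq (compile e d)
      (.seq (compile f (d + 1)) (.instr (.add (2 * d + 3) (2 * d + 3) (2 * (d + 1) + 3))))
  | sub e f, d =>
    .seq (compile e d)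
      (.seq (compile f (d + 1)) (.instr (.sub (2 * d + 3) (2 * d + 3) (2 * (d + 1) + 3))))

/-- The time for the evaluation of an expression. -/
def cost : Expr → ℕ
  | const _ => 1
  | var _ => 1
  | len => 1
  | inp e => e.cost + 1
  | arr _ e => e.cost + (7 + 1)
  | add e f => e.cost + (f.cost + 1)
  | sub e f => e.cost + (f.cost + 1)

end Expr

/-- `σ'` differs from `σ` only in registers that are free at depth `d`. -/
structure Agree (d : ℕ) (σ σ' : State) : Prop where
  mem : σ'.mem = σ.mem
  low : ∀ r, r < 2 * d + 3 → σ'.reg r = σ.reg r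
  even : ∀ x, σ'.reg (2 * x) = σ.reg (2 * x)

theorem Agree.trans {d : ℕ} {σ σ' σ'' : State} (h : Agree d σ σ') (h' : Agree d σ' σ'') :
    Agree d σ σ'' :=
  ⟨h'.mem.trans h.mem, fun r hr => (h'.low r hr).trans (h.low r hr),
    fun x => (h'.even x).trans (h.even x)⟩

theorem Agree.mono {d e : ℕ} (hde : d ≤ e) {σ σ' : State} (h : Agree e σ σ') : Agree d σ σ' :=
  ⟨h.mem, fun r hr => h.low r (by omega), h.even⟩

theorem Agree.rel {d : ℕ} {s : AState} {σ σ' : State} (h : Agree d σ σ') (hs : Rel s σ) :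
    Rel s σ' :=
  ⟨fun x => (h.even x).trans (hs.reg x), (h.low 1 (by omega)).trans hs.len, h.mem.trans hs.mem⟩

theorem Agree.update (d : ℕ) (σ : State) (e n : ℕ) (h : d ≤ e) :
    Agree d σ { σ with reg := Function.update σ.reg (2 * e + 3) n } :=
  ⟨rfl, fun r hr => Function.update_of_ne (by omega) _ _,
    fun x => Function.update_of_ne (by omega) _ _⟩

/-- Four doublings multiply by `16`. The scratch register `2 * d + 5` is odd and above all registers
protected at depth `d`. -/
theorem exec_address (a : Fin 16) (d : ℕ) (σ : State) :
    ∃ σ', Exec (Expr.address a (2 * d + 3)) σ σ' 7 ∧ Agree d σ σ' ∧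
      σ'.reg (2 * d + 3) = 16 * σ.reg (2 * d + 3) + σ.reg 1 + a := by
  refine ⟨_, .seq (.instr _ _) (.seq (.instr _ _) (.seq (.instr _ _) (.seq (.instr _ _)
    (.seq (.instr _ _) (.seq (.instr _ _) (.instr _ _)))))), ?_, ?_⟩
  · refine ⟨rfl, fun r hr => ?_, fun x => ?_⟩
    · have h1 : r ≠ 2 * d + 3 := by omega
      have h2 : r ≠ 2 * d + 3 + 2 := by omega
      simp [Instr.run, h1, h2]
    · have h1 : 2 * x ≠ 2 * d + 3 := by omega
      have h2 : 2 * x ≠ 2 * d + 3 + 2 := by omega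
      simp [Instr.run, h1, h2]
  · simp [Instr.run]
    omega

/-- The second operand is evaluated at depth `d + 1`, where `Agree` protects the register `2 * d +
3` that holds the first one. -/
theorem Expr.exec_compile (e : Expr) (d : ℕ) {s : AState} {σ : State} (h : Rel s σ) :
    ∃ σ', Exec (e.compile d) σ σ' e.cost ∧ Agree d σ σ' ∧ σ'.reg (2 * d + 3) = e.eval s := by
  induction e generalizing d σ with
  | const n => exact ⟨_, .instr _ _, .update _ _ _ _ le_rfl, by simp [Instr.run, eval]⟩
  | var x => exact ⟨_, .instr _ _, .update _ _ _ _ le_rfl, by simp [Instr.run, eval, h.reg]⟩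
  | len => exact ⟨_, .instr _ _, .update _ _ _ _ le_rfl, by simp [Instr.run, eval, h.len]⟩
  | inp e ih =>
    obtain ⟨σ₁, h1, h2, h3⟩ := ih d h
    exact ⟨_, .seq h1 (.instr _ _), h2.trans (.update _ _ _ _ le_rfl),
      by simp [Instr.run, eval, h3, (h2.rel h).mem]⟩
  | arr a e ih =>
    obtain ⟨σ₁, h1, h2, h3⟩ := ih d h
    obtain ⟨σ₂, h4, h5, h6⟩ := exec_address a d σ₁
    refine ⟨_, .seq h1 (.seq h4 (.instr _ _)), (h2.trans h5).trans (.update _ _ _ _ le_rfl), ?_⟩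
    simp [Instr.run, eval, h6, h3, (h5.rel (h2.rel h)).mem, (h2.rel h).len, AState.mem_arr]
  | add e f ihe ihf =>
    obtain ⟨σ₁, h1, h2, h3⟩ := ihe d h
    obtain ⟨σ₂, h4, h5, h6⟩ := ihf (d + 1) (h2.rel h)
    refine ⟨_, .seq h1 (.seq h4 (.instr _ _)),
      (h2.trans (h5.mono (by omega))).trans (.update _ _ _ _ le_rfl), ?_⟩
    simp [Instr.run, eval, h6, h3, h5.low (2 * d + 3) (by omega)]
  | sub e f ihe ihf =>
    obtain ⟨σ₁, h1, h2, h3⟩ := ihe d h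
    obtain ⟨σ₂, h4, h5, h6⟩ := ihf (d + 1) (h2.rel h)
    refine ⟨_, .seq h1 (.seq h4 (.instr _ _)),
      (h2.trans (h5.mono (by omega))).trans (.update _ _ _ _ le_rfl), ?_⟩
    simp [Instr.run, eval, h6, h3, h5.low (2 * d + 3) (by omega)]

/-! ### Programs with bounds for their running time -/

/-- The program `p` leads from `s` to `s'` in at most `T` steps. -/
def Realizes (p : Prog) (s s' : AState) (T : ℕ) : Prop :=
  ∀ σ, Rel s σ → ∃ σ' t, Exec p σ σ' t ∧ t ≤ T ∧ Rel s' σ'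

theorem Realizes.mono {p : Prog} {s s' : AState} {T T' : ℕ} (h : Realizes p s s' T)
    (hT : T ≤ T') : Realizes p s s' T' := fun σ hσ =>
  let ⟨σ', t, h1, h2, h3⟩ := h σ hσ
  ⟨σ', t, h1, h2.trans hT, h3⟩

theorem Realizes.seq {p q : Prog} {s s' s'' : AState} {T T' : ℕ} (hp : Realizes p s s' T)
    (hq : Realizes q s' s'' T') : Realizes (.seq p q) s s'' (T + T') := by
  intro σ hσ
  obtain ⟨σ₁, t₁, h1, h2, h3⟩ := hp σ hσ
  obtain ⟨σ₂, t₂, h4, h5, h6⟩ := hq σ₁ h3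
  exact ⟨σ₂, _, .seq h1 h4, add_le_add h2 h5, h6⟩

/-- While the variable `x` is not zero. -/
def whileP (x : ℕ) (p : Prog) : Prog := .loop (2 * x) p

theorem Realizes.while_done {x : ℕ} {p : Prog} {s : AState} (h : s.v x = 0) :
    Realizes (whileP x p) s s 1 :=
  fun σ hσ => ⟨σ, 1, .loop_done ((hσ.reg x).trans h), le_rfl, hσ⟩

theorem Realizes.while_step {x : ℕ} {p : Prog} {s s' s'' : AState} {T T' : ℕ} (h : s.v x ≠ 0)
    (hp : Realizes p s s' T) (hl : Realizes (whileP x p) s' s'' T') :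
    Realizes (whileP x p) s s'' (T + T' + 1) := by
  intro σ hσ
  obtain ⟨σ₁, t₁, h1, h2, h3⟩ := hp σ hσ
  obtain ⟨σ₂, t₂, h4, h5, h6⟩ := hl σ₁ h3
  exact ⟨σ₂, _, .loop_step (by rw [hσ.reg]; exact h) h1 h4, by omega, h6⟩

/-- A loop whose body realizes a function. -/
theorem Realizes.while_iterate {x : ℕ} {p : Prog} {f : AState → AState} {T : ℕ}
    (hp : ∀ s, Realizes p s (f s) T) {n : ℕ} {s : AState} (h : ∀ j < n, (f^[j] s).v x ≠ 0)
    (h0 : (f^[n] s).v x = 0) : Realizes (whileP x p) s (f^[n] s) ((T + 1) * n + 1) := by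
  induction n generalizing s with
  | zero => simpa using while_done h0
  | succ n ih =>
    have h1 := ih (s := f s) (fun j hj => by simpa using h (j + 1) (by omega)) (by simpa using h0)
    exact (while_step (by simpa using h 0 (by omega)) (hp s) h1).mono (by
      rw [Nat.mul_succ]; omega)

/-- A loop with an invariant that counts the remaining rounds. -/
theorem Realizes.while_inv {x : ℕ} {p : Prog} {T : ℕ} (I : ℕ → AState → Prop)
    (hI : ∀ n s, I n s → s.v x ≠ 0 → ∃ m s', n = m + 1 ∧ I m s' ∧ Realizes p s s' T) {n : ℕ}
    {s : AState} (h : I n s) : ∃ m s', I m s' ∧ s'.v x = 0 ∧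
      Realizes (whileP x p) s s' ((T + 1) * n + 1) := by
  induction n generalizing s with
  | zero =>
    by_cases hx : s.v x = 0
    · exact ⟨0, s, h, hx, (while_done hx).mono (by omega)⟩
    · obtain ⟨m, s', h1, -⟩ := hI 0 s h hx
      omega
  | succ n ih =>
    by_cases hx : s.v x = 0
    · exact ⟨_, s, h, hx, (while_done hx).mono (by omega)⟩
    · obtain ⟨m, s', h1, h2, h3⟩ := hI _ s h hx
      obtain rfl : n = m := by omega
      obtain ⟨m, s'', h4, h5, h6⟩ := ih h2
      exact ⟨m, s'', h4, h5, (while_step hx h3 h6).mono (by rw [Nat.mul_succ]; omega)⟩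

/-- Programs without loops. -/
inductive Block : Type
  | set (x : ℕ) (e : Expr)
  | put (a : Fin 16) (e f : Expr)
  | seq (p q : Block)
  | ite (e : Expr) (p q : Block)

namespace Block

/-- The effect of a block. -/
def eval : Block → AState → AState
  | set x e, s => s.set x (e.eval s)
  | put a e f, s => s.put a (e.eval s) (f.eval s)
  | seq p q, s => q.eval (p.eval s)
  | ite e p q, s => if e.eval s = 0 then q.eval s else p.eval s

/-- The program of a block. -/
def compile : Block → Prog
  | set x e => .seq (e.compile 0) (.instr (.copy (2 * x) 3))
  | put a e f =>
    .seq (f.compile 0) (.seq (e.compile 1) (.seq (Expr.address a 5) (.instr (.store 5 3))))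
  | seq p q => .seq p.compile q.compile
  | ite e p q => .seq (e.compile 0) (.ite 3 p.compile q.compile)

/-- A bound for the running time of a block. -/
def cost : Block → ℕ
  | set _ e => e.cost + 1
  | put _ e f => f.cost + (e.cost + (7 + 1))
  | seq p q => p.cost + q.cost
  | ite e p q => e.cost + (p.cost + q.cost + 1)

theorem realizes (b : Block) (s : AState) : Realizes b.compile s (b.eval s) b.cost := by
  induction b generalizing s with
  | set x e =>
    intro σ hσ
    obtain ⟨σ₁, h1, h2, h3⟩ := e.exec_compile 0 hσ
    have hσ₁ := h2.rel hσ
    refine ⟨_, _, .seq h1 (.instr _ _), le_rfl, fun y => ?_, ?_, hσ₁.mem⟩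
    · have : σ₁.reg 3 = e.eval s := h3
      simp [Instr.run, eval, Function.update_apply, this, hσ₁.reg]
    · have : 1 ≠ 2 * x := by omega
      simp [Instr.run, eval, this, hσ₁.len]
  | put a e f =>
    intro σ hσ
    obtain ⟨σ₁, h1, h2, h3⟩ := f.exec_compile 0 hσ
    have hσ₁ := h2.rel hσ
    -- The value waits in register `3` while the address is computed at depth `1`, in register `5`.
    obtain ⟨σ₂, h4, h5, h6⟩ := e.exec_compile 1 hσ₁
    have hσ₂ := h5.rel hσ₁
    obtain ⟨σ₃, h7, h8, h9⟩ := exec_address a 1 σ₂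
    have hσ₃ := h8.rel hσ₂
    refine ⟨_, _, .seq h1 (.seq h4 (.seq h7 (.instr _ _))), le_rfl, hσ₃.reg, hσ₃.len, ?_⟩
    have e1 : σ₃.reg 5 = 16 * σ₂.reg 5 + σ₂.reg 1 + a := h9
    have e2 : σ₂.reg 5 = e.eval s := h6
    have e3 : σ₃.reg 3 = f.eval s := by
      rw [h8.low 3 (by omega), h5.low 3 (by omega)]; exact h3
    simp only [Instr.run, eval, AState.mem_put, e1, e2, e3, hσ₃.mem, hσ₂.len]
  | seq p q ihp ihq => exact (ihp s).seq (ihq _)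
  | ite e p q ihp ihq =>
    intro σ hσ
    obtain ⟨σ₁, h1, h2, h3⟩ := e.exec_compile 0 hσ
    have h3 : σ₁.reg 3 = e.eval s := h3
    by_cases h : e.eval s = 0
    · obtain ⟨σ₂, t, h4, h5, h6⟩ := ihq s σ₁ (h2.rel hσ)
      exact ⟨σ₂, _, .seq h1 (.ite_false (h3.trans h) h4), by simp only [cost]; omega,
        by simpa only [eval, h, if_true] using h6⟩
    · obtain ⟨σ₂, t, h4, h5, h6⟩ := ihp s σ₁ (h2.rel hσ)
      exact ⟨σ₂, _, .seq h1 (.ite_true (by rwa [h3]) h4), by simp only [cost]; omega,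
        by simpa only [eval, h, if_false] using h6⟩

end Block

/-- Programs with a conditional whose branches contain loops. -/
def iteP (e : Expr) (p q : Prog) : Prog := .seq (e.compile 0) (.ite 3 p q)

theorem Realizes.iteP_true {e : Expr} {p q : Prog} {s s' : AState} {T : ℕ} (h : e.eval s ≠ 0)
    (hp : Realizes p s s' T) : Realizes (iteP e p q) s s' (e.cost + (T + 1)) := by
  intro σ hσ
  obtain ⟨σ₁, h1, h2, h3⟩ := e.exec_compile 0 hσ
  have h3 : σ₁.reg 3 = e.eval s := h3
  obtain ⟨σ₂, t, h4, h5, h6⟩ := hp σ₁ (h2.rel hσ)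
  exact ⟨σ₂, _, .seq h1 (.ite_true (by rwa [h3]) h4), by omega, h6⟩

theorem Realizes.iteP_false {e : Expr} {p q : Prog} {s s' : AState} {T : ℕ} (h : e.eval s = 0)
    (hq : Realizes q s s' T) : Realizes (iteP e p q) s s' (e.cost + (T + 1)) := by
  intro σ hσ
  obtain ⟨σ₁, h1, h2, h3⟩ := e.exec_compile 0 hσ
  have h3 : σ₁.reg 3 = e.eval s := h3
  obtain ⟨σ₂, t, h4, h5, h6⟩ := hq σ₁ (h2.rel hσ)
  exact ⟨σ₂, _, .seq h1 (.ite_false (h3.trans h) h4), by omega, h6⟩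

/-- The initial state. -/
def AState.init (w : List Bool) (k : ℕ) : AState where
  inp := w
  v := fun x => if x = 0 then k else 0
  arr := fun _ _ => 0

theorem rel_init (w : List Bool) (k : ℕ) : Rel (.init w k) (init w k) := by
  refine ⟨fun x => ?_, by simp [init, AState.init], ?_⟩
  · have : 2 * x ≠ 1 := by omega
    simp [init, AState.init, this]
  · funext i
    by_cases h : i < w.length
    · rw [AState.mem, if_pos (show i < (AState.init w k).inp.length from h)]
      rfl
    · rw [AState.mem, if_neg (show ¬ i < (AState.init w k).inp.length from h)]
      simp only [init, AState.init]
      rw [List.getD_eq_default _ _ (by omega)]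
      rfl

open OTree

namespace Expr

instance : Add Expr := ⟨add⟩
instance : Sub Expr := ⟨sub⟩
instance (n : ℕ) : OfNat Expr n := ⟨const n⟩

@[simp] theorem eval_add (s : AState) (e f : Expr) : (e + f).eval s = e.eval s + f.eval s := rfl
@[simp] theorem eval_sub (s : AState) (e f : Expr) : (e - f).eval s = e.eval s - f.eval s := rfl
@[simp] theorem eval_zero (s : AState) : eval s 0 = 0 := rfl
@[simp] theorem eval_one (s : AState) : eval s 1 = 1 := rfl
@[simp] theorem eval_two (s : AState) : eval s 2 = 2 := rfl
@[simp] theorem eval_var (s : AState) (x : ℕ) : (var x).eval s = s.v x := rfl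
@[simp] theorem eval_len (s : AState) : len.eval s = s.inp.length := rfl
@[simp] theorem eval_inp (s : AState) (e : Expr) : (inp e).eval s = s.mem (e.eval s) := rfl
@[simp] theorem eval_arr (s : AState) (a : Fin 16) (e : Expr) :
    (arr a e).eval s = s.arr a (e.eval s) := rfl

theorem cost_sub (e f : Expr) : (e - f).cost = e.cost + (f.cost + 1) := rfl

end Expr

open _root_.RAM.Expr

theorem AState.mem_inp {s : AState} {u v : List Bool} {b : Bool} (h : s.inp = u ++ b :: v) :
    s.mem u.length = b.toNat := by
  rw [AState.mem, if_pos (by simp [h]), h]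
  cases b <;> simp

@[simp] theorem AState.mem_set (s : AState) (x n : ℕ) : (s.set x n).mem = s.mem := rfl

/-! ### The ends of the subtrees, and their intervals of leaves -/

/-- `E` and `Z` describe the subtrees of `t`, whose code starts at position `i`: the ends of their
codes, and the number of leaves from their starting position on, when there are `z` leaves to the
right of `t`. -/
def Layout (E Z : ℕ → ℕ) : ℕ → ℕ → OTree → Prop
  | i, z, .nil => E i = i + 1 ∧ Z i = z + 1
  | i, z, .node _ l r =>
    (E i = i + (1 + (code l).length + (code r).length) ∧ Z i = z + (r.numLeaves + l.numLeaves)) ∧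
      Layout E Z (i + 1) (z + r.numLeaves) l ∧ Layout E Z (i + (1 + (code l).length)) z r

theorem Layout.root {E Z : ℕ → ℕ} {i z : ℕ} {t : OTree} (h : Layout E Z i z t) :
    E i = i + (code t).length ∧ Z i = z + t.numLeaves := by
  cases t with
  | nil => exact h
  | node _ l r =>
    obtain ⟨h, -⟩ := h
    simp only [code, List.length_cons, List.length_append, BinaryTree.numLeaves]
    omega

theorem Layout.congr {E Z E' Z' : ℕ → ℕ} {i z : ℕ} {t : OTree} (h : Layout E Z i z t)
    (hE : ∀ j, i ≤ j → j < i + (code t).length → E' j = E j)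
    (hZ : ∀ j, i ≤ j → j < i + (code t).length → Z' j = Z j) : Layout E' Z' i z t := by
  induction t generalizing i z with
  | nil =>
    simp only [code, List.length_singleton] at hE hZ
    rw [Layout, hE i le_rfl (by omega), hZ i le_rfl (by omega)]
    exact h
  | node _ l r ihl ihr =>
    simp only [code, List.length_cons, List.length_append] at hE hZ
    obtain ⟨h1, h2, h3⟩ := h
    rw [Layout, hE i le_rfl (by omega), hZ i le_rfl (by omega)]
    exact ⟨h1, ihl h2 (fun j h1 h2 => hE j (by omega) (by omega))
      (fun j h1 h2 => hZ j (by omega) (by omega)),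
      ihr h3 (fun j h1 h2 => hE j (by omega) (by omega))
      (fun j h1 h2 => hZ j (by omega) (by omega))⟩

/-- `A` and `B` detect the intervals of `t`. -/
structure Detects (A B : ℕ → ℕ) (z : ℕ) (t : OTree) : Prop where
  rootA : A (z + t.numLeaves) = z
  rootB : B z = z + t.numLeaves
  leA : ∀ x, z < x → x ≤ z + t.numLeaves → z ≤ A x
  leB : ∀ y, z ≤ y → y < z + t.numLeaves → B y ≤ z + t.numLeaves
  iff : ∀ x y, z ≤ y → y < x → x ≤ z + t.numLeaves → (A x = y ∨ B y = x ↔ (x, y) ∈ ivs z t)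

theorem Detects.congr {A B A' B' : ℕ → ℕ} {z : ℕ} {t : OTree} (h : Detects A B z t)
    (hA : ∀ x, z < x → x ≤ z + t.numLeaves → A' x = A x)
    (hB : ∀ y, z ≤ y → y < z + t.numLeaves → B' y = B y) : Detects A' B' z t := by
  have := one_le_numLeaves t
  refine ⟨?_, ?_, fun x h1 h2 => ?_, fun y h1 h2 => ?_, fun x y h1 h2 h3 => ?_⟩
  · rw [hA _ (by omega) le_rfl, h.rootA]
  · rw [hB _ le_rfl (by omega), h.rootB]
  · rw [hA x h1 h2]; exact h.leA x h1 h2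
  · rw [hB y h1 h2]; exact h.leB y h1 h2
  · rw [hA x (by omega) h3, hB y h1 (by omega)]; exact h.iff x y h1 h2 h3

theorem Detects.nil {A B : ℕ → ℕ} {z : ℕ} (hA : A (z + 1) = z) (hB : B z = z + 1) :
    Detects A B z .nil := by
  refine ⟨hA, hB, fun x h1 h2 => ?_, fun y h1 h2 => ?_, fun x y h1 h2 h3 => ?_⟩ <;>
    simp only [BinaryTree.numLeaves] at *
  · obtain rfl : x = z + 1 := by omega
    omega
  · obtain rfl : y = z := by omega
    omega
  · obtain rfl : x = z + 1 := by omega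
    obtain rfl : y = z := by omega
    simp [ivs, hA]

/-- Descendants are recorded before ancestors, so `A` and `B` keep the longest interval at each
endpoint. The new root shares its left end with `l` and its right end with `r`: it overwrites the
root of `l` in `A` and that of `r` in `B`, and each of them survives in the other array. -/
theorem Detects.node {A B A' B' : ℕ → ℕ} {z : ℕ} {l r : OTree} (hr : Detects A B z r)
    (hl : Detects A B (z + r.numLeaves) l)
    (hA : ∀ x, A' x = if x = z + (r.numLeaves + l.numLeaves) then z else A x)
    (hB : ∀ y, B' y = if y = z then z + (r.numLeaves + l.numLeaves) else B y) :
    Detects A' B' z (.node () l r) := by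
  have h1 := one_le_numLeaves l
  have h2 := one_le_numLeaves r
  have e : (BinaryTree.node () l r).numLeaves = r.numLeaves + l.numLeaves := by
    simp only [BinaryTree.numLeaves]; omega
  refine ⟨?_, ?_, fun x h3 h4 => ?_, fun y h3 h4 => ?_, fun x y h3 h4 h5 => ?_⟩ <;> rw [e] at *
  · rw [hA, if_pos rfl]
  · rw [hB, if_pos rfl]
  · rw [hA]
    split_ifs with h
    · exact le_rfl
    · by_cases hx : x ≤ z + r.numLeaves
      · exact hr.leA x h3 hx
      · have := hl.leA x (by omega) (by omega); omega
  · rw [hB]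
    split_ifs with h
    · exact le_rfl
    · by_cases hy : y < z + r.numLeaves
      · have := hr.leB y h3 hy; omega
      · have := hl.leB y (by omega) (by omega); omega
  · have ra := hr.rootA
    have rb := hr.rootB
    have la := hl.rootA
    have lb := hl.rootB
    rw [hA, hB]
    by_cases hroot : x = z + (r.numLeaves + l.numLeaves) ∧ y = z
    · obtain ⟨rfl, rfl⟩ := hroot
      simp [ivs]
    by_cases hy : z + r.numLeaves ≤ y
    · rw [mem_ivs_node_left hy, ← hl.iff x y hy h4 (by omega), if_neg (by omega : ¬ y = z)]
      split_ifs with hx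
      · subst hx
        rw [add_assoc] at la lb
        constructor
        · rintro (h | h)
          · omega
          · exact Or.inr h
        · rintro (h | h)
          -- The entry of `A` that was overwritten described the root of `l`, which `B` still
          -- records.
          · right; rw [← h, la, lb]
          · exact Or.inr h
      · rfl
    by_cases hx : x ≤ z + r.numLeaves
    · rw [mem_ivs_node_right hx, ← hr.iff x y h3 h4 hx, if_neg (by omega)]
      split_ifs with hy
      · subst hy
        constructor
        · rintro (h | h)
          · exact Or.inl h
          · omega
        · rintro (h | h)
          · exact Or.inl h
          -- Symmetrically, the lost entry of `B` described the root of `r`, which `A` still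
          -- records.
          · left; rw [← h, rb, ra]
      · rfl
    have h6 : (x, y) ∉ ivs z (.node () l r) := by
      simp only [ivs, List.mem_cons, Prod.mk.injEq, List.mem_append]
      rintro (h | h | h)
      · exact hroot h
      · have := mem_ivs_bounds h; omega
      · have := mem_ivs_bounds h; omega
    simp only [h6, iff_false, not_or]
    constructor
    · split_ifs with h
      · omega
      · have := hl.leA x (by omega) (by omega); omega
    · split_ifs with h
      · omega
      · have := hr.leB y (by omega) (by omega); omega

/-- One step of the pass from right to left. Variable `1` is the position, variable `2` the number
of leaves seen so far; the arrays `0`, `1`, `2`, `3` are `E`, `Z`, `A`, `B`. -/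
def scan : Block :=
  .seq (.set 1 (var 1 - 1)) <|
  .seq (.ite (inp (var 1))
    (.seq (.put 0 (var 1) (arr 0 (arr 0 (var 1 + 1)))) (.put 1 (var 1) (var 2)))
    (.seq (.set 2 (var 2 + 1)) (.seq (.put 0 (var 1) (var 1 + 1)) (.put 1 (var 1) (var 2))))) <|
  .seq (.put 2 (var 2) (arr 1 (arr 0 (var 1)))) (.put 3 (arr 1 (arr 0 (var 1))) (var 2))

theorem scan_v_one (s : AState) : (scan.eval s).v 1 = s.v 1 - 1 := by
  by_cases h : s.mem (s.v 1 - 1) = 0 <;> simp [scan, Block.eval, h]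

theorem iterate_scan_v_one (n : ℕ) (s : AState) : (scan.eval^[n] s).v 1 = s.v 1 - n := by
  induction n with
  | zero => rfl
  | succ n ih => rw [Function.iterate_succ_apply', scan_v_one, ih, Nat.sub_sub]

/-- The state `s'` arises from `s` by scanning the tree `t` with code at position `i`, with `z`
leaves to the right of it. -/
structure Scanned (s s' : AState) (i z : ℕ) (t : OTree) : Prop where
  inp : s'.inp = s.inp
  pos : s'.v 1 = i
  leaves : s'.v 2 = z + t.numLeaves
  other : ∀ x, x ≠ 1 → x ≠ 2 → s'.v x = s.v x
  layout : Layout (s'.arr 0) (s'.arr 1) i z t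
  detects : Detects (s'.arr 2) (s'.arr 3) z t
  arrE : ∀ j, j < i ∨ i + (code t).length ≤ j → s'.arr 0 j = s.arr 0 j
  arrZ : ∀ j, j < i ∨ i + (code t).length ≤ j → s'.arr 1 j = s.arr 1 j
  arrA : ∀ x, x ≤ z ∨ z + t.numLeaves < x → s'.arr 2 x = s.arr 2 x
  arrB : ∀ y, y < z ∨ z + t.numLeaves ≤ y → s'.arr 3 y = s.arr 3 y
  arr : ∀ a, 4 ≤ a → s'.arr a = s.arr a

/-- Read from right to left, a code yields `r`, then `l`, then the root. The left child of a node at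
`i` starts at `i + 1`, so the node ends at `E (E (i + 1))`, and `Z` at that end counts the leaves to
the right of the subtree. `hZ` supplies this count at the end of `t`; the frame fields ensure that
scanning `l` does not spoil the records of `r`. -/
theorem scan_tree (t : OTree) (s : AState) (u v : List Bool) (z : ℕ)
    (hinp : s.inp = u ++ (code t ++ v)) (hpos : s.v 1 = u.length + (code t).length)
    (hz : s.v 2 = z) (hZ : s.arr 1 (u.length + (code t).length) = z) :
    Scanned s (scan.eval^[(code t).length] s) u.length z t := by
  induction t generalizing s u v z with
  | nil =>
    simp only [code, List.length_singleton, List.singleton_append] at hinp hpos hZ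
    have hm := AState.mem_inp hinp
    simp only [Bool.toNat_false] at hm
    simp only [code, List.length_singleton, Function.iterate_one]
    have key : scan.eval s = (((((s.set 1 u.length).set 2 (z + 1)).put 0 u.length
        (u.length + 1)).put 1 u.length (z + 1)).put 2 (z + 1) z).put 3 z (z + 1) := by
      simp [scan, Block.eval, hpos, hm, hz, hZ]
    rw [key]
    refine ⟨rfl, by simp, by simp [BinaryTree.numLeaves], fun x h1 h2 => by simp [h1, h2],
      by simp [Layout], .nil (by simp) (by simp), fun j h => ?_, fun j h => ?_, fun x h => ?_,
      fun y h => ?_, fun a ha => ?_⟩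
    · have : j ≠ u.length := by simp [code] at h; omega
      simp [this]
    · have : j ≠ u.length := by simp [code] at h; omega
      simp [this]
    · have : x ≠ z + 1 := by simp [BinaryTree.numLeaves] at h; omega
      simp [this]
    · have : y ≠ z := by simp [BinaryTree.numLeaves] at h; omega
      simp [this]
    · funext j
      have h0 : a ≠ 0 := by rintro rfl; simp at ha
      have h1 : a ≠ 1 := by rintro rfl; simp at ha
      have h2 : a ≠ 2 := by rintro rfl; simp at ha
      have h3 : a ≠ 3 := by rintro rfl; simp at ha
      simp [h0, h1, h2, h3]
  | node _ l r ihl ihr =>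
    have hl := one_le_numLeaves l
    have hr := one_le_numLeaves r
    simp only [code, List.length_cons, List.length_append] at hinp hpos hZ
    have S1 := ihr s (u ++ true :: code l) v z (by simp [hinp])
      (by simp only [hpos, List.length_append, List.length_cons]; omega) hz
      (by rw [← hZ]; congr 1; simp only [List.length_append, List.length_cons]; omega)
    set s1 := scan.eval^[(code r).length] s with hs1
    have hu1 : (u ++ true :: code l).length = u.length + (1 + (code l).length) := by
      simp only [List.length_append, List.length_cons]; omega
    rw [hu1] at S1
    have S2 := ihl s1 (u ++ [true]) (code r ++ v) (z + r.numLeaves) (by simp [S1.inp, hinp])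
      (by simp only [S1.pos, List.length_append, List.length_singleton]; omega) S1.leaves
      (by
        rw [List.length_append, List.length_singleton, add_assoc]
        exact S1.layout.root.2)
    set s2 := scan.eval^[(code l).length] s1 with hs2
    rw [List.length_append, List.length_singleton] at S2
    have hlen : (code (.node () l r)).length = 1 + ((code l).length + (code r).length) := by
      simp only [code, List.length_cons, List.length_append]; omega
    have hs : scan.eval^[(code (.node () l r)).length] s = scan.eval s2 := by
      rw [hlen, Function.iterate_add_apply, Function.iterate_add_apply, Function.iterate_one]
    rw [hs]
    have hm : s2.mem u.length = 1 :=
      AState.mem_inp (b := true) (by rw [S2.inp, S1.inp, hinp, List.cons_append])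
    have hp2 := S2.pos
    have hE1 := S2.layout.root.1
    have hE2 : s2.arr 0 (u.length + (1 + (code l).length)) =
        u.length + (1 + (code l).length + (code r).length) := by
      rw [S2.arrE _ (Or.inr (by omega)), S1.layout.root.1]; omega
    have hE2' : s2.arr 0 (u.length + 1 + (code l).length) =
        u.length + (1 + (code l).length + (code r).length) := by rw [add_assoc, hE2]
    have hZ2 : s2.arr 1 (u.length + (1 + (code l).length + (code r).length)) = z := by
      rw [S2.arrZ _ (Or.inr (by omega)), S1.arrZ _ (Or.inr (by omega)), ← hZ]
      congr 1; omega
    have hv2 := S2.leaves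
    rw [add_assoc] at hv2
    have key : scan.eval s2 = ((((s2.set 1 u.length).put 0 u.length
        (u.length + (1 + (code l).length + (code r).length))).put 1 u.length
        (z + (r.numLeaves + l.numLeaves))).put 2 (z + (r.numLeaves + l.numLeaves)) z).put 3 z
        (z + (r.numLeaves + l.numLeaves)) := by
      simp [scan, Block.eval, hp2, hm, hE1, hE2', hZ2, hv2]
    rw [key]
    have e : (BinaryTree.node () l r).numLeaves = r.numLeaves + l.numLeaves := by
      simp only [BinaryTree.numLeaves]; omega
    refine ⟨by simp [S2.inp, S1.inp], by simp, ?_, fun x h1 h2 => ?_, ⟨?_, ?_, ?_⟩,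
      .node (A := s2.arr 2) (B := s2.arr 3) (S1.detects.congr (fun x h1 h2 => ?_)
        fun y h1 h2 => ?_) S2.detects (fun x => by simp) (fun y => by simp), fun j h => ?_,
      fun j h => ?_, fun x h => ?_, fun y h => ?_, fun a ha => ?_⟩
    · rw [e]; exact hv2
    · simp [h1, S2.other x h1 h2, S1.other x h1 h2]
    · simp
    · refine S2.layout.congr (fun j h1 h2 => ?_) (fun j h1 h2 => ?_)
      · simp [show j ≠ u.length by omega]
      · simp [show j ≠ u.length by omega]
    · refine S1.layout.congr (fun j h1 h2 => ?_) (fun j h1 h2 => ?_)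
      · simp [show j ≠ u.length by omega, S2.arrE j (Or.inr (by omega))]
      · simp [show j ≠ u.length by omega, S2.arrZ j (Or.inr (by omega))]
    · exact S2.arrA x (Or.inl h2)
    · exact S2.arrB y (Or.inl h2)
    · rw [hlen] at h
      simp [show j ≠ u.length by omega, S2.arrE j (by omega), S1.arrE j (by omega)]
    · rw [hlen] at h
      simp [show j ≠ u.length by omega, S2.arrZ j (by omega), S1.arrZ j (by omega)]
    · rw [e] at h
      simp [show x ≠ z + (r.numLeaves + l.numLeaves) by omega, S2.arrA x (by omega),
        S1.arrA x (by omega)]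
    · rw [e] at h
      simp [show y ≠ z by omega, S2.arrB y (by omega), S1.arrB y (by omega)]
    · funext j
      have h0 : a ≠ 0 := by rintro rfl; simp at ha
      have h1 : a ≠ 1 := by rintro rfl; simp at ha
      have h2 : a ≠ 2 := by rintro rfl; simp at ha
      have h3 : a ≠ 3 := by rintro rfl; simp at ha
      simp [h0, h1, h2, h3, S2.arr a ha, S1.arr a ha]

/-! ### Computation of the kernel -/

/-- The array `f` contains the word `L` from position `o` on. -/
def Holds (f : ℕ → ℕ) (o : ℕ) (L : List Bool) : Prop :=
  ∀ j (h : j < L.length), f (o + j) = (L[j]).toNat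

theorem Holds.append {f : ℕ → ℕ} {o : ℕ} {L L' : List Bool} (h : Holds f o L)
    (h' : Holds f (o + L.length) L') : Holds f o (L ++ L') := by
  intro j hj
  rw [List.getElem_append]
  split_ifs with h1
  · exact h j h1
  · rw [List.length_append] at hj
    rw [← h' (j - L.length) (by omega)]
    congr 1; omega

theorem Holds.congr {f g : ℕ → ℕ} {o : ℕ} {L : List Bool} (h : Holds f o L)
    (hg : ∀ j, o ≤ j → j < o + L.length → g j = f j) : Holds g o L :=
  fun j hj => by rw [hg _ (by omega) (by omega), h j hj]

/-- One if the interval of the subtree at position `e` does not belong to the other tree. The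
variables `7` and `8` describe the shift between the two trees. -/
def differs (e : Expr) : Expr :=
  1 - ((1 - ((arr 2 (arr 1 e + var 7 - var 8) - (arr 1 (arr 0 e) + var 7 - var 8)) +
      ((arr 1 (arr 0 e) + var 7 - var 8) - arr 2 (arr 1 e + var 7 - var 8)))) +
    (1 - ((arr 3 (arr 1 (arr 0 e) + var 7 - var 8) - (arr 1 e + var 7 - var 8)) +
      ((arr 1 e + var 7 - var 8) - arr 3 (arr 1 (arr 0 e) + var 7 - var 8)))))

/-- The test whether an interval belongs to the other tree. -/
def common (s : AState) (x y : ℕ) : Bool :=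
  s.arr 2 (x + s.v 7 - s.v 8) = y + s.v 7 - s.v 8 ∨ s.arr 3 (y + s.v 7 - s.v 8) = x + s.v 7 - s.v 8

/-- With truncated subtraction, `(m - n) + (n - m)` vanishes exactly for `m = n`, and `1 - x` is the
negation of `x ≠ 0`. -/
theorem eval_differs (e : Expr) (s : AState) : (differs e).eval s =
    if common s (s.arr 1 (e.eval s)) (s.arr 1 (s.arr 0 (e.eval s))) then 0 else 1 := by
  simp only [differs, common, eval_add, eval_sub, eval_arr, eval_var, eval_one, decide_eq_true_eq]
  split_ifs with h <;> omega

/-- One step of the pass from left to right. Variable `1` is the position, variable `3` the length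
of the output in array `5`, variable `4` the number of steps that remain; array `4` marks the leaves
that have to be deleted. -/
def emit : Block :=
  .seq (.ite (inp (var 1))
    (.ite (differs (var 1) + differs (var 1 + 1) + differs (arr 0 (var 1 + 1)))
      (.seq (.put 5 (var 3) 1) (.set 3 (var 3 + 1)))
      (.put 4 (arr 0 (var 1 + 1) - 1) 1))
    (.ite (arr 4 (var 1)) (.set 3 (var 3))
      (.seq (.put 5 (var 3) 0) (.set 3 (var 3 + 1))))) <|
  .seq (.set 1 (var 1 + 1)) (.set 4 (var 4 - 1))

theorem emit_v_four (s : AState) : (emit.eval s).v 4 = s.v 4 - 1 := by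
  simp only [emit, Block.eval]
  split_ifs <;> simp

theorem iterate_emit_v_four (n : ℕ) (s : AState) : (emit.eval^[n] s).v 4 = s.v 4 - n := by
  induction n with
  | zero => rfl
  | succ n ih => rw [Function.iterate_succ_apply', emit_v_four, ih, Nat.sub_sub]

/-- The state `s'` arises from `s` by processing the code of length `m` at position `i`, with output
`L`. -/
structure Emitted (s s' : AState) (i m : ℕ) (L : List Bool) : Prop where
  inp : s'.inp = s.inp
  pos : s'.v 1 = i + m
  outLen : s'.v 3 = s.v 3 + L.length
  other : ∀ x, x ≠ 1 → x ≠ 3 → x ≠ 4 → s'.v x = s.v x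
  out : Holds (s'.arr 5) (s.v 3) L
  outOld : ∀ j, j < s.v 3 → s'.arr 5 j = s.arr 5 j
  del : ∀ j, j < i ∨ i + m ≤ j + 1 → s'.arr 4 j = s.arr 4 j
  arr : ∀ a, a ≠ 4 → a ≠ 5 → s'.arr a = s.arr a

theorem Emitted.common_eq {s s' : AState} {i m : ℕ} {L : List Bool} (h : Emitted s s' i m L) :
    common s' = common s := by
  funext x y
  simp only [common, h.other 7 (by norm_num) (by norm_num) (by norm_num),
    h.other 8 (by norm_num) (by norm_num) (by norm_num), h.arr 2 (by decide) (by decide),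
    h.arr 3 (by decide) (by decide)]

/-- A trivial node is removed by omitting its own letter and marking the last leaf of `l`, which is
skipped when the pass arrives there. Ancestors can mark only the last leaf of a subtree, hence the
form of `hdel` and the case distinction: a mark on the last leaf drops exactly the last letter of
the output. -/
theorem emit_tree (t : OTree) (s : AState) (u v : List Bool) (z : ℕ)
    (hinp : s.inp = u ++ (code t ++ v)) (hpos : s.v 1 = u.length)
    (hlay : Layout (s.arr 0) (s.arr 1) u.length z t)
    (hZ : s.arr 1 (u.length + (code t).length) = z)
    (hdel : ∀ j, u.length ≤ j → j + 1 < u.length + (code t).length → s.arr 4 j = 0) :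
    Emitted s (emit.eval^[(code t).length] s) u.length (code t).length
      (if s.arr 4 (u.length + (code t).length - 1) = 0 then code (kernel (common s) z t)
        else (code (kernel (common s) z t)).dropLast) := by
  induction t generalizing s u v z with
  | nil =>
    simp only [code, List.singleton_append] at hinp
    have hm := AState.mem_inp hinp
    simp only [Bool.toNat_false] at hm
    simp only [code, List.length_singleton, Function.iterate_one, Nat.add_sub_cancel, kernel]
    by_cases hd : s.arr 4 u.length = 0
    · have key : emit.eval s = (((s.put 5 (s.v 3) 0).set 3 (s.v 3 + 1)).set 1
          (u.length + 1)).set 4 (s.v 4 - 1) := by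
        simp [emit, Block.eval, hpos, hm, hd]
      rw [key, if_pos hd]
      refine ⟨rfl, by simp, by simp, fun x h1 h2 h3 => by simp [h1, h2, h3], ?_, fun j h => ?_,
        fun j h => by simp, fun a h1 h2 => by funext j; simp [h2]⟩
      · intro j hj
        simp only [List.length_singleton, Nat.lt_one_iff] at hj
        subst hj
        simp
      · simp [h.ne]
    · have key : emit.eval s = ((s.set 3 (s.v 3)).set 1 (u.length + 1)).set 4 (s.v 4 - 1) := by
        simp [emit, Block.eval, hpos, hm, hd]
      rw [key, if_neg hd]
      exact ⟨rfl, by simp, by simp, fun x h1 h2 h3 => by simp [h1, h2, h3],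
        fun j hj => by simp at hj, fun j h => by simp, fun j h => by simp,
        fun a h1 h2 => by funext j; simp⟩
  | node x l r ihl ihr =>
    obtain ⟨⟩ := x
    -- The last leaf of the tree is the last leaf of `r`, so the mark `D` is handed on to the right
    -- subtree unchanged, while the mark for `l` is decided at the root.
    obtain ⟨D, hD⟩ : ∃ D, D = s.arr 4 (u.length + (code (.node () l r)).length - 1) := ⟨_, rfl⟩
    rw [← hD]
    have hlen : (code (.node () l r)).length = (code r).length + ((code l).length + 1) := by
      simp only [code, List.length_cons, List.length_append]; omega
    have hcl : 1 ≤ (code l).length := by have := one_le_numLeaves l; have := length_code l; omega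
    have hcr : 1 ≤ (code r).length := by have := one_le_numLeaves r; have := length_code r; omega
    have hinp' : s.inp = u ++ true :: (code l ++ (code r ++ v)) := by simp [hinp, code]
    have hm : s.mem u.length = 1 := AState.mem_inp (b := true) hinp'
    obtain ⟨⟨hE0, hZ0⟩, hL, hR⟩ := hlay
    have hE1 := hL.root.1
    have hZ1 := hL.root.2
    have hE2 := hR.root.1
    have hZ2 := hR.root.2
    rw [← add_assoc] at hE2 hZ2
    have hend : u.length + (1 + (code l).length + (code r).length) =
      u.length + (code (.node () l r)).length := by omega
    have hend' : u.length + 1 + (code l).length + (code r).length =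
      u.length + (code (.node () l r)).length := by omega
    rw [hend] at hE0
    rw [hend'] at hE2
    rw [add_assoc] at hZ1
    rw [hlen] at hdel
    -- the root
    obtain ⟨s1, hs1, L1, hL1, S1, hdl⟩ : ∃ s1, emit.eval s = s1 ∧ ∃ L1 : List Bool,
        (L1 = if isTrivial (common s) z l r then [] else [true]) ∧
        (∀ x, x ≠ 1 → x ≠ 3 → x ≠ 4 → s1.v x = s.v x) ∧
        s1.inp = s.inp ∧ s1.v 1 = u.length + 1 ∧ s1.v 3 = s.v 3 + L1.length ∧
        Holds (s1.arr 5) (s.v 3) L1 ∧ (∀ j, j < s.v 3 → s1.arr 5 j = s.arr 5 j) ∧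
        (∀ a, a ≠ 4 → a ≠ 5 → s1.arr a = s.arr a) ∧
        (∀ j, s1.arr 4 j = if isTrivial (common s) z l r ∧ j = u.length + (code l).length then 1
          else s.arr 4 j) := by
      refine ⟨_, rfl, _, rfl, ?_⟩
      -- The three positions tested are those of the root, of the left child (the next letter), and
      -- of the right child (where the left code ends).
      have hdiff : (differs (var 1) + differs (var 1 + 1) +
          differs (arr 0 (var 1 + 1))).eval s = 0 ↔ isTrivial (common s) z l r = true := by
        simp only [eval_add, eval_differs, eval_var, eval_arr, eval_one, hpos, hE0, hZ0, hZ, hE1,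
          hZ1, hE2, hZ2, isTrivial, Bool.and_eq_true]
        split_ifs <;> simp_all
      by_cases htr : isTrivial (common s) z l r = true
      · have key : emit.eval s = ((s.put 4 (u.length + (code l).length) 1).set 1
            (u.length + 1)).set 4 (s.v 4 - 1) := by
          have : u.length + 1 + (code l).length - 1 = u.length + (code l).length := by omega
          simp only [emit, Block.eval, hdiff.2 htr, if_true]
          simp [hpos, hm, hE1, this]
        rw [key]
        refine ⟨fun x h1 h2 h3 => by simp [h1, h3], rfl, by simp, by simp [htr], ?_,
          fun j h => by simp, fun a h1 h2 => by funext j; simp [h1], fun j => by simp [htr]⟩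
        simp only [htr, if_true]
        exact fun j hj => by simp at hj
      · have key : emit.eval s = (((s.put 5 (s.v 3) 1).set 3 (s.v 3 + 1)).set 1
            (u.length + 1)).set 4 (s.v 4 - 1) := by
          simp only [emit, Block.eval, mt hdiff.1 htr, if_false]
          simp [hpos, hm]
        rw [key]
        refine ⟨fun x h1 h2 h3 => by simp [h1, h2, h3], rfl, by simp, by simp [htr], ?_,
          fun j h => by simp [h.ne], fun a h1 h2 => by funext j; simp [h2], fun j => by simp [htr]⟩
        simp only [htr]
        intro j hj
        simp only [Bool.false_eq_true, if_false, List.length_singleton, Nat.lt_one_iff] at hj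
        subst hj
        simp
    obtain ⟨hinp1, hpos1, hout1, hholds1, hold1, harr1, hdel1⟩ := hdl
    have hcom1 : common s1 = common s := by
      funext x y
      simp only [common, S1 7 (by norm_num) (by norm_num) (by norm_num),
        S1 8 (by norm_num) (by norm_num) (by norm_num), harr1 2 (by decide) (by decide),
        harr1 3 (by decide) (by decide)]
    -- the left subtree
    have hul : (u ++ [true]).length = u.length + 1 := by simp
    have S2 := ihl s1 (u ++ [true]) (code r ++ v) (z + r.numLeaves) (by simp [hinp1, hinp'])
      (by simp [hpos1])
      (by rw [harr1 0 (by decide) (by decide), harr1 1 (by decide) (by decide), hul]; exact hL)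
      (by rw [harr1 1 (by decide) (by decide), hul]; exact hZ2)
      (by
        intro j h1 h2
        rw [hul] at h1 h2
        rw [hdel1, if_neg (by omega)]
        exact hdel j (by omega) (by omega))
    set s2 := emit.eval^[(code l).length] s1 with hs2
    rw [hul, hcom1] at S2
    have hd1 : s1.arr 4 (u.length + 1 + (code l).length - 1) =
        if isTrivial (common s) z l r then 1 else 0 := by
      rw [hdel1, show u.length + 1 + (code l).length - 1 = u.length + (code l).length by omega,
        hdel _ (by omega) (by omega)]
      simp
    -- the right subtree
    have hur : (u ++ true :: code l).length = u.length + 1 + (code l).length := by simp; omega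
    have hcom2 := S2.common_eq.trans hcom1
    have hdel2 : ∀ j, u.length + 1 + (code l).length ≤ j → s2.arr 4 j = s.arr 4 j := by
      intro j hj
      rw [S2.del j (by omega), hdel1, if_neg (by omega)]
    have S3 := ihr s2 (u ++ true :: code l) v z (by simp [S2.inp, hinp1, hinp'])
      (by rw [S2.pos, hur])
      (by
        rw [S2.arr 0 (by decide) (by decide), S2.arr 1 (by decide) (by decide),
          harr1 0 (by decide) (by decide), harr1 1 (by decide) (by decide), hur, add_assoc]
        exact hR)
      (by
        rw [S2.arr 1 (by decide) (by decide), harr1 1 (by decide) (by decide), hur, hend', hZ])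
      (by
        intro j h1 h2
        rw [hur] at h1 h2
        rw [hdel2 j (by omega)]
        exact hdel j (by omega) (by omega))
    set s3 := emit.eval^[(code r).length] s2 with hs3
    rw [hur, hcom2, hdel2 _ (by omega), hend', ← hD] at S3
    have hs : emit.eval^[(code (.node () l r)).length] s = s3 := by
      rw [hlen, Function.iterate_add_apply, Function.iterate_add_apply, Function.iterate_one, hs1]
    rw [hs]
    set LL := if s1.arr 4 (u.length + 1 + (code l).length - 1) = 0 then
      code (kernel (common s) (z + r.numLeaves) l)
      else (code (kernel (common s) (z + r.numLeaves) l)).dropLast with hLL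
    set LR := if D = 0 then
      code (kernel (common s) z r) else (code (kernel (common s) z r)).dropLast with hLR
    have hconcat : (if D = 0 then code (kernel (common s) z (.node () l r))
        else (code (kernel (common s) z (.node () l r))).dropLast) = L1 ++ (LL ++ LR) := by
      -- For a trivial root this is `code_graft`: nothing is written for the root, and `l` loses its
      -- last letter.
      rw [hL1, hLL, hLR, hd1, kernel]
      clear_value LL LR
      clear hD
      by_cases htr : isTrivial (common s) z l r = true
      · simp only [htr, if_true, code_graft, one_ne_zero, if_false, List.nil_append]
        split_ifs
        · rfl
        · rw [List.dropLast_append_of_ne_nil (code_ne_nil _)]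
      · simp only [htr, if_true, if_false, code, Bool.false_eq_true]
        split_ifs
        · rfl
        · rw [← List.cons_append, List.dropLast_append_of_ne_nil (code_ne_nil _)]; rfl
    rw [hconcat]
    refine ⟨by rw [S3.inp, S2.inp, hinp1], ?_, ?_, fun x h1 h2 h3 => ?_, ?_, fun j hj => ?_,
      fun j hj => ?_, fun a h1 h2 => ?_⟩
    · rw [S3.pos]; omega
    · rw [S3.outLen, S2.outLen, hout1]; simp only [List.length_append]; omega
    · rw [S3.other x h1 h2 h3, S2.other x h1 h2 h3, S1 x h1 h2 h3]
    · have h2 := S2.out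
      have h3 := S3.out
      rw [hout1] at h2
      rw [S2.outLen, hout1] at h3
      refine Holds.append (hholds1.congr fun j h1 h2 => ?_) (Holds.append
        (h2.congr fun j h1 h2 => ?_) h3)
      · rw [S3.outOld j (by rw [S2.outLen]; omega), S2.outOld j (by omega)]
      · rw [S3.outOld j (by rw [S2.outLen]; omega)]
    · rw [S3.outOld j (by rw [S2.outLen]; omega), S2.outOld j (by omega), hold1 j hj]
    · rw [hlen] at hj
      rw [S3.del j (by omega), S2.del j (by omega), hdel1, if_neg (by omega)]
    · rw [S3.arr a h1 h2, S2.arr a h1 h2, harr1 a h1 h2]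

end RAM

namespace OTree

/-! ### Rotations in terms of positions in the preorder code -/

/-- The tree with children `l` and `r`, after a right rotation at the root if there is one. -/
def rotRight : OTree → OTree → OTree
  | .nil, r => .node () .nil r
  | .node _ a b, r => .node () a (.node () b r)

/-- The tree with children `l` and `r`, after a left rotation at the root if there is one. -/
def rotLeft (l : OTree) : OTree → OTree
  | .nil => .node () l .nil
  | .node _ a b => .node () (.node () l a) b

/-- Rotation of the edge above the interior node whose letter has position `q` in the code (the tree
itself if there is no such edge). -/
def rotAt : OTree → ℕ → OTree
  | .nil, _ => .nil
  | .node _ l r, q =>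
    if q = 0 then .node () l r
    else if q = 1 then rotRight l r
    else if q < 1 + (code l).length then .node () (rotAt l (q - 1)) r
    else if q = 1 + (code l).length then rotLeft l r
    else .node () l (rotAt r (q - 1 - (code l).length))

theorem rotAt_zero (t : OTree) : rotAt t 0 = t := by
  cases t <;> simp [rotAt]

theorem length_code_pos (t : OTree) : 0 < (code t).length :=
  List.length_pos_iff.2 (code_ne_nil t)

theorem getLast_code (t : OTree) : (code t).getLast (code_ne_nil t) = false := by
  induction t with
  | nil => rfl
  | node _ l r _ ih =>
    simp only [code]
    rw [List.getLast_cons (by simp [code_ne_nil]),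
      List.getLast_append_of_right_ne_nil _ _ (code_ne_nil r), ih]

theorem rotationDist_rotAt_le (t : OTree) (q : ℕ) : rotationDist t (rotAt t q) ≤ 1 := by
  induction t generalizing q with
  | nil => simp [rotAt, rotationDist_self]
  | node _ l r ihl ihr =>
    rw [rotAt]
    split_ifs
    · simp [rotationDist_self]
    · cases l with
      | nil => simp [rotRight, rotationDist_self]
      | node _ a b => exact (RightRotation.root a b r).rotationDist_le_one
    · exact (rotationDist_node_left_le _ _ _).trans (ihl _)
    · cases r with
      | nil => simp [rotLeft, rotationDist_self]
      | node _ a b =>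
        rw [rotationDist_comm]
        exact (RightRotation.root l a b).rotationDist_le_one
    · exact (rotationDist_node_right_le _ _ _).trans (ihr _)

theorem exists_rotAt_node_left {l l' : OTree} (h : ∃ q < (code l).length, rotAt l q = l')
    (r : OTree) : ∃ q < (code (.node () l r)).length, rotAt (.node () l r) q = .node () l' r := by
  obtain ⟨q, hq, rfl⟩ := h
  rcases Nat.eq_zero_or_pos q with rfl | h0
  · exact ⟨0, length_code_pos _, by rw [rotAt_zero, rotAt_zero]⟩
  · refine ⟨q + 1, by simp only [code, List.length_cons, List.length_append]; omega, ?_⟩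
    rw [rotAt, if_neg (by omega), if_neg (by omega), if_pos (by omega), Nat.add_sub_cancel]

theorem exists_rotAt_node_right {r r' : OTree} (h : ∃ q < (code r).length, rotAt r q = r')
    (l : OTree) : ∃ q < (code (.node () l r)).length, rotAt (.node () l r) q = .node () l r' := by
  obtain ⟨q, hq, rfl⟩ := h
  rcases Nat.eq_zero_or_pos q with rfl | h0
  · exact ⟨0, length_code_pos _, by rw [rotAt_zero, rotAt_zero]⟩
  · refine ⟨q + (1 + (code l).length),
      by simp only [code, List.length_cons, List.length_append]; omega, ?_⟩
    rw [rotAt, if_neg (by omega), if_neg (by omega), if_neg (by omega), if_neg (by omega)]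
    congr 2; omega

/-- At the root, a right rotation lifts the left child, at position `1`; its inverse lifts the right
child, right behind the code of `a`. Thus one kind of move, given by a position, covers both
directions. -/
theorem _root_.RightRotation.exists_rotAt {s t : OTree} (h : RightRotation s t) :
    (∃ q < (code s).length, rotAt s q = t) ∧ ∃ q < (code t).length, rotAt t q = s := by
  induction h with
  | root a b c =>
    have := length_code_pos a
    refine ⟨⟨1, by simp [code], by simp [rotAt, rotRight]⟩, 1 + (code a).length,
      by simp [code]; omega, ?_⟩
    rw [rotAt, if_neg (by omega), if_neg (by omega), if_neg (by omega), if_pos rfl, rotLeft]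
  | left b _ ih => exact ⟨exists_rotAt_node_left ih.1 b, exists_rotAt_node_left ih.2 b⟩
  | right a _ ih => exact ⟨exists_rotAt_node_right ih.1 a, exists_rotAt_node_right ih.2 a⟩

/-- The effect of a rotation on the code. -/
theorem code_rotAt (t : OTree) (q : ℕ) (hq : q < (code t).length) :
    (rotAt t q = t ∧ (q = 0 ∨ (code t)[q] = false)) ∨
    (∃ u a v, code t = u ++ true :: true :: (code a ++ v) ∧ q = u.length + 1 ∧
      code (rotAt t q) = u ++ true :: (code a ++ true :: v)) ∨
    ∃ u a v, code t = u ++ true :: (code a ++ true :: v) ∧ q = u.length + 1 + (code a).length ∧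
      code (rotAt t q) = u ++ true :: true :: (code a ++ v) := by
  induction t generalizing q with
  | nil => exact Or.inl ⟨rfl, Or.inl (by simpa [code] using hq)⟩
  | node _ l r ihl ihr =>
    have hq' := hq
    simp only [code, List.length_cons, List.length_append] at hq'
    rw [rotAt]
    by_cases h0 : q = 0
    · exact Or.inl ⟨by simp [h0], Or.inl h0⟩
    by_cases h1 : q = 1
    · subst h1
      cases l with
      | nil => exact Or.inl ⟨by simp [rotRight], Or.inr (by simp [code])⟩
      | node _ a b =>
        exact Or.inr (Or.inl ⟨[], a, code b ++ code r, by simp [code], rfl,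
          by simp [code, rotRight]⟩)
    by_cases h2 : q < 1 + (code l).length
    · rw [if_neg h0, if_neg h1, if_pos h2]
      rcases ihl (q - 1) (by omega) with ⟨e, h⟩ | ⟨u, a, v, e1, e2, e3⟩ | ⟨u, a, v, e1, e2, e3⟩
      · refine Or.inl ⟨by rw [e], Or.inr ?_⟩
        rcases h with h | h
        · omega
        · simp only [code, List.getElem_cons, h0, dif_neg, not_false_eq_true]
          rw [List.getElem_append_left (by omega), h]
      · exact Or.inr (Or.inl ⟨true :: u, a, v ++ code r, by simp [code, e1],
          by simp only [List.length_cons]; omega, by simp [code, e3]⟩)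
      · exact Or.inr (Or.inr ⟨true :: u, a, v ++ code r, by simp [code, e1],
          by simp only [List.length_cons]; omega, by simp [code, e3]⟩)
    by_cases h3 : q = 1 + (code l).length
    · rw [if_neg h0, if_neg h1, if_neg h2, if_pos h3]
      cases r with
      | nil =>
        refine Or.inl ⟨rfl, Or.inr ?_⟩
        simp [code, h3, List.getElem_cons]
      | node _ a b =>
        exact Or.inr (Or.inr ⟨[], l, code a ++ code b, by simp [code], by simp [h3],
          by simp [code, rotLeft]⟩)
    · rw [if_neg h0, if_neg h1, if_neg h2, if_neg h3]
      rcases ihr (q - 1 - (code l).length) (by omega) with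
        ⟨e, h⟩ | ⟨u, a, v, e1, e2, e3⟩ | ⟨u, a, v, e1, e2, e3⟩
      · refine Or.inl ⟨by rw [e], Or.inr ?_⟩
        rcases h with h | h
        · omega
        · simp only [code, List.getElem_cons, h0, dif_neg, not_false_eq_true]
          rw [List.getElem_append_right (by omega), h]
      · exact Or.inr (Or.inl ⟨true :: (code l ++ u), a, v, by simp [code, e1],
          by simp only [List.length_cons, List.length_append]; omega, by simp [code, e3]⟩)
      · exact Or.inr (Or.inr ⟨true :: (code l ++ u), a, v, by simp [code, e1],
          by simp only [List.length_cons, List.length_append]; omega, by simp [code, e3]⟩)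

theorem length_code_rotAt (t : OTree) (q : ℕ) (hq : q < (code t).length) :
    (code (rotAt t q)).length = (code t).length := by
  rcases code_rotAt t q hq with ⟨e, -⟩ | ⟨u, a, v, e1, -, e3⟩ | ⟨u, a, v, e1, -, e3⟩
  · rw [e]
  · rw [e1, e3]; simp only [List.length_append, List.length_cons]; omega
  · rw [e1, e3]; simp only [List.length_append, List.length_cons]; omega

/-- Preorder codes form a prefix code. -/
theorem code_append_injective {s t : OTree} {u v : List Bool} (h : code s ++ u = code t ++ v) :
    s = t ∧ u = v := by
  induction s generalizing t u v with
  | nil => cases t with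
    | nil => simpa [code] using h
    | node _ l r => simp [code] at h
  | node _ l r ihl ihr => cases t with
    | nil => simp [code] at h
    | node _ l' r' =>
      simp only [code, List.cons_append, List.append_assoc, List.cons.injEq, true_and] at h
      obtain ⟨rfl, h'⟩ := ihl h
      obtain ⟨rfl, h''⟩ := ihr h'
      exact ⟨rfl, h''⟩

theorem code_injective {s t : OTree} (h : code s = code t) : s = t :=
  (code_append_injective (u := []) (v := []) (by simpa using h)).1

/-! ### Sequences of rotations -/

/-- The result of `k` rotations at the positions `f 0, f 1, …`. -/
def rotSeq (t : OTree) (f : ℕ → ℕ) : ℕ → OTree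
  | 0 => t
  | k + 1 => rotAt (rotSeq t f k) (f k)

theorem rotSeq_congr {t : OTree} {f g : ℕ → ℕ} {k : ℕ} (h : ∀ i < k, f i = g i) :
    rotSeq t f k = rotSeq t g k := by
  induction k with
  | zero => rfl
  | succ k ih => rw [rotSeq, rotSeq, ih fun i hi => h i (by omega), h k (by omega)]

theorem length_code_rotSeq {t : OTree} {f : ℕ → ℕ} {k : ℕ} (h : ∀ i < k, f i < (code t).length) :
    (code (rotSeq t f k)).length = (code t).length := by
  induction k with
  | zero => rfl
  | succ k ih =>
    have h1 := ih fun i hi => h i (by omega)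
    rw [rotSeq, length_code_rotAt _ _ (by rw [h1]; exact h k (by omega)), h1]

theorem rotationDist_rotSeq_le (t : OTree) (f : ℕ → ℕ) (k : ℕ) :
    rotationDist t (rotSeq t f k) ≤ k := by
  induction k with
  | zero => simp [rotSeq, rotationDist_self]
  | succ k ih =>
    refine (rotationDist_triangle _ (rotSeq t f k) _).trans ?_
    push_cast
    exact add_le_add ih (rotationDist_rotAt_le _ _)

/-- Position `0` leaves a tree unchanged, so sequences of exactly `k` positions also cover all
shorter sequences of rotations. Rotations preserve the length of the code, hence one bound for all
positions. -/
theorem exists_rotSeq {s t : OTree} {k : ℕ} (h : rotationDist s t ≤ k) :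
    ∃ f : ℕ → ℕ, (∀ i, f i < (code s).length) ∧ rotSeq s f k = t := by
  induction k generalizing t with
  | zero =>
    refine ⟨fun _ => 0, fun _ => length_code_pos s, ?_⟩
    have h0 : rotationDist s t = 0 := by simpa using h
    exact SimpleGraph.edist_eq_zero_iff.1 h0
  | succ k ih =>
    -- The walk is taken from `t` to `s`, so that its first edge is the last rotation, the one that
    -- `rotSeq` performs outermost.
    obtain ⟨p, hp⟩ := SimpleGraph.exists_walk_of_edist_ne_top (G := rotationGraph) (u := t) (v := s)
      (by
        change rotationDist t s ≠ ⊤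
        rw [rotationDist_comm]
        exact ne_top_of_le_ne_top (ENat.natCast_ne_top _) h)
    have hlen : p.length ≤ k + 1 := by
      have : (p.length : ℕ∞) ≤ ((k + 1 : ℕ) : ℕ∞) := by
        rw [hp]; exact (rotationDist_comm t s).trans_le h
      exact_mod_cast this
    obtain ⟨u, hu, hut⟩ : ∃ u, rotationDist s u ≤ k ∧ ∃ q < (code u).length, rotAt u q = t := by
      cases p with
      | nil => exact ⟨_, by simp [rotationDist_self], 0, length_code_pos _, rotAt_zero _⟩
      | @cons _ u _ hadj p =>
        refine ⟨u, ?_, ?_⟩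
        · rw [rotationDist_comm]
          refine (SimpleGraph.edist_le p).trans ?_
          simp only [SimpleGraph.Walk.length_cons] at hlen
          exact_mod_cast (by omega : p.length ≤ k)
        · rcases hadj.2 with h | h
          · exact h.exists_rotAt.2
          · exact h.exists_rotAt.1
    obtain ⟨q, hq, hqt⟩ := hut
    obtain ⟨f, hf, rfl⟩ := ih hu
    refine ⟨Function.update f k q, fun i => ?_, ?_⟩
    · by_cases hi : i = k
      · subst hi
        rw [length_code_rotSeq fun i _ => hf i] at hq
        simpa using hq
      · simpa [hi] using hf i
    · rw [rotSeq, rotSeq_congr (g := f) fun i hi => by simp [hi.ne], Function.update_self, hqt]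

end OTree

/-! ### Numbers in positional systems -/

/-- The number with the digits `f 0, …, f (k - 1)` in base `b`. -/
def digitVal (b : ℕ) (f : ℕ → ℕ) : ℕ → ℕ
  | 0 => 0
  | k + 1 => digitVal b f k + f k * b ^ k

theorem digitVal_lt {b : ℕ} {f : ℕ → ℕ} {k : ℕ} (h : ∀ i < k, f i < b) :
    digitVal b f k < b ^ k := by
  induction k with
  | zero => simp [digitVal]
  | succ k ih =>
    have h1 := ih fun i hi => h i (by omega)
    have h2 : (f k + 1) * b ^ k ≤ b * b ^ k := Nat.mul_le_mul_right _ (h k (by omega))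
    rw [digitVal, pow_succ, mul_comm (b ^ k)]
    linarith

theorem digitVal_injective {b : ℕ} {f g : ℕ → ℕ} {k : ℕ} (hf : ∀ i < k, f i < b)
    (hg : ∀ i < k, g i < b) (h : digitVal b f k = digitVal b g k) : ∀ i < k, f i = g i := by
  induction k with
  | zero => intro i hi; omega
  | succ k ih =>
    have h1 := digitVal_lt fun i (hi : i < k) => hf i (by omega)
    have h2 := digitVal_lt fun i (hi : i < k) => hg i (by omega)
    simp only [digitVal] at h
    have hpos : 0 < b ^ k := by omega
    have e : ∀ x y, x < b ^ k → (x + y * b ^ k) / b ^ k = y := fun x y hx => by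
      rw [Nat.add_mul_div_right _ _ hpos, Nat.div_eq_of_lt hx, zero_add]
    have h3 : f k = g k := by rw [← e _ (f k) h1, h, e _ _ h2]
    rw [h3] at h
    intro i hi
    rcases Nat.lt_succ_iff_lt_or_eq.1 hi with hi | rfl
    · exact ih (fun i hi => hf i (by omega)) (fun i hi => hg i (by omega)) (by omega) i hi
    · exact h3

theorem digitVal_max {b : ℕ} {f : ℕ → ℕ} {k : ℕ} (h : ∀ i < k, f i + 1 = b) :
    digitVal b f k + 1 = b ^ k := by
  induction k with
  | zero => simp [digitVal]
  | succ k ih =>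
    have h1 := ih fun i hi => h i (by omega)
    have h2 := h k (by omega)
    rw [digitVal, pow_succ, mul_comm (b ^ k)]
    nth_rewrite 3 [← h2]
    linarith

theorem digitVal_zero {b : ℕ} {f : ℕ → ℕ} {k : ℕ} (h : ∀ i < k, f i = 0) :
    digitVal b f k = 0 := by
  induction k with
  | zero => rfl
  | succ k ih => rw [digitVal, ih fun i hi => h i (by omega), h k (by omega)]; simp

/-- A carry through `j` maximal digits: by `digitVal_max` they are worth `b ^ j - 1`, which is
traded for one more at digit `j`. -/
theorem digitVal_succ {b : ℕ} {f g : ℕ → ℕ} {j k : ℕ} (hjk : j < k) (h : ∀ i < j, f i + 1 = b)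
    (hg : ∀ i < j, g i = 0) (hj : g j = f j + 1) (hgf : ∀ i, j < i → i < k → g i = f i) :
    digitVal b g k = digitVal b f k + 1 := by
  induction k with
  | zero => omega
  | succ k ih =>
    rcases Nat.lt_succ_iff_lt_or_eq.1 hjk with hjk | rfl
    · rw [digitVal, digitVal, ih hjk fun i h1 h2 => hgf i h1 (by omega), hgf k hjk (by omega)]
      omega
    · rw [digitVal, digitVal, digitVal_zero hg, hj]
      have := digitVal_max h
      linarith

namespace RAM

open OTree

open _root_.RAM.Expr

/-! ### Rotations on codes in memory -/

theorem holds_append {f : ℕ → ℕ} {o : ℕ} {L L' : List Bool} :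
    Holds f o (L ++ L') ↔ Holds f o L ∧ Holds f (o + L.length) L' := by
  refine ⟨fun h => ⟨fun j hj => ?_, fun j hj => ?_⟩, fun h => h.1.append h.2⟩
  · rw [h j (by simp; omega), List.getElem_append_left hj]
  · rw [add_assoc, h (L.length + j) (by simpa using hj), List.getElem_append_right (by omega)]
    simp

theorem holds_cons {f : ℕ → ℕ} {o : ℕ} {b : Bool} {L : List Bool} :
    Holds f o (b :: L) ↔ f o = b.toNat ∧ Holds f (o + 1) L := by
  refine ⟨fun h => ⟨h 0 (by simp), fun j hj => ?_⟩, fun h j hj => ?_⟩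
  · rw [show o + 1 + j = o + (j + 1) by omega, h (j + 1) (by simpa using hj)]
    simp
  · cases j with
    | zero => simpa using h.1
    | succ j =>
      rw [show o + (j + 1) = o + 1 + j by omega, h.2 j (by simpa using hj)]
      simp

theorem holds_nil (f : ℕ → ℕ) (o : ℕ) : Holds f o [] := fun j hj => by simp at hj

/-- Two words of the same length in memory are equal if and only if the cells are. -/
theorem Holds.eq_iff {f g : ℕ → ℕ} {o o' : ℕ} {L L' : List Bool} (h : Holds f o L)
    (h' : Holds g o' L') (hL : L.length = L'.length) :
    L = L' ↔ ∀ i < L.length, f (o + i) = g (o' + i) := by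
  constructor
  · rintro rfl i hi
    rw [h i hi, h' i hi]
  · intro H
    have inj : ∀ a b : Bool, a.toNat = b.toNat → a = b := by decide
    refine List.ext_getElem hL fun i h1 h2 => inj _ _ ?_
    rw [← h i h1, ← h' i h2, H i h1]

/-- Only the variables in `X` and the arrays in `Y` have changed. -/
structure Frame (X : List ℕ) (Y : List (Fin 16)) (s s' : AState) : Prop where
  inp : s'.inp = s.inp
  v : ∀ x, x ∉ X → s'.v x = s.v x
  arr : ∀ a, a ∉ Y → s'.arr a = s.arr a

theorem Frame.refl (X : List ℕ) (Y : List (Fin 16)) (s : AState) : Frame X Y s s :=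
  ⟨rfl, fun _ _ => rfl, fun _ _ => rfl⟩

theorem Frame.trans {X X' : List ℕ} {Y Y' : List (Fin 16)} {s s' s'' : AState}
    (h : Frame X Y s s') (h' : Frame X' Y' s' s'') (hX : X' ⊆ X := by simp)
    (hY : Y' ⊆ Y := by simp) : Frame X Y s s'' :=
  ⟨h'.inp.trans h.inp, fun x hx => (h'.v x fun h => hx (hX h)).trans (h.v x hx),
    fun a ha => (h'.arr a fun h => ha (hY h)).trans (h.arr a ha)⟩

theorem Frame.set {X : List ℕ} {Y : List (Fin 16)} {s s' : AState} (h : Frame X Y s s') {x : ℕ}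
    (hx : x ∈ X) (n : ℕ) : Frame X Y s (s'.set x n) :=
  ⟨h.inp, fun y hy => by
    rw [AState.v_set, if_neg (by rintro rfl; exact hy hx), h.v y hy], h.arr⟩

theorem Frame.put {X : List ℕ} {Y : List (Fin 16)} {s s' : AState} (h : Frame X Y s s')
    {a : Fin 16} (ha : a ∈ Y) (i n : ℕ) : Frame X Y s (s'.put a i n) :=
  ⟨h.inp, h.v, fun b hb => by
    funext j
    rw [AState.arr_put, if_neg (by rintro rfl; exact hb ha), h.arr b hb]⟩

/-- Moves a letter to the left; variable `11` is the position, variable `14` the number of subtrees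
that remain to be moved. -/
def shiftLeft : Block :=
  .seq (.put 6 (var 11) (arr 6 (var 11 + 1))) <|
  .seq (.ite (arr 6 (var 11)) (.set 14 (var 14 + 1)) (.set 14 (var 14 - 1))) <|
  .set 11 (var 11 + 1)

/-- Moves a letter to the right; variable `11` is the position, variable `14` the number of subtrees
that have been moved. -/
def shiftRight : Block :=
  .seq (.put 6 (var 11) (arr 6 (var 11 - 1))) <|
  .seq (.ite (arr 6 (var 11)) (.set 14 (var 14 - 1)) (.set 14 (var 14 + 1))) <|
  .set 11 (var 11 - 1)

theorem shiftLeft_eval {s : AState} {b : Bool} (h : s.arr 6 (s.v 11 + 1) = b.toNat) :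
    shiftLeft.eval s = ((s.put 6 (s.v 11) b.toNat).set 14
      (if b then s.v 14 + 1 else s.v 14 - 1)).set 11 (s.v 11 + 1) := by
  cases b <;> simp at h <;> simp [shiftLeft, Block.eval, h]

theorem shiftRight_eval {s : AState} {b : Bool} (h : s.arr 6 (s.v 11 - 1) = b.toNat) :
    shiftRight.eval s = ((s.put 6 (s.v 11) b.toNat).set 14
      (if b then s.v 14 - 1 else s.v 14 + 1)).set 11 (s.v 11 - 1) := by
  cases b <;> simp at h <;> simp [shiftRight, Block.eval, h]

/-- Effect of moving a code: the new position, the new counter, and the range of changed cells. -/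
structure Moved (s s' : AState) (x c lo hi : ℕ) : Prop where
  pos : s'.v 11 = x
  cnt : s'.v 14 = c
  old : ∀ j, j < lo ∨ hi ≤ j → s'.arr 6 j = s.arr 6 j
  frame : Frame [11, 14] [6] s s'

/-- An interior node turns one pending subtree into two and a leaf completes one, so the counter
stays above `c` strictly inside the code and falls to `c` at its end. For `c = 0` a loop on the
counter therefore finds the end of `a` by itself. -/
theorem shiftLeft_tree (a : OTree) (s : AState) (x c : ℕ) (hx : s.v 11 = x) (hc : s.v 14 = c + 1)
    (hW : Holds (s.arr 6) (x + 1) (code a)) :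
    Moved s (shiftLeft.eval^[(code a).length] s) (x + (code a).length) c x (x + (code a).length) ∧
      Holds ((shiftLeft.eval^[(code a).length] s).arr 6) x (code a) ∧
      ∀ j < (code a).length, c < (shiftLeft.eval^[j] s).v 14 := by
  induction a generalizing s x c with
  | nil =>
    have h := shiftLeft_eval (s := s) (b := false) (by rw [hx]; exact (holds_cons.1 hW).1)
    simp only [code, List.length_singleton, Function.iterate_one, h]
    refine ⟨⟨by simp [hx], by simp [hc], fun j hj => ?_, ?_⟩, ?_, fun j hj => ?_⟩
    · have : j ≠ x := by omega
      simp [hx, this]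
    · exact (((Frame.refl _ _ s).put (by simp) _ _).set (by simp) _).set (by simp) _
    · exact holds_cons.2 ⟨by simp [hx], holds_nil _ _⟩
    · obtain rfl : j = 0 := by omega
      simp [hc]
  | node _ l r ihl ihr =>
    have hW' : Holds (s.arr 6) (x + 1) (true :: (code l ++ code r)) := hW
    rw [holds_cons, holds_append] at hW'
    obtain ⟨h1, h2, h3⟩ := hW'
    have h := shiftLeft_eval (s := s) (b := true) (by rw [hx]; exact h1)
    set s1 := shiftLeft.eval s with hs1
    have f1 : Frame [11, 14] [6] s s1 := by
      rw [h]
      exact (((Frame.refl _ _ s).put (by simp) _ _).set (by simp) _).set (by simp) _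
    have old1 : ∀ j, j ≠ x → s1.arr 6 j = s.arr 6 j := fun j hj => by simp [h, hx, hj]
    obtain ⟨M2, H2, N2⟩ := ihl s1 (x + 1) (c + 1) (by simp [h, hx]) (by simp [h, hc])
      (h2.congr fun j h1 h2 => old1 j (by omega))
    set s2 := shiftLeft.eval^[(code l).length] s1 with hs2
    obtain ⟨M3, H3, N3⟩ := ihr s2 (x + 1 + (code l).length) c M2.pos M2.cnt (by
      refine Holds.congr (by rwa [add_right_comm] at h3) fun j h1 h2 => ?_
      rw [M2.old j (Or.inr (by omega)), old1 j (by omega)])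
    set s3 := shiftLeft.eval^[(code r).length] s2 with hs3
    have hlen : (code (.node () l r)).length = (code r).length + ((code l).length + 1) := by
      simp only [code, List.length_cons, List.length_append]; omega
    have hs : shiftLeft.eval^[(code (.node () l r)).length] s = s3 := by
      rw [hlen, Function.iterate_add_apply, Function.iterate_add_apply, Function.iterate_one]
    rw [hs, hlen]
    refine ⟨⟨by rw [M3.pos]; omega, M3.cnt, fun j hj => ?_,
      (f1.trans M2.frame).trans M3.frame⟩, ?_, fun j hj => ?_⟩
    · rw [M3.old j (by omega), M2.old j (by omega), old1 j (by omega)]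
    · refine holds_cons.2 ⟨?_, holds_append.2 ⟨H2.congr fun j h1 h2 => ?_, H3⟩⟩
      · rw [M3.old x (by omega), M2.old x (by omega), h]
        simp [hx]
      · rw [M3.old j (by omega)]
    · rcases Nat.eq_zero_or_pos j with rfl | h0
      · simp [hc]
      obtain ⟨j, rfl⟩ : ∃ i, j = i + 1 := ⟨j - 1, by omega⟩
      rw [Function.iterate_succ_apply, ← hs1]
      by_cases h4 : j < (code l).length
      · have := N2 j h4; omega
      · obtain ⟨i, rfl⟩ : ∃ i, j = i + (code l).length := ⟨j - (code l).length, by omega⟩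
        rw [Function.iterate_add_apply, ← hs2]
        exact N3 i (by omega)

/-- From right to left, a leaf is a new complete subtree and an interior node merges two. The
counter therefore exceeds its initial value after every step, and exceeds it by one at the end. -/
theorem shiftRight_tree (a : OTree) (s : AState) (i c : ℕ) (hx : s.v 11 = i + (code a).length)
    (hc : s.v 14 = c) (hW : Holds (s.arr 6) i (code a)) :
    Moved s (shiftRight.eval^[(code a).length] s) i (c + 1) (i + 1) (i + (code a).length + 1) ∧
      Holds ((shiftRight.eval^[(code a).length] s).arr 6) (i + 1) (code a) ∧
      ∀ j, 1 ≤ j → j ≤ (code a).length → c < (shiftRight.eval^[j] s).v 14 := by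
  induction a generalizing s i c with
  | nil =>
    simp only [code, List.length_singleton] at hx
    have h := shiftRight_eval (s := s) (b := false) (by rw [hx]; exact (holds_cons.1 hW).1)
    simp only [code, List.length_singleton, Function.iterate_one, h]
    refine ⟨⟨by simp [hx], by simp [hc], fun j hj => ?_, ?_⟩, ?_, fun j h1 h2 => ?_⟩
    · have : j ≠ i + 1 := by omega
      simp [hx, this]
    · exact (((Frame.refl _ _ s).put (by simp) _ _).set (by simp) _).set (by simp) _
    · exact holds_cons.2 ⟨by simp [hx], holds_nil _ _⟩
    · obtain rfl : j = 1 := by omega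
      simp [h, hc]
  | node _ l r ihl ihr =>
    have hlen : (code (.node () l r)).length = 1 + ((code l).length + (code r).length) := by
      simp only [code, List.length_cons, List.length_append]; omega
    have hx' : s.v 11 = i + (1 + ((code l).length + (code r).length)) := hx.trans (by rw [← hlen])
    have hW' : Holds (s.arr 6) i (true :: (code l ++ code r)) := hW
    rw [holds_cons, holds_append] at hW'
    obtain ⟨h1, h2, h3⟩ := hW'
    obtain ⟨M1, H1, N1⟩ := ihr s (i + 1 + (code l).length) c (by omega) hc h3
    set s1 := shiftRight.eval^[(code r).length] s with hs1
    obtain ⟨M2, H2, N2⟩ := ihl s1 (i + 1) (c + 1) M1.pos M1.cnt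
      (h2.congr fun j h1 h2 => M1.old j (by omega))
    set s2 := shiftRight.eval^[(code l).length] s1 with hs2
    have h := shiftRight_eval (s := s2) (b := true) (by
      rw [M2.pos, Nat.add_sub_cancel, M2.old _ (by omega), M1.old _ (by omega)]; exact h1)
    rw [M2.pos, M2.cnt] at h
    simp only [if_true, Nat.add_sub_cancel] at h
    set s3 := shiftRight.eval s2 with hs3
    have hs : shiftRight.eval^[(code (.node () l r)).length] s = s3 := by
      rw [hlen, Function.iterate_add_apply, Function.iterate_add_apply, Function.iterate_one]
    have old3 : ∀ j, j ≠ i + 1 → s3.arr 6 j = s2.arr 6 j := fun j hj => by simp [h, hj]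
    have f3 : Frame [11, 14] [6] s2 s3 := by
      rw [h]
      exact (((Frame.refl _ _ s2).put (by simp) _ _).set (by simp) _).set (by simp) _
    rw [hs, hlen]
    refine ⟨⟨by simp [h], by simp [h], fun j hj => ?_, (M1.frame.trans M2.frame).trans f3⟩, ?_,
      fun j h4 h5 => ?_⟩
    · rw [old3 j (by omega), M2.old j (by omega), M1.old j (by omega)]
    · refine holds_cons.2 ⟨by simp [h], holds_append.2 ⟨H2.congr fun j h1 h2 => ?_,
        Holds.congr (by rwa [add_right_comm] at H1) fun j h1 h2 => ?_⟩⟩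
      · exact old3 j (by omega)
      · rw [old3 j (by omega), M2.old j (by omega)]
    · by_cases h6 : j ≤ (code r).length
      · exact N1 j h4 h6
      obtain ⟨j, rfl⟩ : ∃ m, j = m + (code r).length := ⟨j - (code r).length, by omega⟩
      rw [Function.iterate_add_apply, ← hs1]
      by_cases h7 : j ≤ (code l).length
      · have := N2 j (by omega) h7; omega
      obtain rfl : j = 1 + (code l).length := by omega
      rw [Function.iterate_add_apply, ← hs2, Function.iterate_one, ← hs3, h]
      simp

/-- Rotation at the position in variable `13` of the code in array `6`. -/
def rotateP : Prog :=
  iteP (var 13)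
    (iteP (arr 6 (var 13))
      (iteP (arr 6 (var 13 - 1))
        (.seq (Block.seq (.set 11 (var 13)) (.set 14 1)).compile
          (.seq (whileP 14 shiftLeft.compile) (Block.put 6 (var 11) 1).compile))
        (.seq (Block.seq (.set 11 (var 13)) (.seq (.set 14 0) shiftRight)).compile
          (whileP 14 shiftRight.compile)))
      (Block.set 11 0).compile)
    (Block.set 11 0).compile

theorem linear_le {a b n m : ℕ} (h : n ≤ m) : a * n + b ≤ (a + b) * (m + 1) := by
  nlinarith [Nat.mul_le_mul_left a h, Nat.zero_le (b * m)]

/-- The letter before an interior node tells which child it is: after a `1` it is a left child,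
after a `0` a right child. A right rotation moves the code of `a` one cell to the left over the
letter of the node, a left rotation moves it back. The constants in the time bound are merely
generous. -/
theorem rotateP_spec : ∃ C, ∀ (s : AState) (t : OTree) (q : ℕ), s.v 13 = q →
    q < (code t).length → Holds (s.arr 6) 0 (code t) →
    ∃ s', Realizes rotateP s s' (C * ((code t).length + 1)) ∧
      Holds (s'.arr 6) 0 (code (rotAt t q)) ∧ Frame [11, 14] [6] s s' := by
  refine ⟨shiftLeft.cost + shiftRight.cost + 100, fun s t q hq hlt hW => ?_⟩
  have hbig : ∀ n, n ≤ 100 →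
      n ≤ (shiftLeft.cost + shiftRight.cost + 100) * ((code t).length + 1) := fun n hn =>
    (by omega : n ≤ shiftLeft.cost + shiftRight.cost + 100).trans
      (Nat.le_mul_of_pos_right _ (by omega))
  have hskip := (Block.set 11 0).realizes s
  have fskip : Frame [11, 14] [6] s ((Block.set 11 0).eval s) := (Frame.refl _ _ s).set (by simp) _
  rcases code_rotAt t q hlt with ⟨e, h | h⟩ | ⟨u, a, v, e1, e2, e3⟩ | ⟨u, a, v, e1, e2, e3⟩
  · refine ⟨_, (hskip.iteP_false (by simp [hq, h])).mono ?_, by rw [e]; exact hW, fskip⟩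
    exact hbig _ (by decide)
  · refine ⟨_, ?_, by rw [e]; exact hW, fskip⟩
    have h1 : s.arr 6 q = 0 := by simpa [h] using hW q hlt
    by_cases h0 : q = 0
    · refine (hskip.iteP_false (by simp [hq, h0])).mono ?_
      exact hbig _ (by decide)
    · refine ((hskip.iteP_false (by simp [hq, h1])).iteP_true (by simp [hq, h0])).mono ?_
      exact hbig _ (by decide)
  · rw [e1, holds_append, holds_cons, holds_cons, holds_append] at hW
    obtain ⟨w1, w2, w3, w4, w5⟩ := hW
    simp only [zero_add] at w2 w3 w4 w5
    set s1 := (Block.seq (.set 11 (var 13)) (.set 14 1)).eval s with hs1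
    have hs1' : s1 = (s.set 11 q).set 14 1 := by simp [hs1, Block.eval, hq]
    obtain ⟨M, H, N⟩ := shiftLeft_tree a s1 q 0 (by simp [hs1']) (by simp [hs1'])
      (by rw [e2, hs1']; exact w4)
    set s2 := shiftLeft.eval^[(code a).length] s1 with hs2
    have r1 := (Block.seq (.set 11 (var 13)) (.set 14 1)).realizes s
    have r2 := Realizes.while_iterate (x := 14) (fun s => shiftLeft.realizes s)
      (n := (code a).length) (s := s1) (fun j hj => (N j hj).ne') M.cnt
    -- The cell freed behind `a` receives the letter of the new right child.
    have r3 := (Block.put 6 (var 11) 1).realizes s2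
    have hs3 : (Block.put 6 (var 11) 1).eval s2 = s2.put 6 (q + (code a).length) 1 := by
      simp [Block.eval, M.pos]
    rw [hs3] at r3
    have hq0 : q ≠ 0 := by omega
    have hb : s.arr 6 (q - 1) = 1 := by rw [e2, Nat.add_sub_cancel]; exact w2
    have hb' : s.arr 6 q = 1 := by rw [e2]; exact w3
    have r : Realizes rotateP s _ _ :=
      ((((r1.seq (r2.seq r3)).iteP_true (e := arr 6 (var 13 - 1)) (by simp [hq, hb])
      ).iteP_true (e := arr 6 (var 13)) (by simp [hq, hb'])).iteP_true (e := var 13)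
      (by simp [hq, hq0]))
    refine ⟨_, r.mono ?_, ?_, ?_⟩
    · have hle : (code a).length ≤ (code t).length := by
        rw [e1]; simp only [List.length_append, List.length_cons]; omega
      have := linear_le (a := shiftLeft.cost + 1) (b := 60) hle
      simp only [Expr.cost, Block.cost, cost_sub]
      nlinarith
    · have o1 : ∀ j, j < q ∨ q + (code a).length < j → (s2.put 6 (q + (code a).length) 1).arr 6 j =
          s.arr 6 j := by
        intro j hj
        rw [AState.arr_put, if_pos rfl, if_neg (by omega), M.old j (by omega), hs1']
        rfl
      rw [e3, holds_append, holds_cons, holds_append, holds_cons]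
      simp only [zero_add]
      refine ⟨w1.congr fun j h1 h2 => o1 j (by omega), ?_, ?_, ?_, ?_⟩
      · rw [o1 _ (by omega)]; exact w2
      · rw [← e2]
        refine H.congr fun j h1 h2 => ?_
        rw [AState.arr_put, if_pos rfl, if_neg (by omega)]
      · rw [← e2]; simp
      · refine Holds.congr (by rwa [add_right_comm] at w5) fun j h1 h2 => o1 j (by omega)
    · have f1 : Frame [11, 14] [6] s s1 := by
        rw [hs1']
        exact ((Frame.refl _ _ s).set (by simp) _).set (by simp) _
      exact (f1.trans M.frame).put (by simp) _ _
  · rw [e1, holds_append, holds_cons, holds_append, holds_cons] at hW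
    obtain ⟨w1, w2, w3, w4, w5⟩ := hW
    simp only [zero_add] at w2 w3 w4 w5
    set s0 := (s.set 11 q).set 14 0 with hs0
    have f0 : Frame [11, 14] [6] s s0 := ((Frame.refl _ _ s).set (by simp) _).set (by simp) _
    obtain ⟨M, H, N⟩ := shiftRight_tree a s0 (u.length + 1) 0 (by simp [hs0, e2])
      (by simp [hs0]) w3
    set s1 := shiftRight.eval^[(code a).length] s0 with hs1
    have h := shiftRight_eval (s := s1) (b := true) (by
      rw [M.pos, Nat.add_sub_cancel, M.old _ (by omega)]; exact w2)
    rw [M.pos, M.cnt] at h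
    simp only [if_true, Nat.add_sub_cancel] at h
    have r1 := (Block.seq (.set 11 (var 13)) (.seq (.set 14 0) shiftRight)).realizes s
    have hb1 : (Block.seq (.set 11 (var 13)) (.seq (.set 14 0) shiftRight)).eval s =
        shiftRight.eval s0 := by simp [Block.eval, hs0, hq]
    rw [hb1] at r1
    -- One step precedes the loop because the counter starts at `0`. The last of the `(code
    -- a).length + 1` steps moves the parent's letter, which brings the counter from `1` back to `0`
    -- and puts the required `1` in front of `a`.
    have e4 : shiftRight.eval^[(code a).length] (shiftRight.eval s0) = shiftRight.eval s1 := by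
      rw [hs1, ← Function.iterate_succ_apply, Function.iterate_succ_apply']
    have r2 := Realizes.while_iterate (x := 14) (fun s => shiftRight.realizes s)
      (n := (code a).length) (s := shiftRight.eval s0)
      (fun j hj => by
        rw [← Function.iterate_succ_apply]
        exact (N (j + 1) (by omega) (by omega)).ne')
      (by rw [e4, h]; simp)
    rw [e4] at r2
    have hap := length_code_pos a
    have hq0 : q ≠ 0 := by omega
    have hb' : s.arr 6 q = 1 := by rw [e2]; exact w4
    -- The letter before `q` is the last letter of `a`, a leaf.
    have hb : s.arr 6 (q - 1) = 0 := by
      have h1 := w3 ((code a).length - 1) (by omega)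
      have h2 : (code a)[(code a).length - 1] = false := by
        rw [← List.getLast_eq_getElem (code_ne_nil a)]
        exact getLast_code a
      rw [h2] at h1
      rw [e2, show u.length + 1 + (code a).length - 1 = u.length + 1 + ((code a).length - 1) by
        omega, h1]
      rfl
    have r : Realizes rotateP s _ _ :=
      ((((r1.seq r2).iteP_false (e := arr 6 (var 13 - 1)) (by simp [hq, hb])
      ).iteP_true (e := arr 6 (var 13)) (by simp [hq, hb'])).iteP_true (e := var 13)
      (by simp [hq, hq0]))
    refine ⟨_, r.mono ?_, ?_, ?_⟩
    · have hle : (code a).length ≤ (code t).length := by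
        rw [e1]; simp only [List.length_append, List.length_cons]; omega
      have := linear_le (a := shiftRight.cost + 1) (b := 60) hle
      simp only [Expr.cost, Block.cost, cost_sub]
      nlinarith
    · have o1 : ∀ j, j ≤ u.length ∨ q < j → (shiftRight.eval s1).arr 6 j = s.arr 6 j := by
        intro j hj
        rw [h]
        simp only [AState.arr_set, AState.arr_put, if_true]
        rw [if_neg (by omega), M.old j (by omega)]
        rfl
      rw [e3, holds_append, holds_cons, holds_cons, holds_append]
      simp only [zero_add]
      refine ⟨w1.congr fun j h1 h2 => o1 j (by omega), ?_, ?_, ?_, ?_⟩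
      · rw [o1 _ (by omega)]; exact w2
      · rw [h]; simp
      · refine H.congr fun j h1 h2 => ?_
        rw [h]
        simp only [AState.arr_set, AState.arr_put, if_true]
        rw [if_neg (by omega)]
      · refine Holds.congr (by rwa [add_right_comm] at w5) fun j h1 h2 => o1 j (by omega)
    · rw [h]
      exact (((f0.trans M.frame).put (by simp) _ _).set (by simp) _).set (by simp) _

/-! ### The search -/

/-- Copies the first word of array `5`, of length in variable `9`, to array `6`. -/
def copyStep : Block :=
  .seq (.put 6 (var 11) (arr 5 (var 11))) <| .seq (.set 11 (var 11 + 1)) (.set 12 (var 12 - 1))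

/-- The loop of `copyStep`. -/
def copyP : Prog :=
  .seq (Block.seq (.set 11 0) (.set 12 (var 9))).compile (whileP 12 copyStep.compile)

theorem copyP_spec : ∃ C, ∀ (s : AState) (L : List Bool), s.v 9 = L.length → Holds (s.arr 5) 0 L →
    ∃ s', Realizes copyP s s' (C * (L.length + 1)) ∧ Holds (s'.arr 6) 0 L ∧
      Frame [11, 12] [6] s s' := by
  refine ⟨copyStep.cost + 1 + (1 + (Block.seq (.set 11 0) (.set 12 (var 9))).cost),
    fun s L h9 hL => ?_⟩
  have r1 := (Block.seq (.set 11 0) (.set 12 (var 9))).realizes s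
  have f1 : Frame [11, 12] [6] s ((Block.seq (.set 11 0) (.set 12 (var 9))).eval s) :=
    ((Frame.refl _ _ s).set (by simp) _).set (by simp) _
  obtain ⟨m, s', ⟨h1, h2, h3, h4⟩, h5, r2⟩ := Realizes.while_inv (x := 12) (p := copyStep.compile)
    (T := copyStep.cost)
    (fun n s' => s'.v 12 = n ∧ s'.v 11 + n = L.length ∧
      (∀ i < s'.v 11, s'.arr 6 i = s.arr 5 i) ∧ Frame [11, 12] [6] s s')
    (fun n s' ⟨h1, h2, h3, h4⟩ hne => by
      refine ⟨n - 1, _, by omega, ⟨?_, ?_, ?_, ?_⟩, copyStep.realizes s'⟩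
      · simp [copyStep, Block.eval, h1]
      · simp only [copyStep, Block.eval, AState.v_set, AState.v_put, eval_add, eval_var, eval_one]
        simp; omega
      · intro i hi
        simp [copyStep, Block.eval] at hi ⊢
        split_ifs with h
        · rw [h, h4.arr 5 (by decide)]
        · exact h3 i (by omega)
      · exact ((h4.put (by simp) _ _).set (by simp) _).set (by simp) _)
    (n := L.length) (s := (Block.seq (.set 11 0) (.set 12 (var 9))).eval s)
    ⟨by simp [Block.eval, h9], by simp [Block.eval], by simp [Block.eval], f1⟩
  refine ⟨s', (r1.seq r2).mono ?_, fun j hj => ?_, h4⟩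
  · have := linear_le (a := copyStep.cost + 1)
      (b := 1 + (Block.seq (.set 11 0) (.set 12 (var 9))).cost) (le_refl L.length)
    omega
  · rw [zero_add, h3 j (by omega)]
    simpa using hL j hj

/-- Performs the rotations at the positions in array `7`; their number is in variable `0`. -/
def applyP : Prog :=
  .seq (Block.seq (.set 16 0) (.set 17 (var 0))).compile
    (whileP 17 (.seq (Block.set 13 (arr 7 (var 16))).compile
      (.seq rotateP (Block.seq (.set 16 (var 16 + 1)) (.set 17 (var 17 - 1))).compile)))

theorem applyP_spec : ∃ C, ∀ (s : AState) (t : OTree), (∀ i < s.v 0, s.arr 7 i < (code t).length) →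
    Holds (s.arr 6) 0 (code t) →
    ∃ s', Realizes applyP s s' (C * ((s.v 0 + 1) * ((code t).length + 1))) ∧
      Holds (s'.arr 6) 0 (code (rotSeq t (s.arr 7) (s.v 0))) ∧
      Frame [11, 13, 14, 16, 17] [6] s s' := by
  obtain ⟨C, hC⟩ := rotateP_spec
  set b1 := Block.set 13 (arr 7 (var 16)) with hb1
  set b2 := Block.seq (.set 16 (var 16 + 1)) (.set 17 (var 17 - 1)) with hb2
  set b0 := Block.seq (.set 16 0) (.set 17 (var 0)) with hb0
  refine ⟨C + b0.cost + b1.cost + b2.cost + 2, fun s t hd hW => ?_⟩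
  have r1 := b0.realizes s
  have f1 : Frame [11, 13, 14, 16, 17] [6] s (b0.eval s) :=
    ((Frame.refl _ _ s).set (by simp) _).set (by simp) _
  obtain ⟨m, s', ⟨h1, h2, h3, h4⟩, h5, r2⟩ := Realizes.while_inv (x := 17)
    (p := .seq b1.compile (.seq rotateP b2.compile))
    (T := b1.cost + (C * ((code t).length + 1) + b2.cost))
    (fun n s' => s'.v 17 = n ∧ s'.v 16 + n = s.v 0 ∧
      Holds (s'.arr 6) 0 (code (rotSeq t (s.arr 7) (s'.v 16))) ∧
      Frame [11, 13, 14, 16, 17] [6] s s')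
    (fun n s' ⟨h1, h2, h3, h4⟩ hne => by
      have g1 := b1.realizes s'
      have e1 : b1.eval s' = s'.set 13 (s.arr 7 (s'.v 16)) := by
        simp [hb1, Block.eval, h4.arr 7 (by decide)]
      rw [e1] at g1
      have hlen := length_code_rotSeq (t := t) (f := s.arr 7) (k := s'.v 16)
        fun i hi => hd i (by omega)
      obtain ⟨s'', g2, g3, g4⟩ := hC (s'.set 13 (s.arr 7 (s'.v 16))) (rotSeq t (s.arr 7) (s'.v 16))
        (s.arr 7 (s'.v 16)) (by simp) (by rw [hlen]; exact hd _ (by omega)) (by simpa using h3)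
      rw [hlen] at g2
      have h16 : s''.v 16 = s'.v 16 := by rw [g4.v 16 (by simp)]; simp
      have h17 : s''.v 17 = s'.v 17 := by rw [g4.v 17 (by simp)]; simp
      refine ⟨n - 1, _, by omega, ⟨?_, ?_, ?_, ?_⟩, g1.seq (g2.seq (b2.realizes s''))⟩
      · simp [hb2, Block.eval, h17, h1]
      · simp [hb2, Block.eval, h16]; omega
      · simpa [hb2, Block.eval, h16, rotSeq] using g3
      · exact (((h4.set (by simp) _).trans g4).set (by simp) _).set (by simp) _)
    (n := s.v 0) (s := b0.eval s)
    ⟨by simp [hb0, Block.eval], by simp [hb0, Block.eval],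
      by simpa [hb0, Block.eval, rotSeq] using hW, f1⟩
  refine ⟨s', (r1.seq r2).mono ?_, ?_, h4⟩
  · have e : (C + b0.cost + b1.cost + b2.cost + 2) * ((s.v 0 + 1) * ((code t).length + 1)) =
        b0.cost + ((b1.cost + (C * ((code t).length + 1) + b2.cost) + 1) * s.v 0 + 1) +
        (C * ((code t).length + 1) + (b1.cost + b2.cost + 1) * (s.v 0 * (code t).length +
          (code t).length + 1) + (b0.cost + 1) * (s.v 0 * (code t).length + s.v 0 +
          (code t).length)) := by
      ring
    rw [e]
    exact Nat.le_add_right _ _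
  · have : s'.v 16 = s.v 0 := by omega
    rwa [this] at h3

/-- Adds the differences of the letters of the word in array `6` and of the second word in
array `5`. -/
def compareStep : Block :=
  .seq (.set 15 (var 15 + ((arr 6 (var 11) - arr 5 (var 9 + var 11)) +
    (arr 5 (var 9 + var 11) - arr 6 (var 11))))) <|
  .seq (.set 11 (var 11 + 1)) (.set 12 (var 12 - 1))

/-- The loop of `compareStep`. -/
def compareP : Prog :=
  .seq (Block.seq (.set 15 0) (.seq (.set 11 0) (.set 12 (var 9)))).compile
    (whileP 12 compareStep.compile)

/-- The accumulated sum of absolute differences is zero exactly if the codes agree, and codes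
determine trees. -/
theorem compareP_spec : ∃ C, ∀ (s : AState) (t u : OTree), s.v 9 = (code t).length →
    (code t).length = (code u).length → Holds (s.arr 6) 0 (code t) →
    Holds (s.arr 5) (s.v 9) (code u) →
    ∃ s', Realizes compareP s s' (C * ((code t).length + 1)) ∧ (s'.v 15 = 0 ↔ t = u) ∧
      Frame [11, 12, 15] [] s s' := by
  set b0 := Block.seq (.set 15 0) (.seq (.set 11 0) (.set 12 (var 9))) with hb0
  refine ⟨compareStep.cost + 1 + (1 + b0.cost), fun s t u h9 htu ht hu => ?_⟩
  have r1 := b0.realizes s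
  have f1 : Frame [11, 12, 15] [] s (b0.eval s) :=
    (((Frame.refl _ _ s).set (by simp) _).set (by simp) _).set (by simp) _
  obtain ⟨m, s', ⟨h1, h2, h3, h4⟩, h5, r2⟩ := Realizes.while_inv (x := 12)
    (p := compareStep.compile) (T := compareStep.cost)
    (fun n s' => s'.v 12 = n ∧ s'.v 11 + n = (code t).length ∧
      (s'.v 15 = 0 ↔ ∀ i < s'.v 11, s.arr 6 (0 + i) = s.arr 5 (s.v 9 + i)) ∧
      Frame [11, 12, 15] [] s s')
    (fun n s' ⟨h1, h2, h3, h4⟩ hne => by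
      refine ⟨n - 1, _, by omega, ⟨?_, ?_, ?_, ?_⟩, compareStep.realizes s'⟩
      · simp [compareStep, Block.eval, h1]
      · simp [compareStep, Block.eval]; omega
      · have e : (compareStep.eval s').v 15 = s'.v 15 + ((s.arr 6 (s'.v 11) -
            s.arr 5 (s.v 9 + s'.v 11)) + (s.arr 5 (s.v 9 + s'.v 11) - s.arr 6 (s'.v 11))) := by
          simp [compareStep, Block.eval, h4.arr 5 (by simp), h4.arr 6 (by simp), h4.v 9 (by simp)]
        have e' : (compareStep.eval s').v 11 = s'.v 11 + 1 := by simp [compareStep, Block.eval]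
        rw [e, e', Nat.forall_lt_succ_right, ← h3, zero_add]
        omega
      · exact ((h4.set (by simp) _).set (by simp) _).set (by simp) _)
    (n := (code t).length) (s := b0.eval s)
    ⟨by simp [hb0, Block.eval, h9], by simp [hb0, Block.eval], by simp [hb0, Block.eval], f1⟩
  refine ⟨s', (r1.seq r2).mono ?_, ?_, h4⟩
  · have := linear_le (a := compareStep.cost + 1) (b := 1 + b0.cost) (le_refl (code t).length)
    omega
  · rw [h3, show s'.v 11 = (code t).length by omega, ← ht.eq_iff hu htu]
    exact ⟨code_injective, fun h => by rw [h]⟩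

/-- Variable `17` is set to a value different from `0` if the digit at the position in variable `16`
exists and is maximal. -/
def carryTest : Block :=
  .ite (var 0 - var 16) (.set 17 (arr 7 (var 16) + 2 - var 9)) (.set 17 0)

/-- Replaces a maximal digit by `0`. -/
def carryStep : Block := .seq (.put 7 (var 16) 0) (.seq (.set 16 (var 16 + 1)) carryTest)

/-- Increases the number in array `7` by one; variable `10` is set to `0` if this is not
possible. -/
def incrP : Prog :=
  .seq (Block.seq (.set 16 0) carryTest).compile <|
  .seq (whileP 17 carryStep.compile)
    (Block.ite (var 0 - var 16) (.put 7 (var 16) (arr 7 (var 16) + 1)) (.set 10 0)).compile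

theorem carryTest_v (s : AState) : (carryTest.eval s).v 17 =
    if s.v 16 < s.v 0 then s.arr 7 (s.v 16) + 2 - s.v 9 else 0 := by
  by_cases h : s.v 16 < s.v 0
  · have h' : s.v 0 - s.v 16 ≠ 0 := by omega
    simp [carryTest, Block.eval, h, h']
  · have h' : s.v 0 - s.v 16 = 0 := by omega
    simp [carryTest, Block.eval, h, h']

theorem carryTest_v_sixteen (s : AState) : (carryTest.eval s).v 16 = s.v 16 := by
  simp only [carryTest, Block.eval]
  split_ifs <;> simp

theorem carryTest_arr (s : AState) : (carryTest.eval s).arr = s.arr := by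
  simp only [carryTest, Block.eval]
  split_ifs <;> simp

theorem carryTest_frame {Y : List (Fin 16)} {X : List ℕ} (hX : 17 ∈ X) {s s' : AState}
    (h : Frame X Y s s') : Frame X Y s (carryTest.eval s') := by
  simp only [carryTest, Block.eval]
  split_ifs
  · exact h.set hX _
  · exact h.set hX _

/-- In the loop invariant variable `16` counts the leading maximal digits, which have been reset. If
it reaches the number of digits, all of them were maximal and the enumeration is exhausted. -/
theorem incrP_spec : ∃ C, ∀ s : AState, (∀ i < s.v 0, s.arr 7 i < s.v 9) →
    ∃ s', Realizes incrP s s' (C * (s.v 0 + 1)) ∧ Frame [10, 16, 17] [7] s s' ∧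
      ((s'.v 10 = s.v 10 ∧ (∀ i < s.v 0, s'.arr 7 i < s.v 9) ∧
        digitVal (s.v 9) (s'.arr 7) (s.v 0) = digitVal (s.v 9) (s.arr 7) (s.v 0) + 1) ∨
      (s'.v 10 = 0 ∧ digitVal (s.v 9) (s.arr 7) (s.v 0) + 1 = s.v 9 ^ s.v 0)) := by
  set b0 := Block.seq (.set 16 0) carryTest with hb0
  set b1 := Block.ite (var 0 - var 16) (.put 7 (var 16) (arr 7 (var 16) + 1)) (.set 10 0) with hb1
  refine ⟨carryStep.cost + 1 + (1 + b0.cost + b1.cost), fun s hd => ?_⟩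
  have r1 := b0.realizes s
  have f1 : Frame [10, 16, 17] [7] s (b0.eval s) :=
    carryTest_frame (by simp) ((Frame.refl _ _ s).set (by simp) _)
  obtain ⟨m, s', ⟨h1, h2, h3, h4, h5, h10, hf⟩, h17, r2⟩ := Realizes.while_inv (x := 17)
    (p := carryStep.compile) (T := carryStep.cost)
    (fun n s' => s'.v 16 + n = s.v 0 ∧ (∀ i < s'.v 16, s.arr 7 i + 1 = s.v 9) ∧
      (∀ i < s'.v 16, s'.arr 7 i = 0) ∧ (∀ i, s'.v 16 ≤ i → s'.arr 7 i = s.arr 7 i) ∧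
      (s'.v 17 = if s'.v 16 < s.v 0 then s.arr 7 (s'.v 16) + 2 - s.v 9 else 0) ∧
      s'.v 10 = s.v 10 ∧ Frame [10, 16, 17] [7] s s')
    (fun n s' ⟨h1, h2, h3, h4, h5, h10, hf⟩ hne => by
      have hlt : s'.v 16 < s.v 0 := by
        by_contra h; rw [if_neg h] at h5; exact hne h5
      rw [if_pos hlt] at h5
      have hd' := hd _ hlt
      set s1 := (s'.put 7 (s'.v 16) 0).set 16 (s'.v 16 + 1) with hs1
      have e : carryStep.eval s' = carryTest.eval s1 := by simp [carryStep, Block.eval, hs1]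
      have hf1 : Frame [10, 16, 17] [7] s s1 := (hf.put (by simp) _ _).set (by simp) _
      have e16 : (carryTest.eval s1).v 16 = s'.v 16 + 1 := by
        rw [carryTest_v_sixteen]; simp [hs1]
      refine ⟨n - 1, _, by omega, ⟨?_, ?_, ?_, ?_, ?_, ?_, ?_⟩, carryStep.realizes s'⟩ <;> rw [e]
      · rw [e16]; omega
      · rw [e16, Nat.forall_lt_succ_right]
        -- A digit `d` below the base is maximal exactly if `d + 2` exceeds the base, which is what
        -- `carryTest` measures.
        exact ⟨h2, by omega⟩
      · rw [e16, carryTest_arr, Nat.forall_lt_succ_right]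
        refine ⟨fun i hi => ?_, by simp [hs1]⟩
        simp [hs1, hi.ne, h3 i hi]
      · rw [e16, carryTest_arr]
        intro i hi
        have : i ≠ s'.v 16 := by omega
        simp [hs1, this, h4 i (by omega)]
      · have hv : s1.v 16 = s'.v 16 + 1 := by simp [hs1]
        rw [e16, carryTest_v, hf1.v 0 (by simp), hf1.v 9 (by simp), hv]
        have : s1.arr 7 (s'.v 16 + 1) = s.arr 7 (s'.v 16 + 1) := by
          simp [hs1, h4]
        rw [this]
      · have : (carryTest.eval s1).v 10 = s1.v 10 :=
          (carryTest_frame (X := [17]) (Y := []) (by simp) (Frame.refl _ _ s1)).v 10 (by simp)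
        rw [this]
        simp [hs1, h10]
      · exact carryTest_frame (by simp) hf1)
    (n := s.v 0) (s := b0.eval s) (by
      have e : b0.eval s = carryTest.eval (s.set 16 0) := by simp [hb0, Block.eval]
      have e16 : (carryTest.eval (s.set 16 0)).v 16 = 0 := by
        rw [carryTest_v_sixteen]; simp
      refine ⟨?_, ?_, ?_, ?_, ?_, ?_, f1⟩ <;> rw [e]
      · rw [e16]; omega
      · rw [e16]; simp
      · rw [e16]; simp
      · rw [carryTest_arr]; simp
      · rw [e16, carryTest_v]; simp
      · have : (carryTest.eval (s.set 16 0)).v 10 = (s.set 16 0).v 10 :=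
          (carryTest_frame (X := [17]) (Y := []) (by simp) (Frame.refl _ _ _)).v 10 (by simp)
        rw [this]
        simp)
  have r3 := b1.realizes s'
  have h0 : s'.v 0 = s.v 0 := hf.v 0 (by simp)
  refine ⟨_, (r1.seq (r2.seq r3)).mono ?_, ?_, ?_⟩
  · have := linear_le (a := carryStep.cost + 1) (b := 1 + b0.cost + b1.cost) (le_refl (s.v 0))
    omega
  · simp only [hb1, Block.eval]
    split_ifs
    · exact hf.set (by simp) _
    · exact hf.put (by simp) _ _
  · by_cases hlt : s'.v 16 < s.v 0
    · left
      have hne : ¬ s.v 0 - s'.v 16 = 0 := by omega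
      have e : b1.eval s' = s'.put 7 (s'.v 16) (s.arr 7 (s'.v 16) + 1) := by
        simp [hb1, Block.eval, h0, hne, h4]
      rw [h17, if_pos hlt] at h5
      rw [e]
      have a1 : ∀ i, (s'.put 7 (s'.v 16) (s.arr 7 (s'.v 16) + 1)).arr 7 i =
          if i = s'.v 16 then s.arr 7 (s'.v 16) + 1 else s'.arr 7 i := fun i => by simp
      refine ⟨h10, fun i hi => ?_, ?_⟩
      · rw [a1]
        split_ifs
        · omega
        · by_cases h : i < s'.v 16
          · rw [h3 i h]
            have := hd i hi; omega
          · rw [h4 i (by omega)]; exact hd i hi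
      · refine digitVal_succ hlt h2 (fun i hi => ?_) (by rw [a1, if_pos rfl]) fun i h6 h7 => ?_
        · rw [a1, if_neg hi.ne, h3 i hi]
        · rw [a1, if_neg h6.ne', h4 i h6.le]
    · right
      have hne : s.v 0 - s'.v 16 = 0 := by omega
      have e : b1.eval s' = s'.set 10 0 := by simp [hb1, Block.eval, h0, hne]
      rw [e]
      refine ⟨by simp, digitVal_max fun i hi => h2 i (by omega)⟩

/-- Tests whether the rotations at the positions in array `7` transform the first word in array `5`
into the second one, and passes on to the next sequence of positions. -/
def roundP : Prog :=
  .seq copyP <| .seq applyP <| .seq compareP <|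
    iteP (var 15) incrP (Block.seq (.set 18 1) (.set 10 0)).compile

/-- The codes of `t` and `u` are stored in array `5`. -/
structure Stored (s : AState) (t u : OTree) : Prop where
  len : s.v 9 = (code t).length
  len_eq : (code t).length = (code u).length
  fst : Holds (s.arr 5) 0 (code t)
  snd : Holds (s.arr 5) (s.v 9) (code u)

theorem Stored.congr {s s' : AState} {t u : OTree} (h : Stored s t u) {X : List ℕ}
    {Y : List (Fin 16)} (hf : Frame X Y s s') (hX : 9 ∉ X := by simp)
    (hY : 5 ∉ Y := by simp) : Stored s' t u := by
  obtain ⟨h1, h2, h3, h4⟩ := h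
  rw [← hf.arr 5 hY] at h3 h4
  rw [← hf.v 9 hX] at h1 h4
  exact ⟨h1, h2, h3, h4⟩

theorem roundP_spec : ∃ C, ∀ (s : AState) (t u : OTree), Stored s t u →
    (∀ i < s.v 0, s.arr 7 i < s.v 9) →
    ∃ s', Realizes roundP s s' (C * ((s.v 0 + 1) * (s.v 9 + 1))) ∧
      Frame [10, 11, 12, 13, 14, 15, 16, 17, 18] [6, 7] s s' ∧
      ((rotSeq t (s.arr 7) (s.v 0) = u ∧ s'.v 18 = 1 ∧ s'.v 10 = 0) ∨
        (rotSeq t (s.arr 7) (s.v 0) ≠ u ∧ s'.v 18 = s.v 18 ∧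
          ((s'.v 10 = s.v 10 ∧ (∀ i < s.v 0, s'.arr 7 i < s.v 9) ∧
            digitVal (s.v 9) (s'.arr 7) (s.v 0) = digitVal (s.v 9) (s.arr 7) (s.v 0) + 1) ∨
          (s'.v 10 = 0 ∧ digitVal (s.v 9) (s.arr 7) (s.v 0) + 1 = s.v 9 ^ s.v 0)))) := by
  obtain ⟨C1, h1⟩ := copyP_spec
  obtain ⟨C2, h2⟩ := applyP_spec
  obtain ⟨C3, h3⟩ := compareP_spec
  obtain ⟨C4, h4⟩ := incrP_spec
  set b := Block.seq (.set 18 1) (.set 10 0) with hb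
  refine ⟨C1 + C2 + C3 + C4 + (Expr.var 15).cost + 1 + b.cost, fun s t u hs hd => ?_⟩
  obtain ⟨s1, r1, hold1, f1⟩ := h1 s (code t) hs.len hs.fst
  have e0 : s1.v 0 = s.v 0 := f1.v 0 (by simp)
  have e7 : s1.arr 7 = s.arr 7 := f1.arr 7 (by simp)
  obtain ⟨s2, r2, hold2, f2⟩ := h2 s1 t (by rw [e0, e7, ← hs.len]; exact hd) hold1
  rw [e0, e7] at hold2
  rw [e0] at r2
  have hs2 : Stored s2 t u := (hs.congr f1).congr f2
  have hlen := length_code_rotSeq (t := t) (f := s.arr 7) (k := s.v 0) (by rw [← hs.len]; exact hd)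
  obtain ⟨s3, r3, hcmp, f3⟩ := h3 s2 (rotSeq t (s.arr 7) (s.v 0)) u (by rw [hlen, hs2.len])
    (by rw [hlen, hs.len_eq]) hold2 hs2.snd
  rw [hlen] at r3
  have f : Frame [10, 11, 12, 13, 14, 15, 16, 17, 18] [6, 7] s s3 :=
    (((Frame.refl _ _ s).trans f1).trans f2).trans f3
  have g0 : s3.v 0 = s.v 0 := f.v 0 (by simp)
  have g9 : s3.v 9 = s.v 9 := f.v 9 (by simp)
  have g7 : s3.arr 7 = s.arr 7 := by
    rw [f3.arr 7 (by simp), f2.arr 7 (by simp), f1.arr 7 (by simp)]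
  have g10 : s3.v 10 = s.v 10 := by
    rw [f3.v 10 (by simp), f2.v 10 (by simp), f1.v 10 (by simp)]
  have g18 : s3.v 18 = s.v 18 := by
    rw [f3.v 18 (by simp), f2.v 18 (by simp), f1.v 18 (by simp)]
  have cost : ∀ N, N ≤ C4 * (s.v 0 + 1) + b.cost →
      C1 * ((code t).length + 1) + (C2 * ((s.v 0 + 1) * ((code t).length + 1)) +
        (C3 * ((code t).length + 1) + ((Expr.var 15).cost + (N + 1)))) ≤
      (C1 + C2 + C3 + C4 + (Expr.var 15).cost + 1 + b.cost) * ((s.v 0 + 1) * (s.v 9 + 1)) := by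
    intro N hN
    rw [hs.len]
    have a1 : (code t).length + 1 ≤ (s.v 0 + 1) * ((code t).length + 1) :=
      Nat.le_mul_of_pos_left _ (by omega)
    have a2 : s.v 0 + 1 ≤ (s.v 0 + 1) * ((code t).length + 1) :=
      Nat.le_mul_of_pos_right _ (by omega)
    generalize (s.v 0 + 1) * ((code t).length + 1) = M at a1 a2
    have a3 := Nat.mul_le_mul_left C1 a1
    have a4 := Nat.mul_le_mul_left C3 a1
    have a5 := Nat.mul_le_mul_left C4 a2
    have a6 : (Expr.var 15).cost + 1 + b.cost ≤ ((Expr.var 15).cost + 1 + b.cost) * M :=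
      Nat.le_mul_of_pos_right _ (by omega)
    have a7 : (C1 + C2 + C3 + C4 + (Expr.var 15).cost + 1 + b.cost) * M =
      C1 * M + C2 * M + C3 * M + C4 * M + ((Expr.var 15).cost + 1 + b.cost) * M := by ring
    omega
  by_cases hu : rotSeq t (s.arr 7) (s.v 0) = u
  · refine ⟨b.eval s3, (r1.seq (r2.seq (r3.seq (Realizes.iteP_false (e := var 15) (hcmp.2 hu)
      (b.realizes s3))))).mono (cost _ (by omega)),
      (f.set (by simp) _).set (by simp) _, .inl ⟨hu, by simp [hb, Block.eval],
      by simp [hb, Block.eval]⟩⟩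
  · obtain ⟨s4, r4, f4, h⟩ := h4 s3 (by rw [g0, g7, g9]; exact hd)
    rw [g0, g7, g9, g10] at h
    rw [g0] at r4
    refine ⟨s4, (r1.seq (r2.seq (r3.seq (Realizes.iteP_true (e := var 15) (fun h => hu (hcmp.1 h))
      r4)))).mono (cost _ (by omega)), f.trans f4, .inr ⟨hu, ?_, h⟩⟩
    rw [f4.v 18 (by simp), g18]

/-- Tests all sequences of positions. -/
def searchP : Prog :=
  .seq (Block.set 10 1).compile <| .seq (whileP 10 roundP) (Block.set 0 (var 18)).compile

/-- The sequence in array `7` is read as a number in base `s.v 9`, the length of the code. While the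
search runs, every sequence with a smaller number has failed, and the rounds that remain make up the
difference to `s.v 9 ^ s.v 0`. -/
theorem searchP_spec : ∃ C, ∀ (s : AState) (t u : OTree), Stored s t u → (∀ i, s.arr 7 i = 0) →
    s.v 18 = 0 →
    ∃ s', Realizes searchP s s' (C * ((s.v 0 + 1) * (s.v 9 + 1) * s.v 9 ^ s.v 0)) ∧
      s'.v 0 = if rotationDist t u ≤ s.v 0 then 1 else 0 := by
  obtain ⟨C, hC⟩ := roundP_spec
  refine ⟨C + 2 + (Block.set 10 1).cost + (Block.set 0 (var 18)).cost,
    fun s t u hs h7 h18 => ?_⟩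
  have hpos : 0 < s.v 9 := by rw [hs.len]; exact length_code_pos t
  have r1 := (Block.set 10 1).realizes s
  obtain ⟨m, s', ⟨hf, h⟩, h10, r2⟩ := Realizes.while_inv (x := 10) (p := roundP)
    (T := C * ((s.v 0 + 1) * (s.v 9 + 1)))
    (fun n s' => Frame [10, 11, 12, 13, 14, 15, 16, 17, 18] [6, 7] s s' ∧
      ((s'.v 10 = 1 ∧ s'.v 18 = 0 ∧ (∀ i < s.v 0, s'.arr 7 i < s.v 9) ∧
        digitVal (s.v 9) (s'.arr 7) (s.v 0) + n = s.v 9 ^ s.v 0 ∧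
        ∀ g : ℕ → ℕ, (∀ i < s.v 0, g i < s.v 9) →
          digitVal (s.v 9) g (s.v 0) < digitVal (s.v 9) (s'.arr 7) (s.v 0) →
          rotSeq t g (s.v 0) ≠ u) ∨
      (s'.v 10 = 0 ∧ s'.v 18 = if rotationDist t u ≤ s.v 0 then 1 else 0)))
    (fun n s' ⟨hf, h⟩ hne => by
      rcases h with ⟨-, h18, hd, hn, hg⟩ | h
      · have e0 : s'.v 0 = s.v 0 := hf.v 0 (by simp)
        have e9 : s'.v 9 = s.v 9 := hf.v 9 (by simp)
        obtain ⟨s'', r, hf', h⟩ := hC s' t u (hs.congr hf) (by rwa [e0, e9])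
        rw [e0, e9] at h
        rw [e0, e9] at r
        have hlt := digitVal_lt hd
        refine ⟨n - 1, s'', by omega, ⟨hf.trans hf', ?_⟩, r⟩
        rcases h with ⟨h1, h2, h3⟩ | ⟨h1, h2, h3⟩
        · refine .inr ⟨h3, ?_⟩
          rw [h2, if_pos]
          rw [← h1]
          exact rotationDist_rotSeq_le _ _ _
        · have hg' : ∀ g : ℕ → ℕ, (∀ i < s.v 0, g i < s.v 9) →
              digitVal (s.v 9) g (s.v 0) < digitVal (s.v 9) (s'.arr 7) (s.v 0) + 1 →
              rotSeq t g (s.v 0) ≠ u := by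
            intro g hgd hgl
            rcases Nat.lt_succ_iff_lt_or_eq.1 hgl with hgl | hgl
            · exact hg g hgd hgl
            · rw [rotSeq_congr (digitVal_injective hgd hd hgl)]
              exact h1
          rcases h3 with ⟨h4, h5, h6⟩ | ⟨h4, h5⟩
          · refine .inl ⟨by omega, by omega, h5, by omega, ?_⟩
            rwa [h6]
          · refine .inr ⟨h4, ?_⟩
            rw [h2, h18, if_neg]
            intro hle
            -- The current number was the last one, so a successful sequence would already have been
            -- refuted.
            obtain ⟨g, h6, h7⟩ := exists_rotSeq hle
            rw [← hs.len] at h6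
            refine hg' g (fun i _ => h6 i) ?_ h7
            rw [h5]
            exact digitVal_lt fun i _ => h6 i
      · exact absurd h.1 hne)
    (n := s.v 9 ^ s.v 0) (s := (Block.set 10 1).eval s)
    ⟨(Frame.refl _ _ s).set (by simp) _, by
      refine .inl ⟨by simp [Block.eval], by simpa [Block.eval] using h18, fun i _ => ?_, ?_, ?_⟩
      · simpa [Block.eval, h7] using hpos
      · rw [digitVal_zero (by simp [Block.eval, h7]), zero_add]
      · rw [digitVal_zero (f := ((Block.set 10 1).eval s).arr 7) (by simp [Block.eval, h7])]
        simp⟩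
  refine ⟨_, (r1.seq (r2.seq ((Block.set 0 (var 18)).realizes s'))).mono ?_, ?_⟩
  · have hp : 0 < s.v 9 ^ s.v 0 := pow_pos hpos _
    generalize s.v 9 ^ s.v 0 = N at hp
    generalize hM : (s.v 0 + 1) * (s.v 9 + 1) = M
    have hM' : 1 ≤ M := by rw [← hM]; exact Nat.mul_pos (by omega) (by omega)
    have a0 : N ≤ M * N := Nat.le_mul_of_pos_left _ hM'
    have a1 : (Block.set 10 1).cost + (Block.set 0 (var 18)).cost ≤
      ((Block.set 10 1).cost + (Block.set 0 (var 18)).cost) * (M * N) :=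
      Nat.le_mul_of_pos_right _ (by omega)
    have a2 : (C + 2 + (Block.set 10 1).cost + (Block.set 0 (var 18)).cost) * (M * N) =
      C * M * N + 2 * (M * N) +
        ((Block.set 10 1).cost + (Block.set 0 (var 18)).cost) * (M * N) := by ring
    rw [a2, add_mul]
    omega
  · rcases h with h | h
    · omega
    · simp [Block.eval, h.2]

/-! ### The algorithm -/

/-- Computes the kernels of the two trees. -/
def prepP : Prog :=
  .seq (Block.set 1 len).compile <| .seq (whileP 1 scan.compile) <|
  .seq (Block.seq (.set 5 (arr 1 (arr 0 0))) (.seq (.set 4 (arr 0 0)) (.set 8 (var 5)))).compile <|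
  .seq (whileP 4 emit.compile) <|
  .seq (Block.seq (.set 9 (var 3)) (.seq (.set 4 (len - var 1))
    (.seq (.set 7 (var 5)) (.set 8 0)))).compile
  (whileP 4 emit.compile)

theorem realizes_while_scan {s : AState} {n : ℕ} (h : s.v 1 = n) :
    Realizes (whileP 1 scan.compile) s (scan.eval^[n] s) ((scan.cost + 1) * n + 1) :=
  .while_iterate scan.realizes (fun j hj => by rw [iterate_scan_v_one]; omega)
    (by rw [iterate_scan_v_one]; omega)

theorem realizes_while_emit {s : AState} {n : ℕ} (h : s.v 4 = n) :
    Realizes (whileP 4 emit.compile) s (emit.eval^[n] s) ((emit.cost + 1) * n + 1) :=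
  .while_iterate emit.realizes (fun j hj => by rw [iterate_emit_v_four]; omega)
    (by rw [iterate_emit_v_four]; omega)

/-- Here `b` and `d` are the offsets of `t` and `u` in the joint numbering; variables `7` and `8`
translate one into the other. -/
theorem kernel_common {s : AState} {t u : OTree} {b d : ℕ} (htu : t.numLeaves = u.numLeaves)
    (hd : Detects (s.arr 2) (s.arr 3) d u) (hs : ∀ x, b + x + s.v 7 - s.v 8 = d + x)
    {c : ℕ → ℕ → Bool}
    (hc : ∀ x y, (x, y) ∈ ivs 0 t → (c x y ↔ (x, y) ∈ ivs 0 u)) :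
    kernel (common s) b t = kernel c 0 t := by
  refine kernel_congr fun x y hxy => ?_
  have hxy' : (x, y) ∈ ivs 0 t := (mem_ivs_add (d := b) (b := 0)).1 (by simpa using hxy)
  have h1 := mem_ivs_bounds hxy'
  rw [Bool.eq_iff_iff, zero_add, zero_add, hc x y hxy', common, decide_eq_true_eq, hs, hs,
    hd.iff (d + x) (d + y) (by omega) (by omega) (by omega)]
  simpa using mem_ivs_add (d := d) (b := 0) (x := x) (y := y) (s := u)

/-- Both codes are scanned as one word. The leaves of `u`, on the right, have offset `0` and those
of `t` have offset `u.numLeaves`; so the test subtracts this number when `t` is processed and adds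
it when `u` is. -/
theorem prepP_spec : ∃ C, ∀ (t u : OTree) (k : ℕ), t.numLeaves = u.numLeaves →
    ∃ (s : AState) (t' u' : OTree),
      Realizes prepP (.init (code t ++ code u) k) s (C * t.numLeaves) ∧ Stored s t' u' ∧
      (∀ i, s.arr 7 i = 0) ∧ s.v 18 = 0 ∧ s.v 0 = k ∧ rotationDist t' u' = rotationDist t u ∧
      ∀ m : ℕ, rotationDist t u ≤ m → t'.numLeaves ≤ 2 * m + 1 := by
  set b0 := Block.set 1 len with hb0
  set b1 := Block.seq (.set 5 (arr 1 (arr 0 0))) (.seq (.set 4 (arr 0 0)) (.set 8 (var 5))) with hb1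
  set b2 := Block.seq (.set 9 (var 3)) (.seq (.set 4 (len - var 1))
    (.seq (.set 7 (var 5)) (.set 8 0))) with hb2
  refine ⟨b0.cost + b1.cost + b2.cost + 4 * scan.cost + 4 * emit.cost + 11, fun t u k htu => ?_⟩
  have lt := length_code t
  have lu := length_code u
  have nt := one_le_numLeaves t
  set s0 := AState.init (code t ++ code u) k with hs0
  have r0 := b0.realizes s0
  set s1 := b0.eval s0 with hs1
  have i1 : s1.inp = code t ++ code u := rfl
  have h1 : s1.v 1 = (code t).length + (code u).length := by
    simp [hs1, hb0, Block.eval, hs0, AState.init]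
  have v1 : ∀ x, x ≠ 1 → s1.v x = if x = 0 then k else 0 := fun x hx => by
    simp [hs1, hb0, Block.eval, hs0, AState.init, hx]
  have a1 : ∀ a i, s1.arr a i = 0 := fun a i => rfl
  have S1 := scan_tree u s1 (code t) [] 0 (by simp [i1]) h1 (by rw [v1 2 (by simp)]; simp)
    (a1 _ _)
  set s2 := scan.eval^[(code u).length] s1 with hs2
  -- The scan of `t` starts from what the scan of `u` left behind: the counter and `Z` at the start
  -- of `u` both equal `u.numLeaves`.
  have S2 := scan_tree t s2 [] (code u) u.numLeaves (by rw [S1.inp, i1]; simp)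
    (by rw [S1.pos]; simp) (by rw [S1.leaves]; simp) (by simpa using S1.layout.root.2)
  have r1 := realizes_while_scan h1
  rw [Function.iterate_add_apply, ← hs2] at r1
  set s3 := scan.eval^[(code t).length] s2 with hs3
  rw [List.length_nil] at S2
  have h00 : s3.arr 0 0 = (code t).length := by simpa using S2.layout.root.1
  have hZt : s3.arr 1 (code t).length = u.numLeaves := by
    rw [S2.arrZ _ (by omega)]; simpa using S1.layout.root.2
  have v3 : ∀ x, x ≠ 1 → x ≠ 2 → s3.v x = if x = 0 then k else 0 := fun x h1 h2 => by
    rw [S2.other x h1 h2, S1.other x h1 h2, v1 x h1]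
  have a3 : ∀ a, 4 ≤ a → ∀ i, s3.arr a i = 0 := fun a ha i => by
    rw [S2.arr a ha, S1.arr a ha, a1]
  have r2 := b1.realizes s3
  have e4 : b1.eval s3 = ((s3.set 5 u.numLeaves).set 4 (code t).length).set 8 u.numLeaves := by
    simp [hb1, Block.eval, h00, hZt]
  set s4 := b1.eval s3 with hs4
  have a4 : s4.arr = s3.arr := by simp [e4]
  have E1 := emit_tree t s4 [] (code u) u.numLeaves (by simp [e4, S2.inp, S1.inp, i1])
    (by simp [e4, S2.pos]) (by rw [a4]; exact S2.layout) (by rw [a4]; simpa using hZt)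
    (fun j _ _ => by rw [a4, a3 4 (by decide)])
  rw [a4, if_pos (a3 4 (by decide) _), List.length_nil] at E1
  set c : ℕ → ℕ → Bool := fun x y => (x, y) ∈ ivs 0 t ∧ (x, y) ∈ ivs 0 u with hc
  have k1 : kernel (common s4) u.numLeaves t = kernel c 0 t := by
    refine kernel_common (d := 0) htu ?_ (fun x => ?_) fun x y h => by simp [hc, h]
    · rw [a4]
      exact S1.detects.congr (fun x _ h => S2.arrA x (by omega)) fun y _ h => S2.arrB y (by omega)
    · have : s4.v 7 = 0 := by simp [e4, v3]
      rw [this]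
      simp [e4]
  have r3 := realizes_while_emit (s := s4) (n := (code t).length) (by simp [e4])
  rw [k1] at E1
  set s5 := emit.eval^[(code t).length] s4 with hs5
  have o3 : s4.v 3 = 0 := by simp [e4, v3]
  have h53 : s5.v 3 = (code (kernel c 0 t)).length := by rw [E1.outLen, o3, zero_add]
  have h55 : s5.v 5 = u.numLeaves := by
    rw [E1.other 5 (by simp) (by simp) (by simp)]; simp [e4]
  have i5 : s5.inp = code t ++ code u := by rw [E1.inp, e4]; simp [S2.inp, S1.inp, i1]
  have h51 : s5.v 1 = (code t).length := by simpa using E1.pos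
  have r4 := b2.realizes s5
  have e6 : b2.eval s5 = (((s5.set 9 (code (kernel c 0 t)).length).set 4 (code u).length).set 7
      u.numLeaves).set 8 0 := by
    simp [hb2, Block.eval, h53, h55, i5, h51]
  set s6 := b2.eval s5 with hs6
  have a6 : ∀ a, a ≠ 4 → a ≠ 5 → s6.arr a = s3.arr a := fun a h h' => by
    rw [e6, ← a4, ← E1.arr a h h']; simp
  have d6 : ∀ j, (code t).length ≤ j + 1 → s6.arr 4 j = 0 := fun j hj => by
    have : s6.arr 4 j = s5.arr 4 j := by simp [e6]
    rw [this, E1.del j (by omega), a4, a3 4 (by decide)]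
  have E2 := emit_tree u s6 (code t) [] 0 (by simp [e6, i5]) (by simp [e6, h51])
    (by
      rw [a6 0 (by decide) (by decide), a6 1 (by decide) (by decide)]
      exact S1.layout.congr (fun j h _ => S2.arrE j (by omega)) fun j h _ => S2.arrZ j (by omega))
    (by
      rw [a6 1 (by decide) (by decide), S2.arrZ _ (by omega), S1.arrZ _ (by omega), a1])
    (fun j h _ => d6 j (by omega))
  rw [if_pos (d6 _ (by omega))] at E2
  have k2 : kernel (common s6) 0 u = kernel c 0 u := by
    refine kernel_common (d := u.numLeaves) htu.symm ?_ (fun x => ?_) fun x y h => by simp [hc, h]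
    · rw [a6 2 (by decide) (by decide), a6 3 (by decide) (by decide)]
      exact S2.detects
    · simp [e6]; omega
  have r5 := realizes_while_emit (s := s6) (n := (code u).length) (by simp [e6])
  rw [k2] at E2
  set s7 := emit.eval^[(code u).length] s6 with hs7
  have hcom : IsCommon c 0 t u := fun x y _ _ => by simp [hc]
  obtain ⟨q1, q2⟩ := kernel_spec le_rfl htu hcom
  have l1 := length_code (kernel c 0 t)
  have l2 := length_code (kernel c 0 u)
  have h63 : s6.v 3 = (code (kernel c 0 t)).length := by simp [e6, h53]
  have h79 : s7.v 9 = (code (kernel c 0 t)).length := by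
    rw [E2.other 9 (by simp) (by simp) (by simp)]; simp [e6]
  refine ⟨s7, kernel c 0 t, kernel c 0 u, (r0.seq (r1.seq (r2.seq (r3.seq (r4.seq r5))))).mono ?_,
    ⟨h79, by omega, ?_, ?_⟩, fun i => ?_, ?_, ?_, q2, fun m hm => numLeaves_kernel_le htu hcom hm⟩
  · have c1 : (scan.cost + 1) * ((code t).length + (code u).length) ≤
        (scan.cost + 1) * (4 * t.numLeaves) := Nat.mul_le_mul_left _ (by omega)
    have c2 : (emit.cost + 1) * ((code t).length + (code u).length) ≤
        (emit.cost + 1) * (4 * t.numLeaves) := Nat.mul_le_mul_left _ (by omega)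
    have c3 : b0.cost + b1.cost + b2.cost + 3 ≤ (b0.cost + b1.cost + b2.cost + 3) * t.numLeaves :=
      Nat.le_mul_of_pos_right _ nt
    have c4 : (b0.cost + b1.cost + b2.cost + 4 * scan.cost + 4 * emit.cost + 11) * t.numLeaves =
        (b0.cost + b1.cost + b2.cost + 3) * t.numLeaves + (scan.cost + 1) * (4 * t.numLeaves) +
          (emit.cost + 1) * (4 * t.numLeaves) := by ring
    rw [mul_add (emit.cost + 1)] at c2
    omega
  · refine Holds.congr (f := s5.arr 5) (by simpa [o3] using E1.out) fun j _ h => ?_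
    rw [E2.outOld j (by omega)]
    simp [e6]
  · rw [h79, ← h63]
    exact E2.out
  · rw [E2.arr 7 (by decide) (by decide), a6 7 (by decide) (by decide), a3 7 (by decide)]
  · rw [E2.other 18 (by simp) (by simp) (by simp), e6]
    simp [E1.other 18, e4, v3]
  · rw [E2.other 0 (by simp) (by simp) (by simp), e6]
    simp [E1.other 0, e4, v3]

/-! ### The total running time -/

theorem sq_mul_five_pow_le (k : ℕ) : k ^ 2 * 5 ^ k ≤ 5 * 7 ^ k := by
  by_cases hk : k < 6
  · interval_cases k <;> norm_num
  · obtain ⟨j, rfl⟩ : ∃ j, k = 6 + j := ⟨k - 6, by omega⟩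
    clear hk
    induction j with
    | zero => norm_num
    | succ j ih =>
      -- From `k = 6` on, `((k + 1) / k) ^ 2` is below `7 / 5`; this first holds at `6`, whence the
      -- direct check of smaller `k`.
      have h : (6 + (j + 1)) ^ 2 * 5 ≤ 7 * (6 + j) ^ 2 := by ring_nf; nlinarith
      calc (6 + (j + 1)) ^ 2 * 5 ^ (6 + (j + 1)) = (6 + (j + 1)) ^ 2 * 5 * 5 ^ (6 + j) := by ring
        _ ≤ 7 * (6 + j) ^ 2 * 5 ^ (6 + j) := Nat.mul_le_mul_right _ h
        _ = 7 * ((6 + j) ^ 2 * 5 ^ (6 + j)) := by ring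
        _ ≤ 7 * (5 * 7 ^ (6 + j)) := Nat.mul_le_mul_left _ ih
        _ = 5 * 7 ^ (6 + (j + 1)) := by ring

/-- For positive `k` the code length is at most `5 * k`, and the polynomial factor is at most `12 *
k ^ 2`. The gap between the bases `5` and `7` absorbs it. For `k = 0` the convention `0 ^ 0 = 1`
matters. -/
theorem search_cost_le {k m : ℕ} (hm : m ≤ 4 * k + 1) :
    (k + 1) * (m + 1) * m ^ k ≤ 60 * (7 * k) ^ k := by
  rcases Nat.eq_zero_or_pos k with rfl | hk
  · simp; omega
  · calc (k + 1) * (m + 1) * m ^ k ≤ (2 * k) * (6 * k) * (5 * k) ^ k := by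
          gcongr <;> omega
      _ = 12 * (k ^ 2 * 5 ^ k) * k ^ k := by rw [mul_pow]; ring
      _ ≤ 12 * (5 * 7 ^ k) * k ^ k := 
          Nat.mul_le_mul_right _ (Nat.mul_le_mul_left _ (sq_mul_five_pow_le k))
      _ = 60 * (7 * k) ^ k := by rw [mul_pow]; ring

/-- The program for the rotation distance: it computes the kernels, and searches if they are small
enough. -/
def rotationP : Prog :=
  .seq prepP (iteP (var 9 - (var 0 + var 0 + var 0 + var 0 + 1)) (Block.set 0 0).compile searchP)

/-- A kernel with at most `2 * k + 1` leaves has a code of length at most `2 * (2 * k + 1) - 1 = 4 *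
k + 1`. A longer code proves that the distance exceeds `k`; a shorter one makes the search
affordable. -/
theorem rotationP_spec : ∃ C, ∀ (t u : OTree) (k : ℕ), t.numLeaves = u.numLeaves →
    ∃ s, Realizes rotationP (.init (code t ++ code u) k) s (C * (t.numLeaves + (7 * k) ^ k)) ∧
      s.v 0 = if rotationDist t u ≤ k then 1 else 0 := by
  obtain ⟨C, hC⟩ := prepP_spec
  obtain ⟨D, hD⟩ := searchP_spec
  set e : Expr := var 9 - (var 0 + var 0 + var 0 + var 0 + 1) with he
  refine ⟨C + 60 * D + e.cost + (Block.set 0 0).cost + 1, fun t u k htu => ?_⟩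
  obtain ⟨s, t', u', r, hs, h7, h18, rfl, hdist, hle⟩ := hC t u k htu
  have hn := one_le_numLeaves t
  have cost : ∀ N, N ≤ D * (60 * (7 * s.v 0) ^ s.v 0) + (Block.set 0 0).cost →
      C * t.numLeaves + (e.cost + (N + 1)) ≤
      (C + 60 * D + e.cost + (Block.set 0 0).cost + 1) *
        (t.numLeaves + (7 * s.v 0) ^ s.v 0) := by
    intro N hN
    generalize (7 * s.v 0) ^ s.v 0 = P at hN
    have h1 : e.cost + (Block.set 0 0).cost + 1 ≤
      (e.cost + (Block.set 0 0).cost + 1) * (t.numLeaves + P) :=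
      Nat.le_mul_of_pos_right _ (by omega)
    have h2 : (C + 60 * D + e.cost + (Block.set 0 0).cost + 1) * (t.numLeaves + P) =
      C * t.numLeaves + C * P + 60 * D * t.numLeaves + D * (60 * P) +
        (e.cost + (Block.set 0 0).cost + 1) * (t.numLeaves + P) := by ring
    omega
  have hev : e.eval s = s.v 9 - (s.v 0 + s.v 0 + s.v 0 + s.v 0 + 1) := by simp [he]
  by_cases h : s.v 9 ≤ 4 * s.v 0 + 1
  · obtain ⟨s', r', h0⟩ := hD s t' u' hs h7 h18
    refine ⟨s', (r.seq (.iteP_false (e := e) (by omega) r')).mono (cost _ ?_), by rw [h0, hdist]⟩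
    exact (Nat.mul_le_mul_left D (search_cost_le h)).trans (Nat.le_add_right _ _)
  · refine ⟨_, (r.seq (.iteP_true (e := e) (by omega) ((Block.set 0 0).realizes s))).mono
      (cost _ (Nat.le_add_left _ _)), ?_⟩
    rw [if_neg]
    · simp [Block.eval]
    · intro hd
      have h1 := hle _ hd
      have h2 := length_code t'
      have h3 := hs.len
      omega

theorem rotationP_decides : ∃ C, rotationDistanceProblem.DecidedInTime rotationP
    fun (x : TreePair) (k : ℕ) => C * (x.fst.numLeaves + (7 * k) ^ k) := by
  obtain ⟨C, hC⟩ := rotationP_spec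
  refine ⟨C, fun x k => ?_⟩
  obtain ⟨s, r, h⟩ := hC x.fst x.snd k x.numLeaves_eq
  obtain ⟨σ, T, h1, h2, h3⟩ := r _ (rel_init _ k)
  exact ⟨σ, T, h1, h2, (h3.reg 0).trans (by convert h; rfl)⟩

end RAM

/-! ### Fixed-parameter tractability -/

theorem ParamProblem.DecidedInTime.mono {Q : ParamProblem} {p : RAM.Prog} {T T' : Q.Inst → ℕ → ℕ}
    (h : Q.DecidedInTime p T) (hT : ∀ x k, T x k ≤ T' x k) : Q.DecidedInTime p T' := fun x k =>
  let ⟨s, t, h1, h2, h3⟩ := h x k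
  ⟨s, t, h1, h2.trans (hT x k), h3⟩

theorem mainTheorem3 :
    rotationDistanceProblem.FixedParameterTractable ∧
      ∃ (p : RAM.Prog) (C : ℕ),
        rotationDistanceProblem.DecidedInTime p
          fun (x : TreePair) (k : ℕ) => C * (x.fst.numLeaves + (7 * k) ^ k) := by
  obtain ⟨C, hC⟩ := RAM.rotationP_decides
  -- The input length is at least the number of leaves and at least `1`, so with `f k = (7 * k) ^ k
  -- + 1` the product `f k * |x|` dominates the sum of the two terms.
  refine ⟨⟨RAM.rotationP, 1, C, fun k => (7 * k) ^ k + 1, hC.mono fun x k => ?_⟩, _, C, hC⟩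
  refine Nat.mul_le_mul_left C ?_
  have h1 := OTree.length_code x.fst
  have h2 := OTree.one_le_numLeaves x.fst
  have h3 : (rotationDistanceProblem.encode x).length =
    (OTree.code x.fst).length + (OTree.code x.snd).length := List.length_append
  rw [pow_one, add_mul, one_mul, add_comm]
  exact add_le_add (Nat.le_mul_of_pos_right _ (by omega)) (by omega)
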